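/- Let $P$ be a closed simple polygon in the plane (region with interior $\operatorname{int}P$). Points $p,q\in P$ are visible to each other if the relatively open segment $pq$ lies in $\operatorname{int}P$; $\mathrm{VP}(q)$ denotes the set of points of $P$ visible from $q$. The long width $LW$ is the maximum distance between two parallel lines through convex vertices of $P$ that have $P$ between them. The short width $SW$ is the minimum distance between two (possibly coinciding) parallel lines tangent to $P$ from the inside at two reflex vertices $a,b$, where the segment $ab$ lies in $P$ and at each of $a,b$ both boundary edges lie on the side of the tangent line facing away from the other line. Put $\mathrm{AR}=LW/SW$, with $\mathrm{AR}=\infty$ if $SW=0$ and $\mathrm{AR}=0$ if there is no such pair of tangents; in all other cases $1\le\mathrm{AR}<\infty$. There is an absolute constant $C$ such that the following holds for every simple polygon $P$ with $\mathrm{AR}<\infty$. Let $\overline{xy}$ (the source) and $\overline{uv}$ (the target) be segments contained in $P$ which are not overlapping segments of one line (that is, if $x,y,u,v$ are collinear, then the two segments are disjoint), and suppose that the target is weakly visible from the source: every point of $\overline{uv}$ is visible from some point of $\overline{xy}$. Then there is a finite set $\mathcal S\subset\overline{xy}$ with $$|\mathcal S|\le C\cdot\max(1,\mathrm{AR})\qquad\text{and}\qquad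 \overline{uv}\subseteq\bigcup_{s\in\mathcal S}\mathrm{VP}(s).$$ -/

import Mathlib

open scoped ENNReal NNReal

noncomputable section

namespace Polygon

variable {n : ℕ} (P : Polygon (EuclideanSpace ℝ (Fin 2)) n)

/-- A polygon is simple if it has at least three vertices, its vertices are distinct, consecutive
edges meet only in their common vertex, and all other pairs of edges are disjoint. -/
structure IsSimple : Prop where
  three_le : 3 ≤ n
  injective : Function.Injective P.vertices
  consecutive : ∀ i : Fin n,
    P.edgeSet ℝ i ∩ P.edgeSet ℝ (finRotate n i) = {P (finRotate n i)}
  disjoint : ∀ i j : Fin n, j ≠ i → j ≠ finRotate n i → i ≠ finRotate n j →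
    Disjoint (P.edgeSet ℝ i) (P.edgeSet ℝ j)

/-- The closed region of the plane bounded by the polygon: its edges, together with all bounded
connected components of the complement of the edges. -/
def region : Set (EuclideanSpace ℝ (Fin 2)) :=
  P.boundary ℝ ∪
    {z | z ∉ P.boundary ℝ ∧ Bornology.IsBounded (connectedComponentIn (P.boundary ℝ)ᶜ z)}

/-- The visibility polygon of `q`: the points `z` of the region such that the relatively open
segment from `q` to `z` lies in the interior of the region. -/
def visibilityPolygon (q : EuclideanSpace ℝ (Fin 2)) : Set (EuclideanSpace ℝ (Fin 2)) :=
  {z | z ∈ P.region ∧ openSegment ℝ q z ⊆ interior P.region}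

/-- The interior angle at the vertex `i` is at most `π`: near that vertex the region is convex. -/
def IsConvexVertex (i : Fin n) : Prop :=
  ∃ r : ℝ, 0 < r ∧ Convex ℝ (P.region ∩ Metric.ball (P i) r)

/-- The interior angle at the vertex `i` exceeds `π`. -/
def IsReflexVertex (i : Fin n) : Prop := ¬ P.IsConvexVertex i

/-- `P.IsOuterStrip i j ν`: the two lines with unit normal `ν` through the convex vertices `i` and
`j` are supporting lines of the region, which lies between them. -/
def IsOuterStrip (i j : Fin n) (ν : EuclideanSpace ℝ (Fin 2)) : Prop :=
  ‖ν‖ = 1 ∧ P.IsConvexVertex i ∧ P.IsConvexVertex j ∧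
    ∀ z ∈ P.region, inner ℝ (P i) ν ≤ inner ℝ z ν ∧ inner ℝ z ν ≤ inner ℝ (P j) ν

/-- `P.IsInnerStrip i j ν`: the two lines with unit normal `ν` through the reflex vertices `i` and
`j` are tangent to the polygon at these vertices from inside, and they bound a passage of the
polygon. At each of the two vertices both edges lie on the side of the tangent line that faces away
from the other line (as the vertex is reflex, a piece of the tangent line around the vertex then
lies in the region), and the passage between the two vertices is not cut off by the boundary. -/
def IsInnerStrip (i j : Fin n) (ν : EuclideanSpace ℝ (Fin 2)) : Prop :=
  ‖ν‖ = 1 ∧ P.IsReflexVertex i ∧ P.IsReflexVertex j ∧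
    inner ℝ (P (finRotate n i)) ν ≤ inner ℝ (P i) ν ∧
    inner ℝ (P ((finRotate n).symm i)) ν ≤ inner ℝ (P i) ν ∧
    inner ℝ (P i) ν ≤ inner ℝ (P j) ν ∧
    inner ℝ (P j) ν ≤ inner ℝ (P (finRotate n j)) ν ∧
    inner ℝ (P j) ν ≤ inner ℝ (P ((finRotate n).symm j)) ν ∧
    segment ℝ (P i) (P j) ⊆ P.region

/-- The long width: the largest distance between the two lines of an outer strip. -/
def longWidth : ℝ≥0∞ :=
  ⨆ (i : Fin n) (j : Fin n) (ν : EuclideanSpace ℝ (Fin 2)) (_ : P.IsOuterStrip i j ν),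
    ENNReal.ofReal (inner ℝ (P j) ν - inner ℝ (P i) ν)

/-- The short width: the smallest distance between the two lines of an inner strip
(`⊤` if there is no inner strip). -/
def shortWidth : ℝ≥0∞ :=
  ⨅ (i : Fin n) (j : Fin n) (ν : EuclideanSpace ℝ (Fin 2)) (_ : P.IsInnerStrip i j ν),
    ENNReal.ofReal (inner ℝ (P j) ν - inner ℝ (P i) ν)

/-- The line aspect ratio: it is `⊤` if the short width is `0`, and `0` if there is no inner
strip; in all other cases it is a real number that is at least `1`. -/
def lineAspectRatio : ℝ≥0∞ := P.longWidth / P.shortWidth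

end Polygon

end

open scoped ENNReal NNReal

noncomputable section

namespace Polygon

/-! ### The cross product of the plane. -/

section

/-! Any two points of the region are at distance at most LW (`IsSimple.le_longWidth`), so the source
splits into O(max(1, AR)) pieces of length at most SW (`IsSimple.exists_cells`). It remains to serve
each piece with boundedly many guards.

Let a target point t be seen from a point s of a short piece. Translate the line of sight parallel
to itself, with its ends sliding along source and target. If reflex vertices stopped it on both
sides, they would span an inner strip narrower than the piece, hence narrower than SW
(`shortWidth_lt_of_obstacles`). So on one side it moves freely until it reaches an end of the piece,
which then sees t, or an end of the target (`IsSimple.obstacle_or_visible`). In the latter case the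
target points between t and that end, off the line of the source, are all seen from a whole interval
of positions, whose length is at least a fixed multiple of the distance from t to that end. One
position then serves all such t (`exists_common_position`): on a fine enough finite grid, every grid
position would fail for some t, but the longest of the corresponding intervals contains a grid
position and covers all the smaller failures. The two ends of the piece, one common position for
each end of the target, and one guard for each end of the target itself make six guards
(`IsSimple.guarded_of_short`).

The multiple degenerates where the source meets the line of the target. As the polygon has finitely
many vertices, near that crossing a single position on each side sees everything that the positions
closer to the crossing see off the line of the source (`IsSimple.exists_guard_near_line`). Cutting
the source there, and the target at the line of the source, reduces the general case to the previous
one. Collinear segments need a single guard.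

Two facts about simple polygons support this. Where the exterior protrudes furthest into an open
set, there is a reflex vertex with a tangent line (`IsSimple.exists_reflexVertex`). A linear
function on the region attains its maximum at a convex vertex (`IsSimple.exists_convexVertex`); this
needs that the exterior does not lie on both sides of an edge, which follows from the jump of the
total angle across the edge. -/

/-- The cross product of two vectors of the plane. -/
def cross (a b : EuclideanSpace ℝ (Fin 2)) : ℝ := a 0 * b 1 - a 1 * b 0

lemma cross_add_left (a b c : EuclideanSpace ℝ (Fin 2)) :
    cross (a + b) c = cross a c + cross b c := by
  simp [cross]; ring

lemma cross_add_right (a b c : EuclideanSpace ℝ (Fin 2)) :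
    cross a (b + c) = cross a b + cross a c := by
  simp [cross]; ring

lemma cross_sub_left (a b c : EuclideanSpace ℝ (Fin 2)) :
    cross (a - b) c = cross a c - cross b c := by
  simp [cross]; ring

lemma cross_sub_right (a b c : EuclideanSpace ℝ (Fin 2)) :
    cross a (b - c) = cross a b - cross a c := by
  simp [cross]; ring

lemma cross_smul_left (r : ℝ) (a b : EuclideanSpace ℝ (Fin 2)) :
    cross (r • a) b = r * cross a b := by
  simp [cross]; ring

lemma cross_smul_right (r : ℝ) (a b : EuclideanSpace ℝ (Fin 2)) :
    cross a (r • b) = r * cross a b := by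
  simp [cross]; ring

lemma cross_neg_left (a b : EuclideanSpace ℝ (Fin 2)) : cross (-a) b = -cross a b := by
  simp [cross]; ring

lemma cross_neg_right (a b : EuclideanSpace ℝ (Fin 2)) : cross a (-b) = -cross a b := by
  simp [cross]; ring

@[simp] lemma cross_self (a : EuclideanSpace ℝ (Fin 2)) : cross a a = 0 := by
  simp [cross]; ring

@[simp] lemma cross_zero_left (a : EuclideanSpace ℝ (Fin 2)) : cross 0 a = 0 := by
  simp [cross]

@[simp] lemma cross_zero_right (a : EuclideanSpace ℝ (Fin 2)) : cross a 0 = 0 := by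
  simp [cross]

lemma cross_comm (a b : EuclideanSpace ℝ (Fin 2)) : cross a b = -cross b a := by
  simp [cross]; ring

@[fun_prop]
lemma continuous_cross {X : Type*} [TopologicalSpace X] {f g : X → EuclideanSpace ℝ (Fin 2)}
    (hf : Continuous f) (hg : Continuous g) : Continuous fun x => cross (f x) (g x) := by
  unfold cross; fun_prop

/-- Expansion of a vector of the plane in a basis. -/
lemma cross_smul_eq (a b c : EuclideanSpace ℝ (Fin 2)) :
    cross a b • c = cross c b • a + cross a c • b := by
  ext i
  fin_cases i <;> simp [cross] <;> ring

lemma eq_smul_of_cross_eq_zero {a b : EuclideanSpace ℝ (Fin 2)} (ha : a ≠ 0) (h : cross a b = 0) :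
    ∃ c : ℝ, b = c • a := by
  have hn : a 0 * a 0 + a 1 * a 1 ≠ 0 := by
    intro h0
    apply ha
    ext i
    fin_cases i <;> simp <;> nlinarith [mul_self_nonneg (a 0), mul_self_nonneg (a 1)]
  refine ⟨(a 0 * b 0 + a 1 * b 1) / (a 0 * a 0 + a 1 * a 1), ?_⟩
  simp only [cross] at h
  ext i
  fin_cases i
  · simp only [Fin.zero_eta, PiLp.smul_apply, smul_eq_mul]
    rw [div_mul_eq_mul_div, eq_div_iff hn]
    linear_combination (-a 1) * h
  · simp only [Fin.mk_one, PiLp.smul_apply, smul_eq_mul]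
    rw [div_mul_eq_mul_div, eq_div_iff hn]
    linear_combination (a 0) * h

/-! ### The region, and the shape of the boundary near one of its points. -/

variable {n : ℕ} {P : Polygon (EuclideanSpace ℝ (Fin 2)) n}

lemma edgeSet_eq_segment (i : Fin n) : P.edgeSet ℝ i = segment ℝ (P i) (P (finRotate n i)) :=
  affineSegment_eq_segment ℝ _ _

lemma mem_edgeSet {i : Fin n} {z : EuclideanSpace ℝ (Fin 2)} :
    z ∈ P.edgeSet ℝ i ↔ ∃ p : ℝ, 0 ≤ p ∧ p ≤ 1 ∧ z - P i = p • (P (finRotate n i) - P i) := by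
  rw [edgeSet_eq_segment, segment_eq_image']
  constructor
  · rintro ⟨p, ⟨h0, h1⟩, rfl⟩
    exact ⟨p, h0, h1, by simp⟩
  · rintro ⟨p, h0, h1, h⟩
    exact ⟨p, ⟨h0, h1⟩, by simp only [← h, add_sub_cancel]⟩

lemma left_mem_edgeSet (i : Fin n) : P i ∈ P.edgeSet ℝ i := by
  rw [edgeSet_eq_segment]; exact left_mem_segment ..

lemma edgeSet_subset_boundary (i : Fin n) : P.edgeSet ℝ i ⊆ P.boundary ℝ :=
  Set.subset_iUnion (fun i => P.edgeSet ℝ i) i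

lemma isCompact_edgeSet (i : Fin n) : IsCompact (P.edgeSet ℝ i) := by
  rw [edgeSet_eq_segment, segment_eq_image']
  exact isCompact_Icc.image (by fun_prop)

lemma isCompact_boundary : IsCompact (P.boundary ℝ) := isCompact_iUnion isCompact_edgeSet

lemma vertex_mem_boundary (i : Fin n) : P i ∈ P.boundary ℝ :=
  edgeSet_subset_boundary i (left_mem_edgeSet i)

lemma boundary_subset_region : P.boundary ℝ ⊆ P.region := Set.subset_union_left

lemma boundary_subset_convexHull : P.boundary ℝ ⊆ convexHull ℝ (Set.range P) := by
  refine Set.iUnion_subset fun i => ?_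
  rw [edgeSet_eq_segment]
  exact (convex_convexHull ℝ _).segment_subset (subset_convexHull _ _ ⟨_, rfl⟩)
    (subset_convexHull _ _ ⟨_, rfl⟩)

lemma notMem_region {z : EuclideanSpace ℝ (Fin 2)} :
    z ∉ P.region ↔ z ∉ P.boundary ℝ ∧
      ¬ Bornology.IsBounded (connectedComponentIn (P.boundary ℝ)ᶜ z) := by
  simp [region]; tauto

/-- A connected set off the boundary that meets the exterior lies in the exterior. -/
lemma subset_compl_region {C : Set (EuclideanSpace ℝ (Fin 2))} (hC : IsPreconnected C)
    (hb : C ⊆ (P.boundary ℝ)ᶜ) {z : EuclideanSpace ℝ (Fin 2)} (hz : z ∈ C) (hzr : z ∉ P.region) :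
    C ⊆ P.regionᶜ := by
  intro w hw
  rw [Set.mem_compl_iff, notMem_region]
  refine ⟨hb hw, ?_⟩
  have : w ∈ connectedComponentIn (P.boundary ℝ)ᶜ z :=
    hC.subset_connectedComponentIn hz hb hw
  rw [← connectedComponentIn_eq this]
  exact (notMem_region.1 hzr).2

lemma isClosed_region : IsClosed P.region := by
  rw [← isOpen_compl_iff, Metric.isOpen_iff]
  intro z hz
  have hzb : z ∈ (P.boundary ℝ)ᶜ := (notMem_region.1 hz).1
  obtain ⟨r, hr, h⟩ := Metric.isOpen_iff.1 isCompact_boundary.isClosed.isOpen_compl z hzb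
  exact ⟨r, hr, subset_compl_region (convex_ball z r).isPreconnected h
    (Metric.mem_ball_self hr) hz⟩

/-- A linear function on the region is bounded by its values at the vertices. -/
lemma exists_le_vertex {z : EuclideanSpace ℝ (Fin 2)} (hz : z ∈ P.region)
    (f : EuclideanSpace ℝ (Fin 2) →L[ℝ] ℝ) : ∃ i, f z ≤ f (P i) := by
  by_contra! hlt
  have hbd : ∀ w ∈ P.boundary ℝ, f w < f z := by
    intro w hw
    have : convexHull ℝ (Set.range P) ⊆ {w | f w < f z} := by
      refine convexHull_min ?_ (convex_halfSpace_lt f.isLinear _)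
      rintro _ ⟨i, rfl⟩
      exact hlt i
    exact this (boundary_subset_convexHull hw)
  have hzb : z ∉ P.boundary ℝ := fun h => lt_irrefl _ (hbd z h)
  have hbdd : Bornology.IsBounded (connectedComponentIn (P.boundary ℝ)ᶜ z) := by
    by_contra h
    exact (notMem_region.2 ⟨hzb, h⟩) hz
  -- The half-plane `f ≥ f z` misses the boundary, so it lies in the component of `z`, which is
  -- bounded: a contradiction.
  have hsub : {w | f z ≤ f w} ⊆ connectedComponentIn (P.boundary ℝ)ᶜ z := by
    refine (convex_halfSpace_ge f.isLinear (f z)).isPreconnected.subset_connectedComponentIn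
      (le_refl (f z)) ?_
    intro w hw hwb
    exact absurd (hbd w hwb) (not_lt.2 hw)
  by_cases hf : f = 0
  · have huniv : (Set.univ : Set (EuclideanSpace ℝ (Fin 2))) ⊆ connectedComponentIn (P.boundary ℝ)ᶜ z :=
      fun w _ => hsub (by simp [hf])
    exact NormedSpace.unbounded_univ ℝ _ (hbdd.subset huniv)
  · obtain ⟨w, hw⟩ : ∃ w, 0 < f w := by
      obtain ⟨w, hw⟩ : ∃ w, f w ≠ 0 := by
        by_contra! h; exact hf (by ext w; simp [h])
      rcases lt_or_gt_of_ne hw with h | h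
      · exact ⟨-w, by simpa using h⟩
      · exact ⟨w, h⟩
    have hw0 : w ≠ 0 := by rintro rfl; simp at hw
    obtain ⟨R, hR⟩ := (hbdd.subset hsub).subset_closedBall z
    have h1 : z + ((|R| + 1) / ‖w‖) • w ∈ Metric.closedBall z R := by
      apply hR
      simp only [Set.mem_ofPred_eq, map_add, map_smul, smul_eq_mul]
      have : 0 ≤ (|R| + 1) / ‖w‖ * f w := by positivity
      linarith
    have h2 : 0 < ‖w‖ := norm_pos_iff.2 hw0
    rw [mem_closedBall_iff_norm] at h1
    simp only [add_sub_cancel_left, norm_smul, Real.norm_eq_abs] at h1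
    rw [abs_of_nonneg (by positivity), div_mul_cancel₀ _ h2.ne'] at h1
    linarith [le_abs_self R]

namespace IsSimple

lemma finRotate_ne (hP : P.IsSimple) (i : Fin n) : finRotate n i ≠ i := by
  have := hP.three_le
  obtain ⟨m, rfl⟩ : ∃ m, n = m + 2 := ⟨n - 2, by omega⟩
  rw [finRotate_apply]
  intro h
  simp at h

lemma vertex_ne (hP : P.IsSimple) (i : Fin n) : P (finRotate n i) ≠ P i :=
  fun h => hP.finRotate_ne i (hP.injective h)

lemma inter_eq (hP : P.IsSimple) {i j : Fin n} (hij : j ≠ i) {z : EuclideanSpace ℝ (Fin 2)}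
    (hi : z ∈ P.edgeSet ℝ i) (hj : z ∈ P.edgeSet ℝ j) :
    (j = finRotate n i ∧ z = P j) ∨ (i = finRotate n j ∧ z = P i) := by
  by_cases h1 : j = finRotate n i
  · left
    refine ⟨h1, ?_⟩
    have := hP.consecutive i
    rw [← h1] at this
    have h : z ∈ P.edgeSet ℝ i ∩ P.edgeSet ℝ j := ⟨hi, hj⟩
    rwa [this] at h
  by_cases h2 : i = finRotate n j
  · right
    refine ⟨h2, ?_⟩
    have := hP.consecutive j
    rw [← h2] at this
    have h : z ∈ P.edgeSet ℝ j ∩ P.edgeSet ℝ i := ⟨hj, hi⟩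
    rwa [this] at h
  exact absurd hj (Set.disjoint_left.1 (hP.disjoint i j hij h1 h2) hi)

lemma vertex_notMem_edgeSet (hP : P.IsSimple) {k j : Fin n} (h1 : j ≠ k)
    (h2 : j ≠ (finRotate n).symm k) : P k ∉ P.edgeSet ℝ j := by
  intro h
  rcases hP.inter_eq h1 (left_mem_edgeSet k) h with ⟨_, h'⟩ | ⟨h', _⟩
  · exact h1 (hP.injective h').symm
  · apply h2; rw [h', Equiv.symm_apply_apply]

/-- A point off some of the edges has a ball disjoint from these edges. -/
lemma exists_ball_disjoint (s : Set (Fin n)) {a : EuclideanSpace ℝ (Fin 2)}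
    (h : ∀ j ∈ s, a ∉ P.edgeSet ℝ j) :
    ∃ r > 0, ∀ z ∈ Metric.ball a r, ∀ j ∈ s, z ∉ P.edgeSet ℝ j := by
  have hcl : IsClosed (⋃ j ∈ s, P.edgeSet ℝ j) :=
    s.toFinite.isClosed_biUnion fun j _ => (isCompact_edgeSet j).isClosed
  obtain ⟨r, hr, hsub⟩ := Metric.isOpen_iff.1 hcl.isOpen_compl a (by simpa using h)
  exact ⟨r, hr, fun z hz j hj hzj => hsub hz (Set.mem_biUnion hj hzj)⟩

/-- Near a boundary point, the boundary of a simple polygon is a line or a corner at a vertex. -/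
theorem local_structure (hP : P.IsSimple) {a : EuclideanSpace ℝ (Fin 2)} (ha : a ∈ P.boundary ℝ) :
    (∃ d : EuclideanSpace ℝ (Fin 2), d ≠ 0 ∧ ∃ r > 0, ∀ z ∈ Metric.ball a r,
      (z ∈ P.boundary ℝ ↔ cross d (z - a) = 0)) ∨
    (∃ k : Fin n, a = P k ∧
      cross (P (finRotate n k) - P k) (P ((finRotate n).symm k) - P k) ≠ 0 ∧
      ∃ r > 0, ∀ z ∈ Metric.ball a r, (z ∈ P.boundary ℝ ↔
        (∃ p : ℝ, 0 ≤ p ∧ z - a = p • (P (finRotate n k) - P k)) ∨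
        (∃ p : ℝ, 0 ≤ p ∧ z - a = p • (P ((finRotate n).symm k) - P k)))) := by
  by_cases hv : ∃ k, a = P k
  · obtain ⟨k, rfl⟩ := hv
    set k' := (finRotate n).symm k with hk'
    have hkk : finRotate n k' = k := Equiv.apply_symm_apply _ _
    set d₁ := P (finRotate n k) - P k with hd₁
    set d₂ := P k' - P k with hd₂
    have hd₁0 : d₁ ≠ 0 := sub_ne_zero.2 (hP.vertex_ne k)
    have hd₂0 : d₂ ≠ 0 := by
      have := hP.vertex_ne k'
      rw [hkk] at this
      exact sub_ne_zero.2 this.symm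
    obtain ⟨r₀, hr₀, hdisj⟩ := exists_ball_disjoint (P := P) (a := P k) {j | j ≠ k ∧ j ≠ k'}
      (fun j hj => hP.vertex_notMem_edgeSet hj.1 hj.2)
    have hn₁ := norm_pos_iff.2 hd₁0
    have hn₂ := norm_pos_iff.2 hd₂0
    -- Radius `r₀` keeps away all edges not ending at the vertex; the lengths of the two edges at
    -- the vertex make edges and rays agree inside the ball.
    have key : ∀ z ∈ Metric.ball (P k) (min r₀ (min ‖d₁‖ ‖d₂‖)), (z ∈ P.boundary ℝ ↔
        (∃ p : ℝ, 0 ≤ p ∧ z - P k = p • d₁) ∨ (∃ p : ℝ, 0 ≤ p ∧ z - P k = p • d₂)) := by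
      intro z hz
      have hz0 : z ∈ Metric.ball (P k) r₀ := Metric.ball_subset_ball (min_le_left _ _) hz
      rw [mem_ball_iff_norm, lt_min_iff, lt_min_iff] at hz
      constructor
      · intro hzb
        obtain ⟨j, hj⟩ := Set.mem_iUnion.1 hzb
        by_cases hjk : j = k
        · subst hjk
          obtain ⟨p, hp, _, h⟩ := mem_edgeSet.1 hj
          exact Or.inl ⟨p, hp, h⟩
        by_cases hjk' : j = k'
        · rw [hjk'] at hj
          obtain ⟨p, hp, hp1, h⟩ := mem_edgeSet.1 hj
          rw [hkk] at h
          refine Or.inr ⟨1 - p, by linarith, ?_⟩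
          have : z - P k = (z - P k') + (P k' - P k) := by abel
          rw [this, h, hd₂]
          module
        · exact absurd hj (hdisj z hz0 j ⟨hjk, hjk'⟩)
      · rintro (⟨p, hp, h⟩ | ⟨p, hp, h⟩)
        · refine edgeSet_subset_boundary k (mem_edgeSet.2 ⟨p, hp, ?_, h⟩)
          rw [h, norm_smul, Real.norm_of_nonneg hp] at hz
          nlinarith
        · refine edgeSet_subset_boundary k' (mem_edgeSet.2 ⟨1 - p, ?_, by linarith, ?_⟩)
          · rw [h, norm_smul, Real.norm_of_nonneg hp] at hz
            nlinarith
          · rw [hkk]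
            have : z - P k' = (z - P k) - (P k' - P k) := by abel
            rw [this, h, hd₂]
            module
    have hrpos : 0 < min r₀ (min ‖d₁‖ ‖d₂‖) := by positivity
    by_cases hc : cross d₁ d₂ = 0
    · left
      refine ⟨d₁, hd₁0, _, hrpos, ?_⟩
      obtain ⟨c, hc⟩ := eq_smul_of_cross_eq_zero hd₁0 hc
      -- Edges leaving the vertex in the same direction would overlap in more than their common end.
      -- So the angle is straight and the boundary is locally a line.
      have hc0 : c < 0 := by
        by_contra! hc0
        have hcpos : 0 < c := by
          rcases hc0.eq_or_lt with h | h
          · exact absurd (by rw [hc, ← h, zero_smul]) hd₂0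
          · exact h
        have hcons := hP.consecutive k'
        rw [hkk] at hcons
        set p := min 1 c
        have hp : 0 < p := lt_min one_pos hcpos
        have hmem : P k + p • d₁ ∈ P.edgeSet ℝ k' ∩ P.edgeSet ℝ k := by
          constructor
          · refine mem_edgeSet.2 ⟨1 - p / c, ?_, ?_, ?_⟩
            · rw [sub_nonneg, div_le_one hcpos]; exact min_le_right _ _
            · have : 0 < p / c := by positivity
              linarith
            · rw [hkk]
              have h1 : P k + p • d₁ - P k' = p • d₁ - d₂ := by rw [hd₂]; abel
              have h2 : P k - P k' = -d₂ := by rw [hd₂]; abel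
              rw [h1, h2, hc, smul_neg, smul_smul, ← sub_smul, ← neg_smul]
              congr 1
              field_simp
              ring
          · exact mem_edgeSet.2 ⟨p, hp.le, min_le_left _ _, by simp [hd₁]⟩
        rw [hcons] at hmem
        have h0 : p • d₁ = 0 := by simpa using hmem
        exact (smul_ne_zero hp.ne' hd₁0) h0
      intro z hz
      rw [key z hz]
      constructor
      · rintro (⟨p, hp, h⟩ | ⟨p, hp, h⟩)
        · rw [h, cross_smul_right, cross_self, mul_zero]
        · rw [h, hc, cross_smul_right, cross_smul_right, cross_self, mul_zero, mul_zero]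
      · intro h
        obtain ⟨p, h⟩ := eq_smul_of_cross_eq_zero hd₁0 h
        rcases le_total 0 p with hp | hp
        · exact Or.inl ⟨p, hp, h⟩
        · refine Or.inr ⟨p / c, div_nonneg_of_nonpos hp hc0.le, ?_⟩
          rw [h, hc, smul_smul, div_mul_cancel₀ _ hc0.ne]
    · exact Or.inr ⟨k, rfl, hc, _, hrpos, key⟩
  · left
    push Not at hv
    obtain ⟨k, hk⟩ := Set.mem_iUnion.1 ha
    obtain ⟨p, hp0, hp1, hp⟩ := mem_edgeSet.1 hk
    set d := P (finRotate n k) - P k with hd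
    have hd0 : d ≠ 0 := sub_ne_zero.2 (hP.vertex_ne k)
    have hdn := norm_pos_iff.2 hd0
    have hp0' : 0 < p := by
      rcases hp0.eq_or_lt with h | h
      · rw [← h, zero_smul, sub_eq_zero] at hp
        exact absurd hp (hv k)
      · exact h
    have hp1' : p < 1 := by
      rcases hp1.eq_or_lt with h | h
      · rw [h, one_smul, hd, sub_left_inj] at hp
        exact absurd hp (hv _)
      · exact h
    obtain ⟨r₀, hr₀, hdisj⟩ := exists_ball_disjoint (P := P) (a := a) {j | j ≠ k} (by
      intro j hj haj
      rcases hP.inter_eq hj hk haj with ⟨_, h⟩ | ⟨_, h⟩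
      · exact hv _ h
      · exact hv _ h)
    refine ⟨d, hd0, min r₀ (min (p * ‖d‖) ((1 - p) * ‖d‖)), ?_, ?_⟩
    · have : 0 < 1 - p := by linarith
      positivity
    intro z hz
    have hz0 : z ∈ Metric.ball a r₀ := Metric.ball_subset_ball (min_le_left _ _) hz
    rw [mem_ball_iff_norm, lt_min_iff, lt_min_iff] at hz
    constructor
    · intro hzb
      obtain ⟨j, hj⟩ := Set.mem_iUnion.1 hzb
      by_cases hjk : j = k
      · subst hjk
        obtain ⟨q, _, _, h⟩ := mem_edgeSet.1 hj
        have : z - a = (z - P j) - (a - P j) := by abel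
        rw [this, h, hp, ← sub_smul, cross_smul_right, cross_self, mul_zero]
      · exact absurd hj (hdisj z hz0 j hjk)
    · intro h
      obtain ⟨q, h⟩ := eq_smul_of_cross_eq_zero hd0 h
      rw [h, norm_smul, Real.norm_eq_abs] at hz
      have h1 : |q| < p := lt_of_mul_lt_mul_right hz.2.1 hdn.le
      have h2 : |q| < 1 - p := lt_of_mul_lt_mul_right hz.2.2 hdn.le
      rw [abs_lt] at h1 h2
      refine edgeSet_subset_boundary k (mem_edgeSet.2 ⟨p + q, by linarith, by linarith, ?_⟩)
      have : z - P k = (a - P k) + (z - a) := by abel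
      rw [this, h, hp, ← add_smul]

end IsSimple

end

/-! ### Sectors at a corner, and reflex vertices as extreme points of the exterior. -/

section

/-- The first coordinate of `v` in the basis `d₁`, `d₂`. -/
def coordFst (d₁ d₂ v : EuclideanSpace ℝ (Fin 2)) : ℝ := cross v d₂ / cross d₁ d₂

/-- The second coordinate of `v` in the basis `d₁`, `d₂`. -/
def coordSnd (d₁ d₂ v : EuclideanSpace ℝ (Fin 2)) : ℝ := cross d₁ v / cross d₁ d₂

lemma isLinearMap_coordFst (d₁ d₂ : EuclideanSpace ℝ (Fin 2)) :
    IsLinearMap ℝ (coordFst d₁ d₂) where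
  map_add v w := by simp [coordFst, cross_add_left, add_div]
  map_smul r v := by simp [coordFst, cross_smul_left, mul_div_assoc]

lemma isLinearMap_coordSnd (d₁ d₂ : EuclideanSpace ℝ (Fin 2)) :
    IsLinearMap ℝ (coordSnd d₁ d₂) where
  map_add v w := by simp [coordSnd, cross_add_right, add_div]
  map_smul r v := by simp [coordSnd, cross_smul_right, mul_div_assoc]

section coord
variable {d₁ d₂ : EuclideanSpace ℝ (Fin 2)} (h : cross d₁ d₂ ≠ 0)
include h

lemma coord_expand (v : EuclideanSpace ℝ (Fin 2)) :
    v = coordFst d₁ d₂ v • d₁ + coordSnd d₁ d₂ v • d₂ := by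
  have := cross_smul_eq d₁ d₂ v
  rw [coordFst, coordSnd, div_eq_inv_mul, div_eq_inv_mul, mul_smul, mul_smul, ← smul_add, ← this,
    smul_smul, inv_mul_cancel₀ h, one_smul]

lemma coordFst_combo (p q : ℝ) : coordFst d₁ d₂ (p • d₁ + q • d₂) = p := by
  rw [coordFst, cross_add_left, cross_smul_left, cross_smul_left, cross_self]
  field_simp
  ring

lemma coordSnd_combo (p q : ℝ) : coordSnd d₁ d₂ (p • d₁ + q • d₂) = q := by
  rw [coordSnd, cross_add_right, cross_smul_right, cross_smul_right, cross_self]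
  field_simp
  ring

end coord

/-- The sector of a disk around `a` spanned by two directions. -/
def smallSector (a : EuclideanSpace ℝ (Fin 2)) (r : ℝ) (d₁ d₂ : EuclideanSpace ℝ (Fin 2)) :
    Set (EuclideanSpace ℝ (Fin 2)) :=
  Metric.ball a r ∩ {w | 0 < coordFst d₁ d₂ (w - a) ∧ 0 < coordSnd d₁ d₂ (w - a)}

/-- The complementary sector of a disk around `a`. -/
def largeSector (a : EuclideanSpace ℝ (Fin 2)) (r : ℝ) (d₁ d₂ : EuclideanSpace ℝ (Fin 2)) :
    Set (EuclideanSpace ℝ (Fin 2)) :=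
  Metric.ball a r ∩ {w | coordFst d₁ d₂ (w - a) < 0 ∨ coordSnd d₁ d₂ (w - a) < 0}

lemma convex_shift_pos {f : EuclideanSpace ℝ (Fin 2) → ℝ} (hf : IsLinearMap ℝ f)
    (a : EuclideanSpace ℝ (Fin 2)) : Convex ℝ {w | 0 < f (w - a)} := by
  have : {w | 0 < f (w - a)} = {w | f a < f w} := by
    ext w; simp [hf.map_sub]
  rw [this]
  exact convex_halfSpace_gt hf _

lemma convex_shift_neg {f : EuclideanSpace ℝ (Fin 2) → ℝ} (hf : IsLinearMap ℝ f)
    (a : EuclideanSpace ℝ (Fin 2)) : Convex ℝ {w | f (w - a) < 0} := by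
  have : {w | f (w - a) < 0} = {w | f w < f a} := by
    ext w; simp [hf.map_sub]
  rw [this]
  exact convex_halfSpace_lt hf _

lemma isPreconnected_smallSector (a : EuclideanSpace ℝ (Fin 2)) (r : ℝ)
    (d₁ d₂ : EuclideanSpace ℝ (Fin 2)) : IsPreconnected (smallSector a r d₁ d₂) :=
  ((convex_ball a r).inter ((convex_shift_pos (isLinearMap_coordFst d₁ d₂) a).inter
    (convex_shift_pos (isLinearMap_coordSnd d₁ d₂) a))).isPreconnected

lemma exists_smul_mem_ball (a v : EuclideanSpace ℝ (Fin 2)) {r : ℝ} (hr : 0 < r) :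
    ∃ c : ℝ, 0 < c ∧ ∀ c' : ℝ, |c'| ≤ c → a + c' • v ∈ Metric.ball a r := by
  refine ⟨r / (2 * (‖v‖ + 1)), by positivity, fun c' hc' => ?_⟩
  rw [mem_ball_iff_norm, add_sub_cancel_left, norm_smul, Real.norm_eq_abs]
  calc |c'| * ‖v‖ ≤ r / (2 * (‖v‖ + 1)) * (‖v‖ + 1) := by gcongr; linarith
    _ = r / 2 := by field_simp
    _ < r := by linarith

/-- The sector is the union of two convex pieces of the disk, which share a point in direction `-(d₁
+ d₂)`. -/
lemma isPreconnected_largeSector (a : EuclideanSpace ℝ (Fin 2)) {r : ℝ} (hr : 0 < r)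
    {d₁ d₂ : EuclideanSpace ℝ (Fin 2)} (h : cross d₁ d₂ ≠ 0) :
    IsPreconnected (largeSector a r d₁ d₂) := by
  have heq : largeSector a r d₁ d₂ =
      (Metric.ball a r ∩ {w | coordFst d₁ d₂ (w - a) < 0}) ∪
      (Metric.ball a r ∩ {w | coordSnd d₁ d₂ (w - a) < 0}) := by
    rw [← Set.inter_union_distrib_left]; rfl
  obtain ⟨c, hc, hball⟩ := exists_smul_mem_ball a (d₁ + d₂) hr
  have hm := hball (-c) (by rw [abs_neg, abs_of_pos hc])
  have he : a + (-c) • (d₁ + d₂) - a = (-c) • d₁ + (-c) • d₂ := by module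
  rw [heq]
  refine IsPreconnected.union (a + (-c) • (d₁ + d₂)) ⟨hm, ?_⟩ ⟨hm, ?_⟩
    ((convex_ball a r).inter (convex_shift_neg (isLinearMap_coordFst d₁ d₂) a)).isPreconnected
    ((convex_ball a r).inter (convex_shift_neg (isLinearMap_coordSnd d₁ d₂) a)).isPreconnected
  · rw [Set.mem_ofPred_eq, he, coordFst_combo h]; linarith
  · rw [Set.mem_ofPred_eq, he, coordSnd_combo h]; linarith

lemma mem_closure_of_ray {S : Set (EuclideanSpace ℝ (Fin 2))} {a b v : EuclideanSpace ℝ (Fin 2)}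
    {r : ℝ} (hb : b ∈ Metric.ball a r)
    (h : ∀ ε : ℝ, 0 < ε → b + ε • v ∈ Metric.ball a r → b + ε • v ∈ S) : b ∈ closure S := by
  have ht : Filter.Tendsto (fun ε : ℝ => b + ε • v) (nhdsWithin 0 (Set.Ioi 0)) (nhds b) := by
    have : Continuous fun ε : ℝ => b + ε • v := by fun_prop
    simpa using (this.tendsto 0).mono_left nhdsWithin_le_nhds
  refine mem_closure_of_tendsto ht ?_
  filter_upwards [ht (Metric.isOpen_ball.mem_nhds hb), self_mem_nhdsWithin] with ε h1 h2
  exact h ε h2 h1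

section corner
variable {a d₁ d₂ : EuclideanSpace ℝ (Fin 2)} {r : ℝ} {B : Set (EuclideanSpace ℝ (Fin 2))}
  (h : cross d₁ d₂ ≠ 0)
  (hB : ∀ z ∈ Metric.ball a r, (z ∈ B ↔ (∃ p : ℝ, 0 ≤ p ∧ z - a = p • d₁) ∨
    (∃ p : ℝ, 0 ≤ p ∧ z - a = p • d₂)))
include h

lemma coords_fst (p : ℝ) : coordFst d₁ d₂ (p • d₁) = p ∧ coordSnd d₁ d₂ (p • d₁) = 0 := by
  have := coordFst_combo h p 0
  have h' := coordSnd_combo h p 0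
  simp only [zero_smul, add_zero] at this h'
  exact ⟨this, h'⟩

lemma coords_snd (p : ℝ) : coordFst d₁ d₂ (p • d₂) = 0 ∧ coordSnd d₁ d₂ (p • d₂) = p := by
  have := coordFst_combo h 0 p
  have h' := coordSnd_combo h 0 p
  simp only [zero_smul, zero_add] at this h'
  exact ⟨this, h'⟩

lemma mem_closure_smallSector_fst {c : ℝ} (hc : 0 < c)
    (hb : a + c • d₁ ∈ Metric.ball a r) : a + c • d₁ ∈ closure (smallSector a r d₁ d₂) := by
  refine mem_closure_of_ray (v := d₂) hb fun ε hε hball => ⟨hball, ?_⟩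
  have : a + c • d₁ + ε • d₂ - a = c • d₁ + ε • d₂ := by abel
  rw [Set.mem_ofPred_eq, this, coordFst_combo h, coordSnd_combo h]
  exact ⟨hc, hε⟩

lemma mem_closure_smallSector_snd {c : ℝ} (hc : 0 < c)
    (hb : a + c • d₂ ∈ Metric.ball a r) : a + c • d₂ ∈ closure (smallSector a r d₁ d₂) := by
  refine mem_closure_of_ray (v := d₁) hb fun ε hε hball => ⟨hball, ?_⟩
  have : a + c • d₂ + ε • d₁ - a = ε • d₁ + c • d₂ := by abel
  rw [Set.mem_ofPred_eq, this, coordFst_combo h, coordSnd_combo h]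
  exact ⟨hε, hc⟩

/-- Stepping off in direction `-d₂` makes the second coordinate negative whatever the sign of `c`.
Thus both directions of the line of an edge are adherent to the large sector, and a linear function
with its maximum at the corner must be constant along that line. -/
lemma mem_closure_largeSector_fst {c : ℝ}
    (hb : a + c • d₁ ∈ Metric.ball a r) : a + c • d₁ ∈ closure (largeSector a r d₁ d₂) := by
  refine mem_closure_of_ray (v := -d₂) hb fun ε hε hball => ⟨hball, Or.inr ?_⟩
  have : a + c • d₁ + ε • (-d₂) - a = c • d₁ + (-ε) • d₂ := by module
  rw [this, coordSnd_combo h]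
  linarith

lemma mem_closure_largeSector_snd {c : ℝ}
    (hb : a + c • d₂ ∈ Metric.ball a r) : a + c • d₂ ∈ closure (largeSector a r d₁ d₂) := by
  refine mem_closure_of_ray (v := -d₁) hb fun ε hε hball => ⟨hball, Or.inl ?_⟩
  have : a + c • d₂ + ε • (-d₁) - a = (-ε) • d₁ + c • d₂ := by module
  rw [this, coordFst_combo h]
  linarith

include hB

lemma smallSector_subset_compl : smallSector a r d₁ d₂ ⊆ Bᶜ := by
  rintro w ⟨hw, hp, hq⟩ hwB
  rcases (hB w hw).1 hwB with ⟨p, _, he⟩ | ⟨p, _, he⟩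
  · rw [he, (coords_fst h p).2] at hq
    exact lt_irrefl _ hq
  · rw [he, (coords_snd h p).1] at hp
    exact lt_irrefl _ hp

lemma largeSector_subset_compl : largeSector a r d₁ d₂ ⊆ Bᶜ := by
  rintro w ⟨hw, hpq⟩ hwB
  rcases (hB w hw).1 hwB with ⟨p, hp, he⟩ | ⟨p, hp, he⟩
  · rw [Set.mem_ofPred_eq, he, (coords_fst h p).2, (coords_fst h p).1] at hpq
    rcases hpq with hpq | hpq <;> linarith
  · rw [Set.mem_ofPred_eq, he, (coords_snd h p).2, (coords_snd h p).1] at hpq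
    rcases hpq with hpq | hpq <;> linarith

lemma mem_sector_of_notMem {w : EuclideanSpace ℝ (Fin 2)} (hw : w ∈ Metric.ball a r)
    (hwB : w ∉ B) : w ∈ smallSector a r d₁ d₂ ∨ w ∈ largeSector a r d₁ d₂ := by
  by_cases h1 : coordFst d₁ d₂ (w - a) < 0 ∨ coordSnd d₁ d₂ (w - a) < 0
  · exact Or.inr ⟨hw, h1⟩
  push Not at h1
  have hexp := coord_expand h (w - a)
  left
  refine ⟨hw, h1.1.lt_of_ne fun h0 => hwB ((hB w hw).2 (Or.inr ⟨_, h1.2, ?_⟩)),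
    h1.2.lt_of_ne fun h0 => hwB ((hB w hw).2 (Or.inl ⟨_, h1.1, ?_⟩))⟩
  · rwa [← h0, zero_smul, zero_add] at hexp
  · rwa [← h0, zero_smul, add_zero] at hexp

end corner

variable {n : ℕ} {P : Polygon (EuclideanSpace ℝ (Fin 2)) n}

/-- A vertex is reflex if the sector spanned by its two edges belongs to the exterior. -/
lemma isReflexVertex_of_smallSector_subset {k : Fin n} {d₁ d₂ : EuclideanSpace ℝ (Fin 2)} {r : ℝ}
    (hcr : cross d₁ d₂ ≠ 0) (hr : 0 < r)
    (hB : ∀ z ∈ Metric.ball (P k) r, (z ∈ P.boundary ℝ ↔ (∃ p : ℝ, 0 ≤ p ∧ z - P k = p • d₁) ∨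
      (∃ p : ℝ, 0 ≤ p ∧ z - P k = p • d₂)))
    (hsub : smallSector (P k) r d₁ d₂ ⊆ P.regionᶜ) : P.IsReflexVertex k := by
  rintro ⟨ρ, hρ, hconv⟩
  obtain ⟨e₁, he₁, heb₁⟩ := exists_smul_mem_ball (P k) d₁ (lt_min hρ hr)
  obtain ⟨e₂, he₂, heb₂⟩ := exists_smul_mem_ball (P k) d₂ (lt_min hρ hr)
  have hb₁ := heb₁ e₁ (abs_of_pos he₁).le
  have hb₂ := heb₂ e₂ (abs_of_pos he₂).le
  have hm₁ : P k + e₁ • d₁ ∈ P.region ∩ Metric.ball (P k) ρ :=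
    ⟨boundary_subset_region ((hB _ (Metric.ball_subset_ball (min_le_right _ _) hb₁)).2
      (Or.inl ⟨e₁, he₁.le, by simp⟩)), Metric.ball_subset_ball (min_le_left _ _) hb₁⟩
  have hm₂ : P k + e₂ • d₂ ∈ P.region ∩ Metric.ball (P k) ρ :=
    ⟨boundary_subset_region ((hB _ (Metric.ball_subset_ball (min_le_right _ _) hb₂)).2
      (Or.inr ⟨e₂, he₂.le, by simp⟩)), Metric.ball_subset_ball (min_le_left _ _) hb₂⟩
  have h0 : (0 : ℝ) ≤ 1 / 2 := by norm_num
  have h1 : (1 / 2 : ℝ) + 1 / 2 = 1 := by norm_num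
  -- Convexity would put the midpoint of two points on the two edges into the region, but it lies in
  -- the small sector.
  have hmid := hconv hm₁ hm₂ h0 h0 h1
  have hmid' := convex_ball (P k) (min ρ r) hb₁ hb₂ h0 h0 h1
  refine hsub ⟨Metric.ball_subset_ball (min_le_right _ _) hmid', ?_⟩ hmid.1
  have : (1 / 2 : ℝ) • (P k + e₁ • d₁) + (1 / 2 : ℝ) • (P k + e₂ • d₂) - P k =
    (e₁ / 2) • d₁ + (e₂ / 2) • d₂ := by module
  rw [Set.mem_ofPred_eq, this, coordFst_combo hcr, coordSnd_combo hcr]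
  exact ⟨by positivity, by positivity⟩

set_option maxHeartbeats 800000 in
/-- If the part of the exterior in an open set is bounded in a direction `f` by points of the
polygon, then it is bounded by a reflex vertex with a tangent line orthogonal to `f`. -/
theorem IsSimple.exists_reflexVertex (hP : P.IsSimple) {K : Set (EuclideanSpace ℝ (Fin 2))}
    (hK : IsOpen K) (hKb : Bornology.IsBounded K) (f g : EuclideanSpace ℝ (Fin 2) →L[ℝ] ℝ)
    (hfg : ∀ d, f d = 0 → g d = 0 → d = 0) (hf : ∃ w, 0 < f w) {m : ℝ}
    (hm : ∀ z ∈ closure K, z ∉ K → z ∉ P.region → f z ≤ m)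
    {z₀ : EuclideanSpace ℝ (Fin 2)} (hz₀ : z₀ ∈ K) (hz₀r : z₀ ∉ P.region) (hz₀m : m < f z₀) :
    ∃ i, P i ∈ closure K ∧ P.IsReflexVertex i ∧ m < f (P i) ∧
      f (P (finRotate n i)) ≤ f (P i) ∧ f (P ((finRotate n).symm i)) ≤ f (P i) ∧
      ∀ z ∈ K, z ∉ P.region → f z < f (P i) := by
  -- Maximise `f` on the closure of the exterior part, then `g` among the maximisers. By `hfg`, no
  -- segment of that closure is centred at the resulting point `a`.
  set U : Set (EuclideanSpace ℝ (Fin 2)) := K ∩ P.regionᶜ with hU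
  have hUo : IsOpen U := hK.inter isClosed_region.isOpen_compl
  have hUc : IsCompact (closure U) := (hKb.subset Set.inter_subset_left).isCompact_closure
  have hUne : (closure U).Nonempty := ⟨z₀, subset_closure ⟨hz₀, hz₀r⟩⟩
  obtain ⟨a₀, ha₀, ha₀max⟩ := hUc.exists_isMaxOn hUne f.continuous.continuousOn
  obtain ⟨a, ⟨haU, hfa⟩, hamax⟩ :=
    (hUc.inter_right (isClosed_singleton.preimage f.continuous : IsClosed (f ⁻¹' {f a₀})))
      |>.exists_isMaxOn ⟨a₀, ha₀, rfl⟩ g.continuous.continuousOn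
  have hfa : f a = f a₀ := hfa
  have hmax : ∀ z ∈ closure U, f z ≤ f a := fun z hz => hfa ▸ ha₀max hz
  have hmaxg : ∀ z ∈ closure U, f z = f a → g z ≤ g a := fun z hz h => hamax ⟨hz, h.trans hfa⟩
  have hma : m < f a := hz₀m.trans_le (hmax _ (subset_closure ⟨hz₀, hz₀r⟩))
  obtain ⟨w, hw⟩ := hf
  have hlt : ∀ z ∈ U, f z < f a := by
    intro z hz
    obtain ⟨r, hr, hball⟩ := Metric.isOpen_iff.1 hUo z hz
    obtain ⟨c, hc, hcb⟩ := exists_smul_mem_ball z w hr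
    have := hmax _ (subset_closure (hball (hcb c (abs_of_pos hc).le)))
    rw [map_add, map_smul, smul_eq_mul] at this
    have : 0 < c * f w := by positivity
    linarith
  -- A point of the exterior inside `K` is not maximal because `U` is open; one on the frontier of
  -- `K` is at level at most `m`.
  have har : a ∈ P.region := by
    by_contra h
    by_cases haK : a ∈ K
    · exact lt_irrefl _ (hlt a ⟨haK, h⟩)
    · exact absurd (hm a (closure_mono Set.inter_subset_left haU) haK h) (not_le.2 hma)
  have hab : a ∈ P.boundary ℝ := by
    by_contra h
    obtain ⟨r, hr, hball⟩ := Metric.isOpen_iff.1 isCompact_boundary.isClosed.isOpen_compl a h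
    obtain ⟨z, hz, hzU⟩ := mem_closure_iff.1 haU _ Metric.isOpen_ball (Metric.mem_ball_self hr)
    exact subset_compl_region (convex_ball a r).isPreconnected hball hz hzU.2
      (Metric.mem_ball_self hr) har
  -- To leave `K`, a connected exterior set above level `m` would have to pass through the frontier
  -- of `K`, where exterior points have level at most `m`.
  have hconn : ∀ C : Set (EuclideanSpace ℝ (Fin 2)), IsPreconnected C → C ⊆ (P.boundary ℝ)ᶜ →
      (∀ z ∈ C, m < f z) → (C ∩ U).Nonempty → C ⊆ U := by
    rintro C hC hCb hCm ⟨z, hzC, hzU⟩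
    have hCr := subset_compl_region hC hCb hzC hzU.2
    refine Set.subset_inter (hC.subset_left_of_subset_union hK isClosed_closure.isOpen_compl
      (disjoint_compl_right.mono_left subset_closure) ?_ ⟨z, hzC, hzU.1⟩) hCr
    intro y hy
    by_cases hyc : y ∈ closure K
    · by_cases hyK : y ∈ K
      · exact Or.inl hyK
      · exact absurd (hm y hyc hyK (hCr hy)) (not_le.2 (hCm y hy))
    · exact Or.inr hyc
  obtain ⟨r₁, hr₁, hball₁⟩ := Metric.isOpen_iff.1 (isOpen_lt continuous_const f.continuous) a hma
  rcases hP.local_structure hab with ⟨d, hd, r₂, hr₂, hB⟩ | ⟨k, rfl, hcr, r₂, hr₂, hB⟩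
  -- If the boundary is a line near `a`, one side of it is exterior, so a segment of the line
  -- centred at `a` lies in the closure of `U`. Maximality forces `f d = 0` and then `g d = 0`.
  · exfalso
    set r := min r₁ r₂
    have hr : 0 < r := lt_min hr₁ hr₂
    obtain ⟨z, hz, hzU⟩ := mem_closure_iff.1 haU _ Metric.isOpen_ball (Metric.mem_ball_self hr)
    have hzne : cross d (z - a) ≠ 0 := fun h =>
      (notMem_region.1 hzU.2).1 ((hB z (Metric.ball_subset_ball (min_le_right _ _) hz)).2 h)
    set C : Set (EuclideanSpace ℝ (Fin 2)) :=
      Metric.ball a r ∩ {y | 0 < cross d (z - a) * cross d (y - a)} with hCdef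
    have hlin : IsLinearMap ℝ fun v => cross d (z - a) * cross d v :=
      ⟨fun v w => by rw [cross_add_right]; ring,
        fun c v => by rw [cross_smul_right, smul_eq_mul]; ring⟩
    have hCU : C ⊆ U := by
      refine hconn C ((convex_ball a r).inter (convex_shift_pos hlin a)).isPreconnected ?_ ?_
        ⟨z, ⟨hz, mul_self_pos.2 hzne⟩, hzU⟩
      · rintro y ⟨hy, hy'⟩ hyb
        have := (hB y (Metric.ball_subset_ball (min_le_right _ _) hy)).1 hyb
        rw [Set.mem_ofPred_eq, this, mul_zero] at hy'
        exact lt_irrefl _ hy'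
      · rintro y ⟨hy, _⟩
        exact hball₁ (Metric.ball_subset_ball (min_le_left _ _) hy)
    obtain ⟨c, hc, hcb⟩ := exists_smul_mem_ball a d hr
    have hcl : ∀ c', |c'| ≤ c → a + c' • d ∈ closure U := by
      intro c' hc'
      refine closure_mono hCU (mem_closure_of_ray (v := z - a) (hcb c' hc') ?_)
      intro ε hε hb
      refine ⟨hb, ?_⟩
      have : a + c' • d + ε • (z - a) - a = c' • d + ε • (z - a) := by abel
      rw [Set.mem_ofPred_eq, this, cross_add_right, cross_smul_right, cross_smul_right, cross_self]
      have := mul_self_pos.2 hzne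
      nlinarith
    have h1 := hmax _ (hcl c (abs_of_pos hc).le)
    have h2 := hmax _ (hcl (-c) (by rw [abs_neg, abs_of_pos hc]))
    simp only [map_add, map_smul, smul_eq_mul] at h1 h2
    have hfd : f d = 0 := by
      have h1 : c * f d ≤ 0 := by linarith
      have h2 : 0 ≤ c * f d := by linarith
      have h3 : c * f d = 0 := le_antisymm h1 h2
      exact (mul_eq_zero.1 h3).resolve_left hc.ne'
    have h3 := hmaxg _ (hcl c (abs_of_pos hc).le) (by simp [hfd])
    have h4 := hmaxg _ (hcl (-c) (by rw [abs_neg, abs_of_pos hc])) (by simp [hfd])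
    simp only [map_add, map_smul, smul_eq_mul] at h3 h4
    have hgd : g d = 0 := by
      have h1 : c * g d ≤ 0 := by linarith
      have h2 : 0 ≤ c * g d := by linarith
      have h3 : c * g d = 0 := le_antisymm h1 h2
      exact (mul_eq_zero.1 h3).resolve_left hc.ne'
    exact hd (hfg d hfd hgd)
  · set d₁ := P (finRotate n k) - P k
    set d₂ := P ((finRotate n).symm k) - P k
    set r := min r₁ r₂
    have hr : 0 < r := lt_min hr₁ hr₂
    replace hB : ∀ z ∈ Metric.ball (P k) r, (z ∈ P.boundary ℝ ↔
        (∃ p : ℝ, 0 ≤ p ∧ z - P k = p • d₁) ∨ (∃ p : ℝ, 0 ≤ p ∧ z - P k = p • d₂)) :=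
      fun z hz => hB z (Metric.ball_subset_ball (min_le_right _ _) hz)
    have hfm : ∀ z ∈ Metric.ball (P k) r, m < f z :=
      fun z hz => hball₁ (Metric.ball_subset_ball (min_le_left _ _) hz)
    obtain ⟨z, hz, hzU⟩ := mem_closure_iff.1 haU _ Metric.isOpen_ball (Metric.mem_ball_self hr)
    obtain ⟨c₁, hc₁, hcb₁⟩ := exists_smul_mem_ball (P k) d₁ hr
    obtain ⟨c₂, hc₂, hcb₂⟩ := exists_smul_mem_ball (P k) d₂ hr
    rcases mem_sector_of_notMem hcr hB hz (notMem_region.1 hzU.2).1 with hs | hs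
    -- The exterior fills the small sector, so the vertex is reflex; both edges adhere to that
    -- sector, so maximality gives the tangent line.
    · have hsub : smallSector (P k) r d₁ d₂ ⊆ U :=
        hconn _ (isPreconnected_smallSector _ _ _ _) (smallSector_subset_compl hcr hB)
          (fun y hy => hfm y hy.1) ⟨z, hs, hzU⟩
      refine ⟨k, closure_mono Set.inter_subset_left haU, ?_, hma, ?_, ?_, fun z hz hzr => hlt z ⟨hz, hzr⟩⟩
      · exact isReflexVertex_of_smallSector_subset hcr hr hB fun y hy => (hsub hy).2
      · have := hmax _ (closure_mono hsub
          (mem_closure_smallSector_fst hcr hc₁ (hcb₁ c₁ (abs_of_pos hc₁).le)))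
        rw [map_add, map_smul, smul_eq_mul, map_sub] at this
        nlinarith
      · have := hmax _ (closure_mono hsub
          (mem_closure_smallSector_snd hcr hc₂ (hcb₂ c₂ (abs_of_pos hc₂).le)))
        rw [map_add, map_smul, smul_eq_mul, map_sub] at this
        nlinarith
    -- If the exterior filled the large sector, `f` would vanish on `d₁` and `d₂`, hence everywhere.
    · exfalso
      have hsub : largeSector (P k) r d₁ d₂ ⊆ U :=
        hconn _ (isPreconnected_largeSector _ hr hcr) (largeSector_subset_compl hcr hB)
          (fun y hy => hfm y hy.1) ⟨z, hs, hzU⟩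
      have e1 := hmax _ (closure_mono hsub
        (mem_closure_largeSector_fst hcr (hcb₁ c₁ (abs_of_pos hc₁).le)))
      have e2 := hmax _ (closure_mono hsub
        (mem_closure_largeSector_fst hcr (hcb₁ (-c₁) (by rw [abs_neg, abs_of_pos hc₁]))))
      have e3 := hmax _ (closure_mono hsub
        (mem_closure_largeSector_snd hcr (hcb₂ c₂ (abs_of_pos hc₂).le)))
      have e4 := hmax _ (closure_mono hsub
        (mem_closure_largeSector_snd hcr (hcb₂ (-c₂) (by rw [abs_neg, abs_of_pos hc₂]))))
      rw [map_add, map_smul, smul_eq_mul] at e1 e2 e3 e4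
      have f1 : f d₁ = 0 := by
        have h3 : c₁ * f d₁ = 0 := by linarith
        exact (mul_eq_zero.1 h3).resolve_left hc₁.ne'
      have f2 : f d₂ = 0 := by
        have h3 : c₂ * f d₂ = 0 := by linarith
        exact (mul_eq_zero.1 h3).resolve_left hc₂.ne'
      rw [coord_expand hcr w, map_add, map_smul, map_smul, f1, f2] at hw
      simp at hw

end

/-! ### The total angle of the boundary, convex vertices and the long width. -/

section

/-- The cross product with a fixed vector, as a linear function. -/
def crossCLM (a : EuclideanSpace ℝ (Fin 2)) : EuclideanSpace ℝ (Fin 2) →L[ℝ] ℝ :=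
  LinearMap.toContinuousLinearMap
    { toFun := cross a
      map_add' := cross_add_right a
      map_smul' := fun r b => cross_smul_right r a b }

@[simp] lemma crossCLM_apply (a b : EuclideanSpace ℝ (Fin 2)) : crossCLM a b = cross a b := rfl

/-- The plane as the complex numbers. -/
def toComplex (z : EuclideanSpace ℝ (Fin 2)) : ℂ := (z 0 : ℂ) + (z 1 : ℂ) * Complex.I

@[simp] lemma toComplex_re (z : EuclideanSpace ℝ (Fin 2)) : (toComplex z).re = z 0 := by
  simp [toComplex]

@[simp] lemma toComplex_im (z : EuclideanSpace ℝ (Fin 2)) : (toComplex z).im = z 1 := by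
  simp [toComplex]

lemma toComplex_injective : Function.Injective toComplex := by
  intro z w h
  ext i
  fin_cases i
  · simpa using congrArg Complex.re h
  · simpa using congrArg Complex.im h

lemma toComplex_sub (z w : EuclideanSpace ℝ (Fin 2)) :
    toComplex (z - w) = toComplex z - toComplex w := by
  apply Complex.ext <;> simp

lemma toComplex_smul (r : ℝ) (w : EuclideanSpace ℝ (Fin 2)) :
    toComplex (r • w) = r * toComplex w := by
  apply Complex.ext <;> simp

lemma norm_toComplex (z : EuclideanSpace ℝ (Fin 2)) : ‖toComplex z‖ = ‖z‖ := by
  rw [EuclideanSpace.norm_eq, ← Real.sqrt_sq (norm_nonneg (toComplex z)), Complex.sq_norm,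
    Complex.normSq_apply]
  simp [pow_two]

@[fun_prop]
lemma continuous_toComplex : Continuous toComplex := by
  unfold toComplex; fun_prop

variable {n : ℕ} (P : Polygon (EuclideanSpace ℝ (Fin 2)) n)

/-- The quotient of the directions from `z` to the two ends of an edge. -/
def edgeRatio (i : Fin n) (z : EuclideanSpace ℝ (Fin 2)) : ℂ :=
  toComplex (P (finRotate n i) - z) / toComplex (P i - z)

/-- The total angle that the boundary of the polygon turns around `z`. -/
def totalAngle (z : EuclideanSpace ℝ (Fin 2)) : ℝ := ∑ i, (P.edgeRatio i z).arg

variable {P}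

lemma toComplex_eq_zero {z : EuclideanSpace ℝ (Fin 2)} : toComplex z = 0 ↔ z = 0 := by
  rw [← norm_eq_zero, norm_toComplex, norm_eq_zero]

/-- The directions to the two ends of a segment have a nonpositive real ratio only from a point of
the segment. So the argument is continuous off the edge. -/
lemma edgeRatio_mem_slitPlane {i : Fin n} {z : EuclideanSpace ℝ (Fin 2)}
    (hz : z ∉ P.edgeSet ℝ i) : P.edgeRatio i z ∈ Complex.slitPlane := by
  by_contra h
  rw [Complex.mem_slitPlane_iff, not_or, not_lt, not_not] at h
  apply hz
  have hne : toComplex (P i - z) ≠ 0 := by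
    intro h0
    rw [toComplex_eq_zero, sub_eq_zero] at h0
    exact hz (h0 ▸ left_mem_edgeSet i)
  set p := -(P.edgeRatio i z).re with hp
  have hp0 : 0 ≤ p := by linarith [h.1]
  have hr : P.edgeRatio i z = ((-p : ℝ) : ℂ) := by
    apply Complex.ext <;> simp [hp, h.2]
  rw [edgeRatio, div_eq_iff hne, ← toComplex_smul] at hr
  have hv := toComplex_injective hr
  refine mem_edgeSet.2 ⟨1 / (1 + p), by positivity, ?_, ?_⟩
  · rw [div_le_one (by positivity)]; linarith
  · have h1 : P (finRotate n i) - P i = (1 + p) • (z - P i) := by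
      have : P (finRotate n i) - P i = (P (finRotate n i) - z) - (P i - z) := by abel
      rw [this, hv]; module
    rw [h1, smul_smul, one_div, inv_mul_cancel₀ (by positivity), one_smul]

lemma continuousAt_edgeRatio {i : Fin n} {z : EuclideanSpace ℝ (Fin 2)}
    (hz : z ∉ P.edgeSet ℝ i) : ContinuousAt (fun w => (P.edgeRatio i w).arg) z := by
  refine (Complex.continuousAt_arg (edgeRatio_mem_slitPlane hz)).comp (f := P.edgeRatio i) ?_
  unfold edgeRatio
  refine ContinuousAt.div (by fun_prop) (by fun_prop) ?_
  rw [ne_eq, toComplex_eq_zero, sub_eq_zero]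
  rintro rfl
  exact hz (left_mem_edgeSet i)

/-- The ratios telescope around the polygon to the product 1, so the sum of their arguments
exponentiates to 1. -/
lemma totalAngle_eq {z : EuclideanSpace ℝ (Fin 2)} (hz : z ∉ P.boundary ℝ) :
    ∃ k : ℤ, P.totalAngle z = k * (2 * Real.pi) := by
  have hne : ∀ i, toComplex (P i - z) ≠ 0 := by
    intro i h
    rw [toComplex_eq_zero, sub_eq_zero] at h
    exact hz (h ▸ vertex_mem_boundary i)
  have hprod : ∏ i, P.edgeRatio i z = 1 := by
    unfold edgeRatio
    rw [Finset.prod_div_distrib, Equiv.prod_comp (finRotate n) fun i => toComplex (P i - z)]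
    exact div_self (Finset.prod_ne_zero_iff.2 fun i _ => hne i)
  have hexp : Complex.exp (P.totalAngle z * Complex.I) = 1 := by
    have h1 : ∏ i, ((‖P.edgeRatio i z‖ : ℂ) * Complex.exp ((P.edgeRatio i z).arg * Complex.I)) = 1 := by
      rw [← hprod]
      exact Finset.prod_congr rfl fun i _ => Complex.norm_mul_exp_arg_mul_I _
    rw [Finset.prod_mul_distrib, ← Complex.exp_sum, ← Finset.sum_mul] at h1
    have h2 : ∏ i, (‖P.edgeRatio i z‖ : ℂ) = 1 := by
      rw [← Complex.ofReal_prod, ← norm_prod, hprod]; simp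
    rw [h2, one_mul] at h1
    rw [totalAngle]
    push_cast
    exact h1
  obtain ⟨k, hk⟩ := Complex.exp_eq_one_iff.1 hexp
  refine ⟨k, ?_⟩
  have := congrArg Complex.im hk
  simpa using this

/-- Far away, the two ends of an edge are seen in almost the same direction: each ratio tends to 1.
-/
lemma tendsto_totalAngle :
    Filter.Tendsto P.totalAngle (Bornology.cobounded _) (nhds 0) := by
  have h : ∀ i : Fin n, Filter.Tendsto (fun z => (P.edgeRatio i z).arg) (Bornology.cobounded _)
      (nhds 0) := by
    intro i
    have hc : Filter.Tendsto (fun z => toComplex (P i - z)) (Bornology.cobounded _)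
        (Bornology.cobounded _) := by
      rw [← tendsto_norm_atTop_iff_cobounded]
      simp only [norm_toComplex]
      have h1 : Filter.Tendsto (fun z : EuclideanSpace ℝ (Fin 2) => ‖z‖ - ‖P i‖)
          (Bornology.cobounded _) Filter.atTop :=
        Filter.tendsto_atTop_add_const_right _ _ tendsto_norm_cobounded_atTop
      refine Filter.tendsto_atTop_mono (fun z => ?_) h1
      rw [norm_sub_rev]
      exact norm_sub_norm_le _ _
    have h0 := (Filter.tendsto_inv₀_cobounded.comp hc).const_mul
      (toComplex (P (finRotate n i) - P i))
    have h1 : Filter.Tendsto (P.edgeRatio i) (Bornology.cobounded _) (nhds 1) := by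
      have h2 := h0.const_add 1
      rw [mul_zero, add_zero] at h2
      refine h2.congr' ?_
      have hev : ∀ᶠ z in Bornology.cobounded (EuclideanSpace ℝ (Fin 2)), z ≠ P i := by
        have : Bornology.IsBounded ({P i} : Set (EuclideanSpace ℝ (Fin 2))) :=
          Bornology.isBounded_singleton
        filter_upwards [Bornology.isBounded_def.1 this] with z hz using hz
      filter_upwards [hev] with z hz
      have hne : toComplex (P i - z) ≠ 0 := by
        rw [ne_eq, toComplex_eq_zero, sub_eq_zero]; exact fun h => hz h.symm
      have : P (finRotate n i) - P i = (P (finRotate n i) - z) - (P i - z) := by abel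
      simp only [Function.comp, edgeRatio]
      rw [this, toComplex_sub (P (finRotate n i) - z)]
      field_simp
      ring
    have h3 := (Complex.continuousAt_arg Complex.one_mem_slitPlane).tendsto.comp h1
    rw [Complex.arg_one] at h3
    exact h3
  have := tendsto_finsetSum (Finset.univ : Finset (Fin n)) fun i _ => h i
  rw [Finset.sum_const_zero] at this
  exact this

/-- On an unbounded component the total angle is continuous and gets arbitrarily small, while its
values are multiples of 2π. If it were nonzero somewhere, its absolute value would equal 1 at some
point. -/
lemma totalAngle_eq_zero {z : EuclideanSpace ℝ (Fin 2)} (hz : z ∉ P.region) :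
    P.totalAngle z = 0 := by
  obtain ⟨hzb, hunb⟩ := notMem_region.1 hz
  set C := connectedComponentIn (P.boundary ℝ)ᶜ z
  have hCb : C ⊆ (P.boundary ℝ)ᶜ := connectedComponentIn_subset _ _
  have hsmall : ∀ w ∉ P.boundary ℝ, |P.totalAngle w| ≤ 1 → P.totalAngle w = 0 := by
    intro w hw h
    obtain ⟨k, hk⟩ := totalAngle_eq hw
    rcases eq_or_ne k 0 with rfl | hk0
    · simpa using hk
    · exfalso
      have h1 : (1 : ℝ) ≤ |(k : ℝ)| := by exact_mod_cast Int.one_le_abs hk0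
      rw [hk, abs_mul, abs_of_pos Real.two_pi_pos] at h
      nlinarith [Real.pi_gt_three]
  obtain ⟨w, hwC, hw⟩ : ∃ w ∈ C, |P.totalAngle w| < 1 := by
    by_contra! hcon
    have hev : ∀ᶠ w in Bornology.cobounded (EuclideanSpace ℝ (Fin 2)), |P.totalAngle w| < 1 := by
      have := tendsto_totalAngle (P := P) |>.abs
      rw [abs_zero] at this
      exact this.eventually_lt_const one_pos
    refine hunb (Bornology.isBounded_def.2 ?_)
    filter_upwards [hev] with w hw hwC
    exact absurd hw (not_lt.2 (hcon w hwC))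
  by_contra hne
  have hlarge : 1 ≤ |P.totalAngle z| := by
    by_contra h
    exact hne (hsmall z hzb (not_le.1 h).le)
  have hcont : ContinuousOn (fun w => |P.totalAngle w|) C := by
    intro w hw
    refine ContinuousAt.continuousWithinAt (ContinuousAt.abs ?_)
    have hwb := hCb hw
    unfold totalAngle
    refine tendsto_finsetSum _ fun i _ => continuousAt_edgeRatio fun h => hwb ?_
    exact edgeSet_subset_boundary i h
  obtain ⟨y, hyC, hy⟩ := isPreconnected_connectedComponentIn.intermediate_value hwC
    (mem_connectedComponentIn hzb) hcont ⟨hw.le, hlarge⟩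
  have := hsmall y (hCb hyC) (le_of_eq hy)
  simp only [this, abs_zero] at hy
  exact zero_ne_one hy

/-- In units of the edge the ratio is `(1 - p - εi) / (-p - εi)`. For 0 < p < 1 and small `ε` its
real part is negative and its imaginary part has the sign of `ε`, so its argument jumps between π
and -π across the edge. -/
lemma edgeRatio_normal {k : Fin n} {p : ℝ} (hne : P (finRotate n k) ≠ P k)
    {N : EuclideanSpace ℝ (Fin 2)}
    (hN : toComplex N = Complex.I * toComplex (P (finRotate n k) - P k)) {ε : ℝ} (hε : ε ≠ 0) :
    P.edgeRatio k (P k + p • (P (finRotate n k) - P k) + ε • N) =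
      (((ε ^ 2 - p * (1 - p)) / (p ^ 2 + ε ^ 2) : ℝ) : ℂ) +
        ((ε / (p ^ 2 + ε ^ 2) : ℝ) : ℂ) * Complex.I := by
  set d := P (finRotate n k) - P k with hd
  have hd0 : toComplex d ≠ 0 := by
    rw [ne_eq, toComplex_eq_zero, hd, sub_eq_zero]; exact hne
  have h1 : P (finRotate n k) - (P k + p • d + ε • N) = (1 - p) • d - ε • N := by
    have : P (finRotate n k) = P k + d := by rw [hd]; abel
    rw [this]; module
  have h2 : P k - (P k + p • d + ε • N) = (-p) • d - ε • N := by module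
  have hpos : p ^ 2 + ε ^ 2 ≠ 0 := by positivity
  have hpos' : ((p : ℂ) ^ 2 + (ε : ℂ) ^ 2) ≠ 0 := by exact_mod_cast hpos
  have hden : (-(p : ℂ) - ε * Complex.I) ≠ 0 := by
    intro h
    have := congrArg Complex.im h
    simp at this
    exact hε this
  rw [edgeRatio, h1, h2, toComplex_sub, toComplex_sub, toComplex_smul, toComplex_smul,
    toComplex_smul, hN]
  have e1 : ((1 - p : ℝ) : ℂ) * toComplex d - ε * (Complex.I * toComplex d) =
    ((1 - p : ℂ) - ε * Complex.I) * toComplex d := by push_cast; ring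
  have e2 : ((-p : ℝ) : ℂ) * toComplex d - ε * (Complex.I * toComplex d) =
    (-(p : ℂ) - ε * Complex.I) * toComplex d := by push_cast; ring
  rw [e1, e2, mul_div_mul_right _ _ hd0, div_eq_iff hden]
  push_cast
  field_simp
  ring_nf
  simp only [Complex.I_sq]
  ring

/-- The exterior does not lie on both sides of an edge. -/
theorem IsSimple.exists_mem_region_near_edge (hP : P.IsSimple) (k : Fin n) {p : ℝ} (hp0 : 0 < p)
    (hp1 : p < 1) {r : ℝ} (hr : 0 < r) :
    ∃ z ∈ Metric.ball (P k + p • (P (finRotate n k) - P k)) r,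
      z ∉ P.boundary ℝ ∧ z ∈ P.region := by
  -- With the exterior on both sides, the total angle vanishes on both sides. The contribution `R`
  -- of the other edges is continuous at `z₀` and cancels that of edge `k`, which exceeds π/2 on one
  -- side and is below -π/2 on the other. The two one-sided limits of `R` contradict each other.
  by_contra! hcon
  set d := P (finRotate n k) - P k with hd
  have hdne := hP.vertex_ne k
  have hd0 : d ≠ 0 := sub_ne_zero.2 hdne
  set z₀ := P k + p • d with hz₀
  have hother : ∀ j ∈ ({k}ᶜ : Set (Fin n)), z₀ ∉ P.edgeSet ℝ j := by
    intro j hj hz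
    have hzk : z₀ ∈ P.edgeSet ℝ k := mem_edgeSet.2 ⟨p, hp0.le, hp1.le, by simp [hz₀, hd]⟩
    rcases hP.inter_eq hj hzk hz with ⟨h, h'⟩ | ⟨h, h'⟩
    · have : (p - 1) • d = 0 := by
        have h2 : P k + p • d = P k + d := by rw [← hz₀, h', h, hd]; abel
        rw [sub_smul, one_smul, sub_eq_zero]
        exact add_left_cancel h2
      exact smul_ne_zero (by linarith) hd0 this
    · have : p • d = 0 := by simpa [hz₀] using h'
      exact smul_ne_zero hp0.ne' hd0 this
  obtain ⟨ρ, hρ, hdisj⟩ := exists_ball_disjoint _ hother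
  set N : EuclideanSpace ℝ (Fin 2) := !₂[-d 1, d 0] with hNdef
  have hN : toComplex N = Complex.I * toComplex d := by
    apply Complex.ext <;> simp [hNdef]
  have hcN : cross d N ≠ 0 := by
    intro h
    obtain ⟨c, hc⟩ := eq_smul_of_cross_eq_zero hd0 h
    rw [hc, toComplex_smul] at hN
    have h2 := mul_right_cancel₀ (by rwa [ne_eq, toComplex_eq_zero]) hN
    have := congrArg Complex.im h2
    simp at this
  obtain ⟨c, hc, hcb⟩ := exists_smul_mem_ball z₀ N (lt_min hr hρ)
  have hpp : 0 < p * (1 - p) := mul_pos hp0 (by linarith)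
  set R : EuclideanSpace ℝ (Fin 2) → ℝ := fun z => ∑ i ∈ Finset.univ.erase k, (P.edgeRatio i z).arg
  have hRc : ContinuousAt R z₀ := by
    refine tendsto_finsetSum _ fun i hi => continuousAt_edgeRatio ?_
    exact hother i (Finset.ne_of_mem_erase hi)
  have hsum : ∀ z, P.totalAngle z = (P.edgeRatio k z).arg + R z := fun z =>
    (Finset.add_sum_erase _ _ (Finset.mem_univ k)).symm
  have hval : ∀ ε : ℝ, ε ≠ 0 → |ε| ≤ c → (P.edgeRatio k (z₀ + ε • N)).arg = -R (z₀ + ε • N) := by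
    intro ε hε hεc
    have hb := hcb ε hεc
    have hzb : z₀ + ε • N ∉ P.boundary ℝ := by
      intro h
      obtain ⟨j, hj⟩ := Set.mem_iUnion.1 h
      by_cases hjk : j = k
      · subst hjk
        obtain ⟨q, _, _, hq⟩ := mem_edgeSet.1 hj
        have : ε * cross d N = 0 := by
          have h2 : ε • N = (q - p) • d := by
            have : ε • N = (z₀ + ε • N - P j) - p • d := by rw [hz₀]; abel
            rw [this, hq, sub_smul]
          rw [← cross_smul_right, h2, cross_smul_right, cross_self, mul_zero]
        exact (mul_ne_zero hε hcN) this
      · exact hdisj _ (Metric.ball_subset_ball (min_le_right _ _) hb) j hjk hj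
    have := totalAngle_eq_zero (hcon _ (Metric.ball_subset_ball (min_le_left _ _) hb) hzb)
    rw [hsum] at this
    linarith
  have hlim : ContinuousAt (fun ε : ℝ => R (z₀ + ε • N)) 0 := by
    refine ContinuousAt.comp (f := fun ε : ℝ => z₀ + ε • N) (g := R) ?_ (by fun_prop)
    simpa using hRc
  have hre : ∀ ε : ℝ, ε ≠ 0 → ε ^ 2 < p * (1 - p) →
      Real.pi / 2 < |(P.edgeRatio k (z₀ + ε • N)).arg| := by
    intro ε hε hε2
    by_contra h
    rw [not_lt, Complex.abs_arg_le_pi_div_two_iff, edgeRatio_normal hdne hN hε] at h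
    have : (ε ^ 2 - p * (1 - p)) / (p ^ 2 + ε ^ 2) < 0 :=
      div_neg_of_neg_of_pos (by linarith) (by positivity)
    simp only [Complex.add_re, Complex.ofReal_re, Complex.mul_re, Complex.I_re, Complex.ofReal_im,
      Complex.I_im] at h
    linarith
  have hsmall : ∀ᶠ ε : ℝ in nhds 0, ε ^ 2 < p * (1 - p) ∧ |ε| ≤ c := by
    refine Filter.Eventually.and ?_ ?_
    · have : Continuous fun ε : ℝ => ε ^ 2 := by fun_prop
      exact (this.tendsto 0).eventually_lt_const (by simpa using hpp)
    · have : Continuous fun ε : ℝ => |ε| := by fun_prop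
      exact ((this.tendsto 0).eventually_lt_const (by simpa using hc)).mono fun _ h => h.le
  have hp1 : R z₀ ≤ -(Real.pi / 2) := by
    have h1 : Filter.Tendsto (fun ε : ℝ => R (z₀ + ε • N)) (nhdsWithin 0 (Set.Ioi 0))
        (nhds (R z₀)) := by
      simpa using hlim.tendsto.mono_left nhdsWithin_le_nhds
    refine le_of_tendsto h1 ?_
    filter_upwards [nhdsWithin_le_nhds hsmall, self_mem_nhdsWithin] with ε hε hpos
    have hpos : 0 < ε := hpos
    have h2 := hre ε hpos.ne' hε.1
    rw [abs_of_nonneg, hval ε hpos.ne' hε.2] at h2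
    · linarith
    · rw [Complex.arg_nonneg_iff, edgeRatio_normal hdne hN hpos.ne']
      simp only [Complex.add_im, Complex.ofReal_im, Complex.mul_im, Complex.I_im, Complex.I_re,
        Complex.ofReal_re, mul_zero, mul_one, zero_add, add_zero]
      positivity
  have hp2 : Real.pi / 2 ≤ R z₀ := by
    have h1 : Filter.Tendsto (fun ε : ℝ => R (z₀ + ε • N)) (nhdsWithin 0 (Set.Iio 0))
        (nhds (R z₀)) := by
      simpa using hlim.tendsto.mono_left nhdsWithin_le_nhds
    refine ge_of_tendsto h1 ?_
    filter_upwards [nhdsWithin_le_nhds hsmall, self_mem_nhdsWithin] with ε hε hneg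
    have hneg : ε < 0 := hneg
    have h2 := hre ε hneg.ne hε.1
    rw [abs_of_neg, hval ε hneg.ne hε.2] at h2
    · linarith
    · rw [Complex.arg_neg_iff, edgeRatio_normal hdne hN hneg.ne]
      simp only [Complex.add_im, Complex.ofReal_im, Complex.mul_im, Complex.I_im, Complex.I_re,
        Complex.ofReal_re, mul_zero, mul_one, zero_add, add_zero]
      exact div_neg_of_neg_of_pos hneg (by positivity)
  linarith [Real.pi_pos]

/-- Lexicographic comparison with the extreme vertex cuts out a convex set, so it passes from the
vertices to the whole boundary. -/
lemma convex_lex (f g : EuclideanSpace ℝ (Fin 2) →L[ℝ] ℝ) (F G : ℝ) :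
    Convex ℝ {z | f z < F ∨ (f z = F ∧ g z ≤ G)} := by
  intro x hx y hy a b ha hb hab
  have hfx : f x ≤ F := hx.elim le_of_lt fun h => h.1.le
  have hfy : f y ≤ F := hy.elim le_of_lt fun h => h.1.le
  rcases ha.eq_or_lt with rfl | ha'
  · obtain rfl : b = 1 := by linarith
    simpa using hy
  rcases hb.eq_or_lt with rfl | hb'
  · obtain rfl : a = 1 := by linarith
    simpa using hx
  simp only [Set.mem_ofPred_eq, map_add, map_smul, smul_eq_mul]
  have hF : F = a * F + b * F := by rw [← add_mul, hab, one_mul]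
  have hG : G = a * G + b * G := by rw [← add_mul, hab, one_mul]
  rcases hx with hx | hx
  · left; nlinarith
  · rcases hy with hy | hy
    · left; nlinarith
    · right
      rw [hx.1, hy.1]
      exact ⟨hF.symm, by nlinarith⟩

/-- The maximum of a linear function on the region is attained at a convex vertex. -/
theorem IsSimple.exists_convexVertex (hP : P.IsSimple)
    (f g : EuclideanSpace ℝ (Fin 2) →L[ℝ] ℝ) (hfg : ∀ d, f d = 0 → g d = 0 → d = 0)
    (hf : ∃ w, 0 < f w) : ∃ i, P.IsConvexVertex i ∧ ∀ z ∈ P.region, f z ≤ f (P i) := by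
  have hn := hP.three_le
  -- Ties in `f` are broken by `g`, so that the chosen vertex is a genuine corner.
  obtain ⟨i, -, hi⟩ := Finset.exists_max_image (Finset.univ : Finset (Fin n))
    (fun i => toLex (f (P i), g (P i))) ⟨⟨0, by omega⟩, Finset.mem_univ _⟩
  have hlex : ∀ j, f (P j) < f (P i) ∨ (f (P j) = f (P i) ∧ g (P j) ≤ g (P i)) := by
    intro j
    have := hi j (Finset.mem_univ j)
    rwa [Prod.Lex.toLex_le_toLex] at this
  have hle : ∀ j, f (P j) ≤ f (P i) := fun j => (hlex j).elim le_of_lt fun h => h.1.le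
  have hreg : ∀ z ∈ P.region, f z ≤ f (P i) := by
    intro z hz
    obtain ⟨j, hj⟩ := exists_le_vertex hz f
    exact hj.trans (hle j)
  refine ⟨i, ?_, hreg⟩
  have hbd : ∀ z ∈ P.boundary ℝ, f z < f (P i) ∨ (f z = f (P i) ∧ g z ≤ g (P i)) := by
    intro z hz
    have : convexHull ℝ (Set.range P) ⊆ {z | f z < f (P i) ∨ (f z = f (P i) ∧ g z ≤ g (P i))} := by
      refine convexHull_min ?_ (convex_lex f g _ _)
      rintro _ ⟨j, rfl⟩
      exact hlex j
    exact this (boundary_subset_convexHull hz)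
  rcases hP.local_structure (vertex_mem_boundary i) with
    ⟨d, hd, r, hr, hB⟩ | ⟨k, hk, hcr, r, hr, hB⟩
  -- On a straight piece of boundary through `P i`, neither of two opposite directions may increase
  -- `(f, g)`, so both functionals vanish on `d`.
  · exfalso
    obtain ⟨c, hc, hcb⟩ := exists_smul_mem_ball (P i) d hr
    have hmem : ∀ c', |c'| ≤ c → P i + c' • d ∈ P.boundary ℝ := fun c' hc' =>
      (hB _ (hcb c' hc')).2 (by rw [add_sub_cancel_left, cross_smul_right, cross_self, mul_zero])
    have h1 := hbd _ (hmem c (abs_of_pos hc).le)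
    have h2 := hbd _ (hmem (-c) (by rw [abs_neg, abs_of_pos hc]))
    simp only [map_add, map_smul, smul_eq_mul] at h1 h2
    have hfd : c * f d = 0 := by
      rcases h1 with h1 | h1 <;> rcases h2 with h2 | h2 <;> linarith
    have hgd : c * g d = 0 := by
      rcases h1 with h1 | h1 <;> rcases h2 with h2 | h2 <;> linarith
    exact hd (hfg d ((mul_eq_zero.1 hfd).resolve_left hc.ne')
      ((mul_eq_zero.1 hgd).resolve_left hc.ne'))
  · obtain rfl := hP.injective hk
    set d₁ := P (finRotate n i) - P i with hd₁
    set d₂ := P ((finRotate n).symm i) - P i with hd₂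
    have hf₁ : f d₁ ≤ 0 := by rw [hd₁, map_sub]; linarith [hle (finRotate n i)]
    have hf₂ : f d₂ ≤ 0 := by rw [hd₂, map_sub]; linarith [hle ((finRotate n).symm i)]
    -- Points with a larger value of `f` are exterior, and they cannot lie in the small sector
    -- because `f` does not increase along either edge.
    have hlarge : largeSector (P i) r d₁ d₂ ⊆ P.regionᶜ := by
      obtain ⟨w, hw⟩ := hf
      obtain ⟨c, hc, hcb⟩ := exists_smul_mem_ball (P i) w hr
      have hball := hcb c (abs_of_pos hc).le
      have hout : P i + c • w ∉ P.region := by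
        intro h
        have := hreg _ h
        rw [map_add, map_smul, smul_eq_mul] at this
        nlinarith
      rcases mem_sector_of_notMem hcr hB hball (notMem_region.1 hout).1 with h | h
      · exfalso
        have hexp := congrArg f (coord_expand hcr (c • w))
        rw [map_add, map_smul, map_smul, map_smul, smul_eq_mul, smul_eq_mul, smul_eq_mul] at hexp
        have h1 := h.2.1
        have h2 := h.2.2
        rw [add_sub_cancel_left] at h1 h2
        nlinarith
      · exact subset_compl_region (isPreconnected_largeSector _ hr hcr)
          (largeSector_subset_compl hcr hB) h hout
    -- Otherwise the exterior would lie on both sides of edge `i` near the vertex.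
    have hsmall : smallSector (P i) r d₁ d₂ ⊆ P.region := by
      intro z hz
      by_contra hzr
      have hsub := subset_compl_region (isPreconnected_smallSector _ _ _ _)
        (smallSector_subset_compl hcr hB) hz hzr
      obtain ⟨c, hc, hcb⟩ := exists_smul_mem_ball (P i) d₁ hr
      set p := min c (1 / 2) with hp
      have hp0 : 0 < p := by positivity
      have hp1 : p < 1 := (min_le_right _ _).trans_lt (by norm_num)
      have hball := hcb p (by rw [abs_of_pos hp0]; exact min_le_left _ _)
      obtain ⟨ρ, hρ, hρb⟩ := Metric.isOpen_iff.1 Metric.isOpen_ball _ hball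
      obtain ⟨y, hy, hyb, hyr⟩ := hP.exists_mem_region_near_edge i hp0 hp1 hρ
      rcases mem_sector_of_notMem hcr hB (hρb hy) hyb with h | h
      · exact hsub h hyr
      · exact hlarge h hyr
    refine ⟨r, hr, ?_⟩
    have hnonneg : ∀ {l : EuclideanSpace ℝ (Fin 2) → ℝ}, IsLinearMap ℝ l →
        Convex ℝ {w | 0 ≤ l (w - P i)} := by
      intro l hl
      have : {w | 0 ≤ l (w - P i)} = {w | l (P i) ≤ l w} := by
        ext w; simp [hl.map_sub]
      rw [this]
      exact convex_halfSpace_ge hl _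
    have heq : P.region ∩ Metric.ball (P i) r = Metric.ball (P i) r ∩
        ({w | 0 ≤ coordFst d₁ d₂ (w - P i)} ∩ {w | 0 ≤ coordSnd d₁ d₂ (w - P i)}) := by
      ext w
      constructor
      · rintro ⟨hw, hwb⟩
        by_contra h
        refine hlarge ⟨hwb, ?_⟩ hw
        by_contra h'
        rw [Set.mem_ofPred_eq] at h'
        push Not at h'
        exact h ⟨hwb, h'.1, h'.2⟩
      · rintro ⟨hwb, h1, h2⟩
        refine ⟨?_, hwb⟩
        by_cases hwB : w ∈ P.boundary ℝ
        · exact boundary_subset_region hwB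
        · rcases mem_sector_of_notMem hcr hB hwb hwB with h | h
          · exact hsmall h
          · rcases h.2 with h | h
            · exact absurd h (not_lt.2 h1)
            · exact absurd h (not_lt.2 h2)
    rw [heq]
    exact (convex_ball _ _).inter ((hnonneg (isLinearMap_coordFst _ _)).inter
      (hnonneg (isLinearMap_coordSnd _ _)))

/-- The long width is at least the distance of any two points of the region. -/
theorem IsSimple.le_longWidth (hP : P.IsSimple) {x y : EuclideanSpace ℝ (Fin 2)}
    (hx : x ∈ P.region) (hy : y ∈ P.region) : ENNReal.ofReal ‖y - x‖ ≤ P.longWidth := by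
  rcases eq_or_ne x y with rfl | hxy
  · simp
  have hn : 0 < ‖y - x‖ := norm_pos_iff.2 (sub_ne_zero.2 hxy.symm)
  -- The outer strip orthogonal to `y - x` contains both points between its lines, so its width is
  -- at least their distance.
  set ν := ‖y - x‖⁻¹ • (y - x) with hν
  have hν1 : ‖ν‖ = 1 := by
    rw [hν, norm_smul, norm_inv, norm_norm, inv_mul_cancel₀ hn.ne']
  have hν0 : ν ≠ 0 := by rintro h; rw [h, norm_zero] at hν1; exact zero_ne_one hν1
  have hνν : inner ℝ ν ν = 1 := by rw [real_inner_self_eq_norm_sq, hν1, one_pow]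
  have hfg : ∀ d, innerSL ℝ ν d = 0 → crossCLM ν d = 0 → d = 0 := by
    intro d h1 h2
    obtain ⟨c, rfl⟩ := eq_smul_of_cross_eq_zero hν0 h2
    rw [innerSL_apply_apply, inner_smul_right, hνν, mul_one] at h1
    rw [h1, zero_smul]
  obtain ⟨j, hj, hjmax⟩ := hP.exists_convexVertex (innerSL ℝ ν) (crossCLM ν) hfg
    ⟨ν, by rw [innerSL_apply_apply, hνν]; exact one_pos⟩
  obtain ⟨i, hi, himin⟩ := hP.exists_convexVertex (-innerSL ℝ ν) (crossCLM ν)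
    (fun d h1 h2 => hfg d (by simpa using h1) h2)
    ⟨-ν, by simp [hν1]⟩
  have hstrip : P.IsOuterStrip i j ν := by
    refine ⟨hν1, hi, hj, fun z hz => ⟨?_, ?_⟩⟩
    · have := himin z hz
      simp only [neg_apply, innerSL_apply_apply] at this
      rw [real_inner_comm, real_inner_comm ν]
      linarith
    · have := hjmax z hz
      simp only [innerSL_apply_apply] at this
      rwa [real_inner_comm, real_inner_comm ν]
  refine le_trans (ENNReal.ofReal_le_ofReal ?_) (le_iSup_of_le i (le_iSup_of_le j
    (le_iSup_of_le ν (le_iSup_of_le hstrip le_rfl))))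
  have h1 := (hstrip.2.2.2 x hx).1
  have h2 := (hstrip.2.2.2 y hy).2
  have h3 : inner ℝ y ν - inner ℝ x ν = ‖y - x‖ := by
    rw [← inner_sub_left, hν, inner_smul_right, real_inner_self_eq_norm_sq]
    field_simp
  linarith

end

/-! ### Translating a line of sight: obstacles and inner strips. -/

section

variable {n : ℕ} {P : Polygon (EuclideanSpace ℝ (Fin 2)) n}

/-- The side of the line of sight `s t` on which `z` lies, with orientation `σ`. -/
def side (σ : ℝ) (s t z : EuclideanSpace ℝ (Fin 2)) : ℝ := σ * cross (z - s) (t - s)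

variable (P) in
/-- `P.IsObstacle σ s t e d m i`: on the negative side of the line of sight `s t`, between the lines
through `s` and `t` in directions `e` and `d`, the reflex vertex `i` is the first vertex that a
parallel translate of the line of sight meets when moved by less than `m`. -/
structure IsObstacle (σ : ℝ) (s t e d : EuclideanSpace ℝ (Fin 2)) (m : ℝ) (i : Fin n) : Prop where
  reflex : P.IsReflexVertex i
  above : 0 ≤ σ * cross e (P i - s)
  below : 0 ≤ σ * cross (P i - t) d
  neg_lt : -m < side σ s t (P i)
  nonpos : side σ s t (P i) ≤ 0
  next_le : side σ s t (P (finRotate n i)) ≤ side σ s t (P i)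
  prev_le : side σ s t (P ((finRotate n).symm i)) ≤ side σ s t (P i)
  free : ∀ z, 0 < σ * cross e (z - s) → 0 < σ * cross (z - t) d → -m < side σ s t z →
    side σ s t z < 0 → z ∉ P.region → side σ s t z < side σ s t (P i)

section slab
variable {σ : ℝ} {s t e d : EuclideanSpace ℝ (Fin 2)}

/-- Coordinates along the source direction `e` and the line of sight. The coefficient of `e`
measures how far the translate of the line of sight through `z` has moved along the source;
`expand_target` does the same on the target. -/
lemma expand_source (hα : 0 < σ * cross e (t - s)) (z : EuclideanSpace ℝ (Fin 2)) :
    z = s + (side σ s t z / (σ * cross e (t - s))) • e +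
      (σ * cross e (z - s) / (σ * cross e (t - s))) • (t - s) := by
  have h := congrArg (fun v => (σ * cross e (t - s))⁻¹ • σ • v) (cross_smul_eq e (t - s) (z - s))
  simp only [smul_smul, smul_add] at h
  rw [inv_mul_cancel₀ hα.ne', one_smul] at h
  rw [side, div_eq_inv_mul, div_eq_inv_mul, add_assoc, ← h]
  abel

lemma expand_target (hβ : 0 < σ * cross d (t - s)) (z : EuclideanSpace ℝ (Fin 2)) :
    z = t + (side σ s t z / (σ * cross d (t - s))) • d -
      (σ * cross (z - t) d / (σ * cross d (t - s))) • (t - s) := by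
  have h := congrArg (fun v => (σ * cross d (t - s))⁻¹ • σ • v) (cross_smul_eq d (t - s) (z - t))
  simp only [smul_smul, smul_add] at h
  rw [inv_mul_cancel₀ hβ.ne', one_smul] at h
  have h1 : cross (z - s) (t - s) = cross (z - t) (t - s) := by
    have : z - s = (z - t) + (t - s) := by abel
    rw [this, cross_add_left, cross_self, add_zero]
  rw [cross_comm d (z - t), mul_neg, mul_neg, neg_smul] at h
  rw [side, h1, div_eq_inv_mul, div_eq_inv_mul, add_sub_assoc,
    sub_eq_add_neg, ← h]
  abel

/-- The negative side of the line of sight, up to distance `m`. -/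
def slab (σ : ℝ) (s t e d : EuclideanSpace ℝ (Fin 2)) (m : ℝ) : Set (EuclideanSpace ℝ (Fin 2)) :=
  {z | 0 < σ * cross e (z - s) ∧ 0 < σ * cross (z - t) d ∧ -m < side σ s t z ∧ side σ s t z < 0}

lemma isOpen_slab (m : ℝ) : IsOpen (slab σ s t e d m) := by
  unfold slab side
  refine IsOpen.and ?_ (IsOpen.and ?_ (IsOpen.and ?_ ?_)) <;>
    exact isOpen_lt (by fun_prop) (by fun_prop)

lemma closure_slab_subset (m : ℝ) : closure (slab σ s t e d m) ⊆
    {z | 0 ≤ σ * cross e (z - s) ∧ 0 ≤ σ * cross (z - t) d ∧ -m ≤ side σ s t z ∧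
      side σ s t z ≤ 0} := by
  refine closure_minimal (fun z hz => ⟨hz.1.le, hz.2.1.le, hz.2.2.1.le, hz.2.2.2.le⟩) ?_
  unfold side
  refine IsClosed.and ?_ (IsClosed.and ?_ (IsClosed.and ?_ ?_)) <;>
    exact isClosed_le (by fun_prop) (by fun_prop)

/-- The distance from the line of sight is bounded by `m`. Along it, the line through `s` bounds the
slab on one side and the line through `t` on the other, since neither is parallel to the line of
sight. -/
lemma isBounded_slab (hα : 0 < σ * cross e (t - s)) (hβ : 0 < σ * cross d (t - s)) (m : ℝ) :
    Bornology.IsBounded (slab σ s t e d m) := by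
  set α := σ * cross e (t - s) with hαd
  set β := σ * cross d (t - s) with hβd
  rw [isBounded_iff_forall_norm_le]
  refine ⟨‖s‖ + m / α * ‖e‖ + (α + m / β * |σ * cross e d|) / α * ‖t - s‖, ?_⟩
  rintro z ⟨hA, hB, h1, h2⟩
  have hφ : |side σ s t z| ≤ m := abs_le.2 ⟨h1.le, by linarith⟩
  have hm : 0 ≤ m := (abs_nonneg _).trans hφ
  have hz := expand_target hβ z
  have hAz : σ * cross e (z - s) = α + side σ s t z / β * (σ * cross e d) -
      σ * cross (z - t) d / β * α := by
    conv_lhs => rw [hz]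
    have : t + (side σ s t z / β) • d - (σ * cross (z - t) d / β) • (t - s) - s =
      (t - s) + (side σ s t z / β) • d - (σ * cross (z - t) d / β) • (t - s) := by abel
    rw [this, cross_sub_right, cross_add_right, cross_smul_right, cross_smul_right, hαd]
    ring
  have hAle : σ * cross e (z - s) ≤ α + m / β * |σ * cross e d| := by
    have h3 : 0 ≤ σ * cross (z - t) d / β * α := by positivity
    have h4 : side σ s t z / β * (σ * cross e d) ≤ m / β * |σ * cross e d| := by
      calc _ ≤ |side σ s t z / β * (σ * cross e d)| := le_abs_self _
        _ = |side σ s t z| / β * |σ * cross e d| := by rw [abs_mul, abs_div, abs_of_pos hβ]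
        _ ≤ _ := by gcongr
    linarith
  rw [expand_source hα z]
  refine (norm_add_le _ _).trans (add_le_add ((norm_add_le _ _).trans (add_le_add le_rfl ?_)) ?_)
  · rw [norm_smul, Real.norm_eq_abs, abs_div, abs_of_pos hα]
    gcongr
  · rw [norm_smul, Real.norm_of_nonneg (by positivity)]
    gcongr

/-- A boundary point of the slab on one of the segments lies in the region. -/
lemma mem_region_of_slab (hα : 0 < σ * cross e (t - s)) (hβ : 0 < σ * cross d (t - s)) {p q : ℝ}
    (hS : segment ℝ (s - p • e) s ⊆ P.region) (hT : segment ℝ (t - q • d) t ⊆ P.region)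
    (hst : segment ℝ s t ⊆ P.region) {z : EuclideanSpace ℝ (Fin 2)}
    (hA : 0 ≤ σ * cross e (z - s)) (hB : 0 ≤ σ * cross (z - t) d)
    (h1 : -min (p * (σ * cross e (t - s))) (q * (σ * cross d (t - s))) ≤ side σ s t z)
    (h2 : side σ s t z ≤ 0)
    (h0 : σ * cross e (z - s) = 0 ∨ σ * cross (z - t) d = 0 ∨ side σ s t z = 0) :
    z ∈ P.region := by
  set α := σ * cross e (t - s) with hαd
  set β := σ * cross d (t - s) with hβd
  have hz := expand_source hα z
  have hz' := expand_target hβ z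
  have hmp := min_le_left (p * α) (q * β)
  have hmq := min_le_right (p * α) (q * β)
  have key : ∀ {a v : EuclideanSpace ℝ (Fin 2)} {p c : ℝ}, -p ≤ c → c ≤ 0 →
      a + c • v ∈ segment ℝ (a - p • v) a := by
    intro a v p c h h'
    rw [segment_symm, segment_eq_image']
    rcases (show 0 ≤ p by linarith).eq_or_lt with rfl | hp
    · obtain rfl : c = 0 := by linarith
      exact ⟨0, ⟨le_rfl, zero_le_one⟩, by simp⟩
    · refine ⟨-c / p, ⟨div_nonneg (by linarith) hp.le, (div_le_one hp).2 (by linarith)⟩, ?_⟩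
      have : a - p • v - a = (-p) • v := by module
      simp only [this, smul_smul]
      congr 2
      field_simp
  -- The three cases are the side on the source, the side on the target, and the line of sight
  -- itself.
  rcases h0 with h0 | h0 | h0
  · rw [h0, zero_div, zero_smul, add_zero] at hz
    rw [hz]
    refine hS (key ?_ (div_nonpos_of_nonpos_of_nonneg h2 hα.le))
    rw [le_div_iff₀ hα]
    linarith
  · rw [h0, zero_div, zero_smul, sub_zero] at hz'
    rw [hz']
    refine hT (key ?_ (div_nonpos_of_nonpos_of_nonneg h2 hβ.le))
    rw [le_div_iff₀ hβ]
    linarith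
  · rw [h0, zero_div, zero_smul, add_zero] at hz hz'
    set a := σ * cross e (z - s) / α
    set b := σ * cross (z - t) d / β
    have ha : 0 ≤ a := by positivity
    have hb : 0 ≤ b := by positivity
    have hab : a + b = 1 := by
      have h3 : σ * cross e (z - s) = (1 - b) * α := by
        rw [hz', hαd]
        have : t - b • (t - s) - s = (1 - b) • (t - s) := by module
        rw [this, cross_smul_right]
        ring
      have : a = 1 - b := by
        change σ * cross e (z - s) / α = _
        rw [h3, mul_div_assoc, div_self hα.ne', mul_one]
      linarith
    refine hst ?_
    rw [segment_eq_image']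
    exact ⟨a, ⟨ha, by linarith⟩, hz.symm⟩

end slab

lemma segment_subset_of_mem_visibilityPolygon {s t : EuclideanSpace ℝ (Fin 2)}
    (hs : s ∈ P.region) (ht : t ∈ P.visibilityPolygon s) : segment ℝ s t ⊆ P.region := by
  rw [← insert_endpoints_openSegment]
  rintro z (rfl | rfl | hz)
  · exact hs
  · exact ht.1
  · exact interior_subset (ht.2 hz)

/-- When a line of sight is moved in parallel to one side, either it is stopped by an obstacle, or
the end of the source is reached, or the end of the target is reached. -/
theorem IsSimple.obstacle_or_visible (hP : P.IsSimple) {σ : ℝ}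
    {s t e d : EuclideanSpace ℝ (Fin 2)} {p q : ℝ} (hp : 0 ≤ p) (hq : 0 ≤ q)
    (hα : 0 < σ * cross e (t - s)) (hβ : 0 < σ * cross d (t - s))
    (hB : 0 < σ * cross (s - p • e - t) d) (hA : 0 ≤ σ * cross e (t - q • d - s))
    (hS : segment ℝ (s - p • e) s ⊆ P.region) (hT : segment ℝ (t - q • d) t ⊆ P.region)
    (ht : t ∈ P.visibilityPolygon s) :
    (∃ i, P.IsObstacle σ s t e d
      (min (p * (σ * cross e (t - s))) (q * (σ * cross d (t - s)))) i) ∨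
    t ∈ P.visibilityPolygon (s - p • e) ∨
    (q * (σ * cross d (t - s)) ≤ p * (σ * cross e (t - s)) ∧
      ∀ p', 0 < p' → p' * (σ * cross e (t - s)) < q * (σ * cross d (t - s)) →
      ∀ q', 0 ≤ q' → q' ≤ q → 0 < σ * cross e (t - q' • d - s) →
        t - q' • d ∈ P.visibilityPolygon (s - p' • e)) := by
  have hst := segment_subset_of_mem_visibilityPolygon (hS (right_mem_segment ..)) ht
  set α := σ * cross e (t - s) with hαd
  set β := σ * cross d (t - s) with hβd
  set γ := σ * cross e d with hγd
  set m := min (p * α) (q * β) with hm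
  by_cases hK : ∃ z ∈ slab σ s t e d m, z ∉ P.region
  · left
    obtain ⟨z₀, hz₀, hz₀r⟩ := hK
    -- Up to a constant this is `side`, so a maximal exterior point is one that the moving line of
    -- sight meets first.
    set f : EuclideanSpace ℝ (Fin 2) →L[ℝ] ℝ := (-σ) • crossCLM (t - s) with hf
    have hfz : ∀ z, f z = side σ s t z + f s := by
      intro z
      simp only [hf, side, smul_apply, crossCLM_apply, smul_eq_mul]
      rw [cross_comm (z - s), cross_sub_right]
      ring
    obtain ⟨i, hi, hrefl, hlt, hnext, hprev, hfree⟩ := hP.exists_reflexVertex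
      (isOpen_slab m) (isBounded_slab hα hβ m) f (crossCLM e) (m := f s - m) (by
        intro v h1 h2
        have hσ : σ ≠ 0 := by rintro rfl; simp [hαd] at hα
        have hc : cross (t - s) v = 0 := by
          simp only [hf, smul_apply, crossCLM_apply, smul_eq_mul] at h1
          exact (mul_eq_zero.1 h1).resolve_left (neg_ne_zero.2 hσ)
        have hts : t - s ≠ 0 := by intro h; rw [hαd, h] at hα; simp at hα
        obtain ⟨c, rfl⟩ := eq_smul_of_cross_eq_zero hts hc
        rw [crossCLM_apply, cross_smul_right] at h2
        have : c = 0 := by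
          refine (mul_eq_zero.1 h2).resolve_right ?_
          intro h; rw [hαd, h] at hα; simp at hα
        rw [this, zero_smul])
      ⟨e, by
        simp only [hf, smul_apply, crossCLM_apply, smul_eq_mul]
        rw [cross_comm]
        linarith⟩ (by
        -- Three sides of the slab lie in the region, so an exterior point on its frontier is on the
        -- far side, at level `-m`.
        intro z hzc hzK hzr
        obtain ⟨h1, h2, h3, h4⟩ := closure_slab_subset m hzc
        by_contra hlt
        rw [hfz z] at hlt
        refine hzr (mem_region_of_slab hα hβ hS hT hst h1 h2 h3 h4 ?_)
        by_contra h0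
        push Not at h0
        exact hzK ⟨h1.lt_of_ne h0.1.symm, h2.lt_of_ne h0.2.1.symm, by linarith,
          h4.lt_of_ne h0.2.2⟩) hz₀ hz₀r (by rw [hfz z₀]; linarith [hz₀.2.2.1])
    obtain ⟨h1, h2, h3, h4⟩ := closure_slab_subset m hi
    refine ⟨i, hrefl, h1, h2, ?_, h4, ?_, ?_, ?_⟩
    · rw [hfz (P i)] at hlt; linarith
    · rw [hfz, hfz (P i)] at hnext; linarith
    · rw [hfz, hfz (P i)] at hprev; linarith
    · intro z hA hB h5 h6 hz
      have := hfree z ⟨hA, hB, h5, h6⟩ hz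
      rw [hfz, hfz (P i)] at this
      linarith
  · right
    push Not at hK
    -- With no exterior point the open slab is interior to the region, and visibility follows once
    -- the open segment lies in the slab.
    have hKint : slab σ s t e d m ⊆ interior P.region := interior_maximal hK (isOpen_slab m)
    rw [show s - p • e - t = -(t - s) - p • e by abel, cross_sub_left, cross_neg_left,
      cross_comm (t - s), cross_smul_left] at hB
    rw [show t - q • d - s = (t - s) - q • d by abel, cross_sub_right, cross_smul_right] at hA
    -- membership of a point of a segment in the slab
    have key : ∀ a b p' q' : ℝ, a + b = 1 →
        (σ * cross e (a • (s - p' • e) + b • (t - q' • d) - s) = b * (α - q' * γ)) ∧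
        (σ * cross (a • (s - p' • e) + b • (t - q' • d) - t) d = a * (β - p' * γ)) ∧
        (side σ s t (a • (s - p' • e) + b • (t - q' • d)) = -(a * (p' * α) + b * (q' * β))) := by
      intro a b p' q' hab
      obtain rfl : a = 1 - b := by linarith
      have e1 : (1 - b) • (s - p' • e) + b • (t - q' • d) - s =
        b • (t - s) - (b * q') • d - ((1 - b) * p') • e := by module
      have e2 : (1 - b) • (s - p' • e) + b • (t - q' • d) - t =
        -((1 - b) • (t - s)) - (b * q') • d - ((1 - b) * p') • e := by module
      refine ⟨?_, ?_, ?_⟩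
      · rw [e1]
        simp only [cross_sub_right, cross_smul_right, cross_self, hαd, hγd]
        ring
      · rw [e2]
        simp only [cross_sub_left, cross_smul_left, cross_neg_left, cross_self, hβd, hγd]
        rw [cross_comm t d, cross_comm s d, cross_sub_right]
        ring
      · rw [side, e1]
        simp only [cross_sub_left, cross_smul_left, cross_self, cross_sub_right, hβd, hαd]
        rw [cross_comm s t]
        ring
    -- The translate reaches the end of the source at level `-(p * α)` and the end of the target at
    -- level `-(q * β)`; the first of the two decides.
    rcases le_total (p * α) (q * β) with hle | hle
    · left
      rw [min_eq_left hle] at hm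
      rcases hp.eq_or_lt with rfl | hp
      · simpa using ht
      refine ⟨ht.1, ?_⟩
      rintro z ⟨a, b, ha, hb, hab, rfl⟩
      apply hKint
      obtain ⟨k1, k2, k3⟩ := key a b p 0 hab
      simp only [zero_smul, sub_zero, zero_mul, mul_zero, add_zero] at k1 k2 k3
      refine ⟨k1 ▸ by positivity, k2 ▸ ?_, k3 ▸ ?_, k3 ▸ ?_⟩
      · refine mul_pos ha ?_
        linarith
      · rw [hm, neg_lt_neg_iff]
        have : 0 < p * α := by positivity
        nlinarith
      · have : 0 < a * (p * α) := by positivity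
        linarith
    · right
      refine ⟨hle, fun p' hp' hp'q q' hq' hq'q hA' => ⟨?_, ?_⟩⟩
      · apply hT
        rw [segment_symm, segment_eq_image']
        rcases hq.eq_or_lt with rfl | hq
        · obtain rfl : q' = 0 := le_antisymm hq'q hq'
          exact ⟨0, ⟨le_rfl, zero_le_one⟩, by simp⟩
        · refine ⟨q' / q, ⟨by positivity, (div_le_one hq).2 hq'q⟩, ?_⟩
          have : t - q • d - t = (-q) • d := by module
          simp only [this, smul_smul]
          rw [show q' / q * -q = -q' by field_simp, neg_smul, ← sub_eq_add_neg]
      · rw [min_eq_right hle] at hm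
        rw [show t - q' • d - s = (t - s) - q' • d by abel, cross_sub_right, cross_smul_right] at hA'
        rintro z ⟨a, b, ha, hb, hab, rfl⟩
        apply hKint
        obtain ⟨k1, k2, k3⟩ := key a b p' q' hab
        have hpp : p' ≤ p := by
          by_contra h
          nlinarith
        refine ⟨k1 ▸ ?_, k2 ▸ ?_, k3 ▸ ?_, k3 ▸ ?_⟩
        · refine mul_pos hb ?_
          linarith
        · refine mul_pos ha ?_
          rcases le_total γ 0 with hγ | hγ
          · nlinarith
          · have : p' * γ ≤ p * γ := by gcongr
            linarith
        · rw [hm, neg_lt_neg_iff]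
          have h1 : q' * β ≤ q * β := by gcongr
          have h2 : a * (p' * α) < a * (q * β) := by gcongr
          have h3 : b * (q' * β) ≤ b * (q * β) := by gcongr
          have h4 : a * (q * β) + b * (q * β) = q * β := by rw [← add_mul, hab, one_mul]
          linarith
        · have h1 : 0 < a * (p' * α) := by positivity
          have h2 : 0 ≤ b * (q' * β) := by positivity
          linarith

/-- Rotating `w` by a right angle turns the cross product into an inner product. This converts
values of `side` into distances measured along a unit normal of the line of sight. -/
lemma exists_normal {σ : ℝ} (hσ : σ ≠ 0) {w : EuclideanSpace ℝ (Fin 2)} (hw : w ≠ 0) :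
    ∃ ν : EuclideanSpace ℝ (Fin 2), ‖ν‖ = 1 ∧
      ∀ z, σ * cross z w = (|σ| * ‖w‖) * inner ℝ z ν := by
  have hn : 0 < ‖w‖ := norm_pos_iff.2 hw
  have hσ' : 0 < |σ| := abs_pos.2 hσ
  set N : EuclideanSpace ℝ (Fin 2) := !₂[w 1, -w 0] with hN
  have hNn : ‖N‖ = ‖w‖ := by
    rw [EuclideanSpace.norm_eq, EuclideanSpace.norm_eq]
    simp [hN, add_comm]
  have hin : ∀ z, inner ℝ z N = cross z w := by
    intro z
    simp [hN, cross, PiLp.inner_apply]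
    ring
  refine ⟨(σ / (|σ| * ‖w‖)) • N, ?_, fun z => ?_⟩
  · rw [norm_smul, hNn, norm_div, norm_mul, Real.norm_eq_abs, Real.norm_eq_abs, abs_abs, norm_norm]
    field_simp
  · rw [inner_smul_right, hin]
    field_simp

/-- Obstacles on both sides of a line of sight bound an inner strip. -/
theorem shortWidth_lt_of_obstacles {σ : ℝ} {s t e d : EuclideanSpace ℝ (Fin 2)}
    {p q p' q' : ℝ}
    (hα : 0 < σ * cross e (t - s)) (hβ : 0 < σ * cross d (t - s))
    (hS : segment ℝ (s - p • e) s ⊆ P.region) (hT : segment ℝ (t - q • d) t ⊆ P.region)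
    (hS' : segment ℝ (s - p' • -e) s ⊆ P.region) (hT' : segment ℝ (t - q' • -d) t ⊆ P.region)
    (ht : t ∈ P.visibilityPolygon s) {i j : Fin n}
    (hi : P.IsObstacle σ s t e d
      (min (p * (σ * cross e (t - s))) (q * (σ * cross d (t - s)))) i)
    (hj : P.IsObstacle (-σ) s t (-e) (-d)
      (min (p' * (-σ * cross (-e) (t - s))) (q' * (-σ * cross (-d) (t - s)))) j) :
    P.shortWidth < ENNReal.ofReal ((p + p') * ‖e‖) := by
  have hst := segment_subset_of_mem_visibilityPolygon (hS (right_mem_segment ..)) ht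
  have hσ : σ ≠ 0 := by rintro rfl; simp at hα
  have hts : t - s ≠ 0 := by intro h; rw [h] at hα; simp at hα
  obtain ⟨ν, hν1, hν⟩ := exists_normal hσ hts
  set c := |σ| * ‖t - s‖
  have hc : 0 < c := mul_pos (abs_pos.2 hσ) (norm_pos_iff.2 hts)
  have hside : ∀ z w, side σ s t z - side σ s t w = c * (inner ℝ z ν - inner ℝ w ν) := by
    intro z w
    rw [side, side, ← mul_sub, ← cross_sub_left, sub_sub_sub_cancel_right, hν, inner_sub_left]
  have hle : ∀ z w, side σ s t z ≤ side σ s t w → inner ℝ z ν ≤ inner ℝ w ν := by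
    intro z w h
    have := hside z w
    have h2 : c * (inner ℝ z ν - inner ℝ w ν) ≤ 0 := by linarith
    have := nonpos_of_mul_nonpos_right h2 hc
    linarith
  -- Negating `σ`, `e` and `d` keeps the lines of source and target with their inner sides, and
  -- exchanges the two sides of the line of sight.
  have hneg : ∀ z, side (-σ) s t z = -side σ s t z := fun z => by rw [side, side, neg_mul]
  have hαj : -σ * cross (-e) (t - s) = σ * cross e (t - s) := by rw [cross_neg_left]; ring
  have hβj : -σ * cross (-d) (t - s) = σ * cross d (t - s) := by rw [cross_neg_left]; ring
  have hj1 := hj.neg_lt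
  have hj2 := hj.nonpos
  have hj3 := hj.next_le
  have hj4 := hj.prev_le
  have hj5 := hj.above
  have hj6 := hj.below
  simp only [hneg, cross_neg_left, cross_neg_right, neg_mul_neg] at hj1 hj2 hj3 hj4 hj5 hj6
  have hstrip : P.IsInnerStrip i j ν := by
    refine ⟨hν1, hi.reflex, hj.reflex, hle _ _ hi.next_le, hle _ _ hi.prev_le,
      hle _ _ (by linarith [hi.nonpos]), hle _ _ (by linarith), hle _ _ (by linarith), ?_⟩
    rintro z ⟨a, b, ha, hb, hab, rfl⟩
    set z := a • P i + b • P j with hz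
    have hzs : ∀ w : EuclideanSpace ℝ (Fin 2), z - w = a • (P i - w) + b • (P j - w) := by
      intro w
      have : w = (a + b) • w := by rw [hab, one_smul]
      rw [hz]
      nth_rewrite 1 [this]
      module
    have h1 : 0 ≤ σ * cross e (z - s) := by
      rw [hzs, cross_add_right, cross_smul_right, cross_smul_right]
      have := hi.above
      nlinarith [mul_nonneg ha this, mul_nonneg hb hj5]
    have h2 : 0 ≤ σ * cross (z - t) d := by
      rw [hzs, cross_add_left, cross_smul_left, cross_smul_left]
      have := hi.below
      nlinarith [mul_nonneg ha this, mul_nonneg hb hj6]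
    have h3 : side σ s t z = a * side σ s t (P i) + b * side σ s t (P j) := by
      rw [side, hzs, cross_add_left, cross_smul_left, cross_smul_left, side, side]
      ring
    have hij : side σ s t (P i) ≤ side σ s t (P j) := by linarith [hi.nonpos]
    have h4 : side σ s t (P i) ≤ side σ s t z := by
      have : side σ s t (P i) = a * side σ s t (P i) + b * side σ s t (P i) := by
        rw [← add_mul, hab, one_mul]
      nlinarith
    have h5 : side σ s t z ≤ side σ s t (P j) := by
      have : side σ s t (P j) = a * side σ s t (P j) + b * side σ s t (P j) := by
        rw [← add_mul, hab, one_mul]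
      nlinarith
    -- An exterior point between the two obstacles would be at least as close to the line of sight
    -- as the obstacle on its side, contrary to that obstacle being met first.
    by_contra hzr
    rcases le_total (side σ s t z) 0 with h6 | h6
    · have h7 := hi.neg_lt
      have h8 : ¬ (σ * cross e (z - s) = 0 ∨ σ * cross (z - t) d = 0 ∨ side σ s t z = 0) :=
        fun h0 => hzr (mem_region_of_slab hα hβ hS hT hst h1 h2 (by linarith) h6 h0)
      push Not at h8
      have := hi.free z (h1.lt_of_ne h8.1.symm) (h2.lt_of_ne h8.2.1.symm) (by linarith)
        (h6.lt_of_ne h8.2.2) hzr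
      linarith
    · have hα' : 0 < -σ * cross (-e) (t - s) := by rwa [hαj]
      have hβ' : 0 < -σ * cross (-d) (t - s) := by rwa [hβj]
      have h1' : 0 ≤ -σ * cross (-e) (z - s) := by rwa [cross_neg_left, neg_mul_neg]
      have h2' : 0 ≤ -σ * cross (z - t) (-d) := by rwa [cross_neg_right, neg_mul_neg]
      have h7 := hj.neg_lt
      rw [hneg] at h7
      have h8 : ¬ (-σ * cross (-e) (z - s) = 0 ∨ -σ * cross (z - t) (-d) = 0 ∨
          side (-σ) s t z = 0) :=
        fun h0 => hzr (mem_region_of_slab hα' hβ' hS' hT' hst h1' h2'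
          (by rw [hneg]; linarith) (by rw [hneg]; linarith) h0)
      push Not at h8
      have := hj.free z (h1'.lt_of_ne h8.1.symm) (h2'.lt_of_ne h8.2.1.symm)
        (by rw [hneg]; linarith)
        ((show side (-σ) s t z ≤ 0 by rw [hneg]; linarith).lt_of_ne h8.2.2) hzr
      rw [hneg, hneg] at this
      linarith
  have hle' : P.shortWidth ≤ ENNReal.ofReal (inner ℝ (P j) ν - inner ℝ (P i) ν) :=
    iInf_le_of_le i (iInf_le_of_le j (iInf_le_of_le ν (iInf_le _ hstrip)))
  have h1 := hi.neg_lt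
  have h2 := min_le_left (p * (σ * cross e (t - s))) (q * (σ * cross d (t - s)))
  have h3 := min_le_left (p' * (σ * cross e (t - s))) (q' * (σ * cross d (t - s)))
  -- Each obstacle is met before the end of the source, so the strip is narrower than the projection
  -- of `(p + p') • e` on the normal.
  have h4 : c * (inner ℝ (P j) ν - inner ℝ (P i) ν) < c * ((p + p') * inner ℝ e ν) := by
    rw [← hside]
    have : c * ((p + p') * inner ℝ e ν) = (p + p') * (σ * cross e (t - s)) := by
      rw [hν]; ring
    rw [this]
    linarith
  have h5 : inner ℝ (P j) ν - inner ℝ (P i) ν < (p + p') * inner ℝ e ν :=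
    lt_of_mul_lt_mul_left h4 hc.le
  have h6 : inner ℝ e ν ≤ ‖e‖ := by
    have := real_inner_le_norm e ν
    rwa [hν1, mul_one] at this
  have h7 : 0 < p + p' := by
    have h8 : 0 < (p + p') * (σ * cross e (t - s)) := by linarith [hi.nonpos]
    exact pos_of_mul_pos_left h8 hα.le
  refine hle'.trans_lt ?_
  have h9 : 0 ≤ inner ℝ (P j) ν - inner ℝ (P i) ν := sub_nonneg.2 hstrip.2.2.2.2.2.1
  rw [ENNReal.ofReal_lt_ofReal_iff_of_nonneg h9]
  exact h5.trans_le (by gcongr)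

end

/-! ### Guards for a source not longer than the short width. -/

section

variable {n : ℕ} {P : Polygon (EuclideanSpace ℝ (Fin 2)) n}

variable (P) in
/-- `P.Guarded S k Z`: at most `k` points of `S` see all points of `Z`. -/
def Guarded (S : Set (EuclideanSpace ℝ (Fin 2))) (k : ℕ) (Z : Set (EuclideanSpace ℝ (Fin 2))) :
    Prop :=
  ∃ G : Finset (EuclideanSpace ℝ (Fin 2)), (G : Set (EuclideanSpace ℝ (Fin 2))) ⊆ S ∧
    G.card ≤ k ∧ ∀ t ∈ Z, ∃ g ∈ G, t ∈ P.visibilityPolygon g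

namespace Guarded
variable {S S' Z Z' : Set (EuclideanSpace ℝ (Fin 2))} {k k' : ℕ}

lemma mono (h : P.Guarded S k Z) (hS : S ⊆ S') (hk : k ≤ k') (hZ : Z' ⊆ Z) : P.Guarded S' k' Z' := by
  obtain ⟨G, h1, h2, h3⟩ := h
  exact ⟨G, h1.trans hS, h2.trans hk, fun t ht => h3 t (hZ ht)⟩

lemma union (h : P.Guarded S k Z) (h' : P.Guarded S k' Z') : P.Guarded S (k + k') (Z ∪ Z') := by
  classical
  obtain ⟨G, h1, h2, h3⟩ := h
  obtain ⟨G', h1', h2', h3'⟩ := h'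
  refine ⟨G ∪ G', ?_, (Finset.card_union_le _ _).trans (add_le_add h2 h2'), ?_⟩
  · rw [Finset.coe_union]; exact Set.union_subset h1 h1'
  · rintro t (ht | ht)
    · obtain ⟨g, hg, h⟩ := h3 t ht
      exact ⟨g, Finset.mem_union_left _ hg, h⟩
    · obtain ⟨g, hg, h⟩ := h3' t ht
      exact ⟨g, Finset.mem_union_right _ hg, h⟩

lemma of_forall {g : EuclideanSpace ℝ (Fin 2)} (hg : g ∈ S)
    (h : ∀ t ∈ Z, t ∈ P.visibilityPolygon g) : P.Guarded S 1 Z :=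
  ⟨{g}, by simpa using hg, by simp, fun t ht => ⟨g, by simp, h t ht⟩⟩

lemma of_subsingleton (hZ : Z.Subsingleton) (h : ∀ t ∈ Z, ∃ s ∈ S, t ∈ P.visibilityPolygon s) :
    P.Guarded S 1 Z := by
  rcases hZ.eq_empty_or_singleton with rfl | ⟨t, rfl⟩
  · exact ⟨∅, by simp, by simp, by simp⟩
  · obtain ⟨s, hs, hst⟩ := h t rfl
    exact of_forall hs (by rintro _ rfl; exact hst)

lemma iUnion {Zs : ℕ → Set (EuclideanSpace ℝ (Fin 2))} (N : ℕ)
    (h : ∀ i < N, P.Guarded S k (Zs i)) : P.Guarded S (k * N) {t | ∃ i < N, t ∈ Zs i} := by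
  induction N with
  | zero => exact ⟨∅, by simp, by simp, by simp⟩
  | succ N ih =>
    refine ((ih fun i hi => h i (hi.trans N.lt_succ_self)).union (h N N.lt_succ_self)).mono le_rfl
      (le_of_eq (by ring)) ?_
    rintro t ⟨i, hi, ht⟩
    rcases (Nat.lt_succ_iff_lt_or_eq.1 hi) with hi | rfl
    · exact Or.inl ⟨i, hi, ht⟩
    · exact Or.inr ht

end Guarded

/-- If arbitrarily large members of a family see the same things from intervals of length
proportional to `q`, a single position serves the whole family. -/
lemma exists_common_position {V : ℝ → ℝ → Prop} {A : ℝ → Prop} {Q : Set ℝ} {c : ℝ} (hc : 0 < c)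
    (h : ∀ q ∈ Q, ∃ p : ℝ, p ≤ 1 ∧ c * q ≤ p ∧
      ∀ p', p - c * q < p' → p' < p → ∀ q', 0 ≤ q' → q' ≤ q → A q' → V p' q') :
    ∃ p : ℝ, 0 ≤ p ∧ p ≤ 1 ∧ ∀ q ∈ Q, 0 < q → A q → V p q := by
  -- Every position `p` now has a failure `κ p`: a parameter in `Q` that is positive, satisfies `A`
  -- and is not served from `p`.
  by_contra! hcon
  choose! κ hκQ hκpos hκA hκV using hcon
  -- The mesh `1 / (N + 1)` is below `c * κ 0`, and hence below the length `c * q` of the interval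
  -- of any `q ≥ κ 0`.
  obtain ⟨N, hN⟩ := exists_nat_one_div_lt
    (mul_pos hc (hκpos 0 le_rfl zero_le_one))
  have hN0 : (0 : ℝ) < (N : ℝ) + 1 := by positivity
  set q₀ := κ 0
  have hκ' : ∀ k : ℕ, k < N + 2 → 0 ≤ (k : ℝ) / (N + 1) ∧ (k : ℝ) / (N + 1) ≤ 1 := by
    intro k hk
    refine ⟨by positivity, (div_le_one hN0).2 ?_⟩
    exact_mod_cast Nat.lt_succ_iff.1 hk
  -- Some `q` in `Q` is at least `κ 0` and at least the failures of all `N + 2` grid positions.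
  have hmax : ∀ M : ℕ, M ≤ N + 2 → ∃ q ∈ Q, q₀ ≤ q ∧ ∀ k < M, κ ((k : ℝ) / (N + 1)) ≤ q := by
    intro M
    induction M with
    | zero => exact fun _ => ⟨q₀, hκQ 0 le_rfl zero_le_one, le_rfl, by simp⟩
    | succ M ih =>
      intro hM
      obtain ⟨q, hq, hq₀, hqk⟩ := ih (by omega)
      have hMm := hκ' M (by omega)
      rcases le_total (κ ((M : ℝ) / (N + 1))) q with hle | hle
      · refine ⟨q, hq, hq₀, fun k hk => ?_⟩
        rcases Nat.lt_succ_iff_lt_or_eq.1 hk with hk | rfl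
        · exact hqk k hk
        · exact hle
      · refine ⟨_, hκQ _ hMm.1 hMm.2, hq₀.trans hle, fun k hk => ?_⟩
        rcases Nat.lt_succ_iff_lt_or_eq.1 hk with hk | rfl
        · exact (hqk k hk).trans hle
        · exact le_rfl
  obtain ⟨q, hq, hq₀, hqk⟩ := hmax (N + 2) le_rfl
  obtain ⟨p, hp1, hpq, hV⟩ := h q hq
  set a := p - c * q with ha
  have ha0 : 0 ≤ a := by linarith
  have hlen : 1 / ((N : ℝ) + 1) < c * q := hN.trans_le (by gcongr)
  -- The first grid position beyond the left end `a` of the interval of `q`. It sees all parameters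
  -- up to `q` that satisfy `A`, including its own failure.
  set k := ⌊a * (N + 1)⌋₊ + 1 with hk
  have h1 : a < (k : ℝ) / (N + 1) := by
    rw [lt_div_iff₀ hN0, hk]
    push_cast
    exact Nat.lt_floor_add_one _
  have h2 : (k : ℝ) / (N + 1) < p := by
    have h3 : (k : ℝ) ≤ a * (N + 1) + 1 := by
      rw [hk]; push_cast
      linarith [Nat.floor_le (show 0 ≤ a * ((N : ℝ) + 1) by positivity)]
    have h4 : (k : ℝ) / (N + 1) ≤ a + 1 / (N + 1) := by
      rw [div_le_iff₀ hN0, add_mul, one_div, inv_mul_cancel₀ hN0.ne']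
      exact h3
    linarith
  have hkN : k < N + 2 := by
    have h5 : (k : ℝ) < N + 1 := by
      have := h2.trans_le hp1
      rwa [div_lt_one hN0] at this
    have h6 : k < N + 1 := by exact_mod_cast h5
    omega
  obtain ⟨h7, h8⟩ := hκ' k hkN
  exact hκV _ h7 h8 (hV _ h1 h2 _ (hκpos _ h7 h8).le (hqk k hkN) (hκA _ h7 h8))

set_option maxHeartbeats 400000 in
/-- If the source is not longer than the short width, and source and target lie on one side of each
other's lines, then a bounded number of guards suffices. -/
theorem IsSimple.guarded_of_short (hP : P.IsSimple) {σ : ℝ}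
    {x y u v : EuclideanSpace ℝ (Fin 2)}
    (hS : segment ℝ x y ⊆ P.region) (hT : segment ℝ u v ⊆ P.region)
    (hu : 0 ≤ σ * cross (y - x) (u - x)) (hv : 0 ≤ σ * cross (y - x) (v - x))
    (hx : 0 < σ * cross (x - u) (v - u)) (hy : 0 < σ * cross (y - u) (v - u))
    (hw : ENNReal.ofReal ‖y - x‖ ≤ P.shortWidth) :
    P.Guarded (segment ℝ x y) 6 {t | t ∈ segment ℝ u v ∧ 0 < σ * cross (y - x) (t - x) ∧
      ∃ s ∈ segment ℝ x y, t ∈ P.visibilityPolygon s} := by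
  set e := y - x with he
  set d := v - u with hd
  set Z : Set (EuclideanSpace ℝ (Fin 2)) := {t | t ∈ segment ℝ u v ∧ 0 < σ * cross e (t - x) ∧
      ∃ s ∈ segment ℝ x y, t ∈ P.visibilityPolygon s} with hZ
  have hmemS : ∀ p : ℝ, 0 ≤ p → p ≤ 1 → x + p • e ∈ segment ℝ x y := fun p h0 h1 => by
    rw [segment_eq_image']; exact ⟨p, ⟨h0, h1⟩, rfl⟩
  -- While the line of sight moves by `q` along the target, it moves by `q * β / α` along the
  -- source. The extreme values `β₀` and `α₀` bound the ratio `β / α` below, uniformly in `s` and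
  -- `t`, by `c = β₀ / α₀`.
  set α₀ := max (σ * cross e (u - x)) (σ * cross e (v - x)) with hα₀
  set β₀ := min (σ * cross (x - u) d) (σ * cross (y - u) d) with hβ₀
  have hβ₀pos : 0 < β₀ := lt_min hx hy
  have hαq : ∀ q : ℝ, σ * cross e (u + q • d - x) =
      (1 - q) * (σ * cross e (u - x)) + q * (σ * cross e (v - x)) := by
    intro q
    have : u + q • d - x = (1 - q) • (u - x) + q • (v - x) := by rw [hd]; module
    rw [this, cross_add_right, cross_smul_right, cross_smul_right]; ring
  have hβp : ∀ p : ℝ, σ * cross (x + p • e - u) d =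
      (1 - p) * (σ * cross (x - u) d) + p * (σ * cross (y - u) d) := by
    intro q
    have : x + q • e - u = (1 - q) • (x - u) + q • (y - u) := by rw [he]; module
    rw [this, cross_add_left, cross_smul_left, cross_smul_left]; ring
  rcases Z.eq_empty_or_nonempty with hZe | ⟨t₁, ht₁, hAt₁, -⟩
  · rw [hZe]; exact ⟨∅, by simp, by simp, by simp⟩
  have hα₀pos : 0 < α₀ := by
    rw [segment_eq_image'] at ht₁
    obtain ⟨q, ⟨hq0, hq1⟩, rfl⟩ := ht₁
    by_contra! h
    have h1 := (le_max_left _ _).trans h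
    have h2 := (le_max_right _ _).trans h
    have := hαq q
    simp only at hAt₁
    rw [this] at hAt₁
    nlinarith
  set c := β₀ / α₀ with hc
  have hcpos : 0 < c := by positivity
  set V : ℝ → ℝ → Prop := fun p q => u + q • d ∈ P.visibilityPolygon (x + p • e) with hV
  set A : ℝ → Prop := fun q => 0 < σ * cross e (u + q • d - x) with hA
  -- Parameters of target points whose line of sight moves freely to the end `u`; `Q'` is the mirror
  -- image for the end `v`.
  set Q : Set ℝ := {q | ∃ p : ℝ, p ≤ 1 ∧ c * q ≤ p ∧
    ∀ p', p - c * q < p' → p' < p → ∀ q', 0 ≤ q' → q' ≤ q → A q' → V p' q'} with hQ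
  set Q' : Set ℝ := {q | ∃ p : ℝ, p ≤ 1 ∧ c * q ≤ p ∧
    ∀ p', p - c * q < p' → p' < p → ∀ q', 0 ≤ q' → q' ≤ q → A (1 - q') → V (1 - p') (1 - q')}
    with hQ'
  obtain ⟨g, hg0, hg1, hg⟩ := exists_common_position (V := V) (A := A) (Q := Q) hcpos
    fun q hq => hq
  obtain ⟨g', hg0', hg1', hg'⟩ := exists_common_position (V := fun p q => V (1 - p) (1 - q))
    (A := fun q => A (1 - q)) (Q := Q') hcpos fun q hq => hq
  have key : ∀ q : ℝ, 0 ≤ q → q ≤ 1 → A q → (∃ s ∈ segment ℝ x y, u + q • d ∈ P.visibilityPolygon s) →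
      u + q • d ∈ P.visibilityPolygon x ∨ u + q • d ∈ P.visibilityPolygon y ∨ q ∈ Q ∨
        1 - q ∈ Q' := by
    rintro q hq0 hq1 hAq ⟨s, hs, hst⟩
    rw [segment_eq_image'] at hs
    obtain ⟨p, ⟨hp0, hp1⟩, rfl⟩ := hs
    simp only [← he] at hst
    set s := x + p • e with hsdef
    set t := u + q • d with htdef
    have hsx : s - p • e = x := by rw [hsdef]; abel
    have hsy : s - (1 - p) • -e = y := by rw [hsdef, he]; module
    have htu : t - q • d = u := by rw [htdef]; abel
    have htv : t - (1 - q) • -d = v := by rw [htdef, hd]; module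
    have hαe : σ * cross e (t - s) = σ * cross e (t - x) := by
      have : t - s = (t - x) - p • e := by rw [hsdef]; abel
      rw [this, cross_sub_right, cross_smul_right, cross_self]; ring
    have hβe : σ * cross d (t - s) = σ * cross (s - u) d := by
      have : t - s = -(s - u) + q • d := by rw [htdef]; abel
      rw [this, cross_add_right, cross_smul_right, cross_self, cross_neg_right, cross_comm d]; ring
    have hα : 0 < σ * cross e (t - s) := by rw [hαe]; exact hAq
    have hβle : β₀ ≤ σ * cross d (t - s) := by
      rw [hβe, hβp p]
      have h1 := min_le_left (σ * cross (x - u) d) (σ * cross (y - u) d)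
      have h2 := min_le_right (σ * cross (x - u) d) (σ * cross (y - u) d)
      nlinarith
    have hβ : 0 < σ * cross d (t - s) := hβ₀pos.trans_le hβle
    have hαle : σ * cross e (t - s) ≤ α₀ := by
      rw [hαe, hαq q]
      have h1 := le_max_left (σ * cross e (u - x)) (σ * cross e (v - x))
      have h2 := le_max_right (σ * cross e (u - x)) (σ * cross e (v - x))
      nlinarith
    have hsS := hmemS p hp0 hp1
    have htT : t ∈ segment ℝ u v := by rw [segment_eq_image']; exact ⟨q, ⟨hq0, hq1⟩, rfl⟩
    have hS1 : segment ℝ x s ⊆ P.region :=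
      ((convex_segment (𝕜 := ℝ) x y).segment_subset (left_mem_segment ℝ x y) hsS).trans hS
    have hS2 : segment ℝ y s ⊆ P.region :=
      ((convex_segment (𝕜 := ℝ) x y).segment_subset (right_mem_segment ℝ x y) hsS).trans hS
    have hT1 : segment ℝ u t ⊆ P.region :=
      ((convex_segment (𝕜 := ℝ) u v).segment_subset (left_mem_segment ℝ u v) htT).trans hT
    have hT2 : segment ℝ v t ⊆ P.region :=
      ((convex_segment (𝕜 := ℝ) u v).segment_subset (right_mem_segment ℝ u v) htT).trans hT
    have hαj : -σ * cross (-e) (t - s) = σ * cross e (t - s) := by rw [cross_neg_left]; ring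
    have hβj : -σ * cross (-d) (t - s) = σ * cross d (t - s) := by rw [cross_neg_left]; ring
    have hcα : ∀ {r q : ℝ}, 0 < r → r < c * q →
        r * (σ * cross e (t - s)) < q * (σ * cross d (t - s)) := by
      intro r q hr h
      rw [hc, div_mul_eq_mul_div, lt_div_iff₀ hα₀pos] at h
      have hq : 0 < q := by
        have : 0 < β₀ * q := lt_of_le_of_lt (by positivity) h
        exact pos_of_mul_pos_right this hβ₀pos.le
      calc r * (σ * cross e (t - s)) ≤ r * α₀ := by gcongr
        _ < β₀ * q := h
        _ ≤ (σ * cross d (t - s)) * q := by gcongr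
        _ = _ := mul_comm _ _
    have hcp : ∀ {q p : ℝ}, 0 ≤ q → q * (σ * cross d (t - s)) ≤ p * (σ * cross e (t - s)) →
        c * q ≤ p := by
      intro q p hq h
      by_contra! hlt
      rcases le_or_gt p 0 with hp | hp
      · rcases hq.eq_or_lt with rfl | hq
        · rw [mul_zero] at hlt
          nlinarith
        · nlinarith [mul_pos hq hβ]
      · exact absurd (hcα hp hlt) (not_lt.2 h)
    have hleft := hP.obstacle_or_visible (σ := σ) (s := s) (t := t) (e := e) (d := d) hp0 hq0 hα hβ
      (by
        rw [hsx]
        have : x - t = (x - u) - q • d := by rw [htdef]; abel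
        rwa [this, cross_sub_left, cross_smul_left, cross_self, mul_zero, sub_zero])
      (by
        rw [htu]
        have : u - s = (u - x) - p • e := by rw [hsdef]; abel
        rwa [this, cross_sub_right, cross_smul_right, cross_self, mul_zero, sub_zero])
      (by rwa [hsx]) (by rwa [htu]) hst
    have hright := hP.obstacle_or_visible (σ := -σ) (s := s) (t := t) (e := -e) (d := -d)
      (p := 1 - p) (q := 1 - q) (by linarith) (by linarith) (by rwa [hαj]) (by rwa [hβj])
      (by
        rw [hsy, cross_neg_right, neg_mul_neg]
        have : y - t = (y - u) - q • d := by rw [htdef]; abel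
        rwa [this, cross_sub_left, cross_smul_left, cross_self, mul_zero, sub_zero])
      (by
        rw [htv, cross_neg_left, neg_mul_neg]
        have : v - s = (v - x) - p • e := by rw [hsdef]; abel
        rwa [this, cross_sub_right, cross_smul_right, cross_self, mul_zero, sub_zero])
      (by rwa [hsy]) (by rwa [htv]) hst
    rcases hleft with ⟨i, hi⟩ | hleft | ⟨hle, hleft⟩
    · rcases hright with ⟨j, hj⟩ | hright | ⟨hle, hright⟩
      -- Stopped on both sides: the resulting inner strip is narrower than the source, since `p + (1
      -- - p) = 1`.
      · exfalso
        have := shortWidth_lt_of_obstacles hα hβ (by rwa [hsx]) (by rwa [htu]) (by rwa [hsy])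
          (by rwa [htv]) hst hi hj
        rw [add_sub_cancel, one_mul] at this
        exact absurd hw (not_le.2 this)
      · rw [hsy] at hright
        exact Or.inr (Or.inl hright)
      · right; right; right
        rw [hαj, hβj] at hle
        refine ⟨1 - p, by linarith, hcp (by linarith) hle, fun p' h1 h2 q' h3 h4 h5 => ?_⟩
        have h6 := hright (1 - p - p') (by linarith)
          (by rw [hαj, hβj]; exact hcα (by linarith) (by linarith)) (1 - q - q') (by linarith)
          (by linarith)
        have e1 : t - (1 - q - q') • -d = u + (1 - q') • d := by rw [htdef]; module
        have e2 : s - (1 - p - p') • -e = x + (1 - p') • e := by rw [hsdef]; module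
        rw [e1, e2] at h6
        refine h6 ?_
        rw [cross_neg_left, neg_mul_neg]
        have : u + (1 - q') • d - s = (u + (1 - q') • d - x) - p • e := by rw [hsdef]; abel
        rw [this, cross_sub_right, cross_smul_right, cross_self, mul_zero, sub_zero]
        exact h5
    · rw [hsx] at hleft
      exact Or.inl hleft
    · right; right; left
      refine ⟨p, hp1, hcp hq0 hle, fun p' h1 h2 q' h3 h4 h5 => ?_⟩
      have h6 := hleft (p - p') (by linarith) (hcα (by linarith) (by linarith)) (q - q')
        (by linarith) (by linarith)
      have e1 : t - (q - q') • d = u + q' • d := by rw [htdef]; module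
      have e2 : s - (p - p') • e = x + p' • e := by rw [hsdef]; module
      rw [e1, e2] at h6
      refine h6 ?_
      have : u + q' • d - s = (u + q' • d - x) - p • e := by rw [hsdef]; abel
      rw [this, cross_sub_right, cross_smul_right, cross_self, mul_zero, sub_zero]
      exact h5
  have G₁ : P.Guarded (segment ℝ x y) 1 {t | t ∈ P.visibilityPolygon x} :=
    Guarded.of_forall (left_mem_segment ..) fun t ht => ht
  have G₂ : P.Guarded (segment ℝ x y) 1 {t | t ∈ P.visibilityPolygon y} :=
    Guarded.of_forall (right_mem_segment ..) fun t ht => ht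
  have G₃ : P.Guarded (segment ℝ x y) 1 {t | t ∈ P.visibilityPolygon (x + g • e)} :=
    Guarded.of_forall (hmemS g hg0 hg1) fun t ht => ht
  have G₄ : P.Guarded (segment ℝ x y) 1 {t | t ∈ P.visibilityPolygon (x + (1 - g') • e)} :=
    Guarded.of_forall (hmemS _ (by linarith) (by linarith)) fun t ht => ht
  -- The common positions serve only positive distances from `u` and `v`, so these two points get
  -- guards of their own.
  have G₅ : P.Guarded (segment ℝ x y) 1 (Z ∩ {u}) :=
    Guarded.of_subsingleton (Set.subsingleton_singleton.anti Set.inter_subset_right)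
      fun t ht => ht.1.2.2
  have G₆ : P.Guarded (segment ℝ x y) 1 (Z ∩ {v}) :=
    Guarded.of_subsingleton (Set.subsingleton_singleton.anti Set.inter_subset_right)
      fun t ht => ht.1.2.2
  refine (((((G₁.union G₂).union G₃).union G₄).union G₅).union G₆).mono le_rfl le_rfl ?_
  intro t ht
  obtain ⟨htT, hAt, hseen⟩ := id ht
  rw [segment_eq_image'] at htT
  obtain ⟨q, ⟨hq0, hq1⟩, hqt⟩ := htT
  simp only [← hd] at hqt
  by_cases hu0 : t = u
  · exact Or.inl (Or.inr ⟨ht, hu0⟩)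
  by_cases hv0 : t = v
  · exact Or.inr ⟨ht, hv0⟩
  have hq0' : 0 < q := by
    rcases hq0.eq_or_lt with rfl | h
    · exact absurd (by rw [← hqt]; simp) hu0
    · exact h
  have hq1' : q < 1 := by
    rcases hq1.eq_or_lt with rfl | h
    · exact absurd (by rw [← hqt, hd]; simp) hv0
    · exact h
  have hAq : A q := by rw [hA]; simp only; rw [hqt]; exact hAt
  have hcases := key q hq0 hq1 hAq (by rw [hqt]; exact hseen)
  rcases hcases with h | h | h | h
  · rw [hqt] at h
    exact Or.inl (Or.inl (Or.inl (Or.inl (Or.inl h))))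
  · rw [hqt] at h
    exact Or.inl (Or.inl (Or.inl (Or.inl (Or.inr h))))
  · have := hg q h hq0' hAq
    rw [hV, hqt] at this
    exact Or.inl (Or.inl (Or.inl (Or.inr this)))
  · have := hg' (1 - q) h (by linarith) (by rwa [sub_sub_cancel])
    simp only [hV, sub_sub_cancel] at this
    rw [hqt] at this
    exact Or.inl (Or.inl (Or.inr this))

end

/-! ### Positions near the crossing of the source with the line of the target. -/

section

variable {n : ℕ} {P : Polygon (EuclideanSpace ℝ (Fin 2)) n}

/-- A triangle with two sides in the region that has no vertex of the polygon off the third side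
lies in the region. -/
theorem IsSimple.triangle_subset_interior (hP : P.IsSimple) {s d₁ d₂ : EuclideanSpace ℝ (Fin 2)}
    (hc : cross d₁ d₂ ≠ 0) (h₁ : segment ℝ s (s + d₁) ⊆ P.region)
    (h₂ : segment ℝ s (s + d₂) ⊆ P.region)
    (hv : ∀ i, 0 ≤ coordFst d₁ d₂ (P i - s) → 0 ≤ coordSnd d₁ d₂ (P i - s) →
      1 ≤ coordFst d₁ d₂ (P i - s) + coordSnd d₁ d₂ (P i - s))
    {a b : ℝ} (ha : 0 < a) (hb : 0 < b) (hab : a + b < 1) :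
    s + a • d₁ + b • d₂ ∈ interior P.region := by
  set K : Set (EuclideanSpace ℝ (Fin 2)) := {z | 0 < coordFst d₁ d₂ (z - s) ∧
    0 < coordSnd d₁ d₂ (z - s) ∧ coordFst d₁ d₂ (z - s) + coordSnd d₁ d₂ (z - s) < 1} with hK
  have hcont₁ : Continuous fun z => coordFst d₁ d₂ (z - s) := by unfold coordFst; fun_prop
  have hcont₂ : Continuous fun z => coordSnd d₁ d₂ (z - s) := by unfold coordSnd; fun_prop
  have hKo : IsOpen K := (isOpen_lt continuous_const hcont₁).and
    ((isOpen_lt continuous_const hcont₂).and (isOpen_lt (hcont₁.add hcont₂) continuous_const))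
  have hKcl : closure K ⊆ {z | 0 ≤ coordFst d₁ d₂ (z - s) ∧ 0 ≤ coordSnd d₁ d₂ (z - s) ∧
      coordFst d₁ d₂ (z - s) + coordSnd d₁ d₂ (z - s) ≤ 1} := by
    refine closure_minimal (fun z hz => ⟨hz.1.le, hz.2.1.le, hz.2.2.le⟩) ?_
    exact (isClosed_le continuous_const hcont₁).and
      ((isClosed_le continuous_const hcont₂).and
        (isClosed_le (hcont₁.add hcont₂) continuous_const))
  have hexp : ∀ z, z = s + coordFst d₁ d₂ (z - s) • d₁ + coordSnd d₁ d₂ (z - s) • d₂ := by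
    intro z
    rw [add_assoc, ← coord_expand hc, add_sub_cancel]
  have hKb : Bornology.IsBounded K := by
    rw [isBounded_iff_forall_norm_le]
    refine ⟨‖s‖ + 1 * ‖d₁‖ + 1 * ‖d₂‖, ?_⟩
    rintro z ⟨h1, h2, h3⟩
    rw [hexp z]
    refine (norm_add_le _ _).trans (add_le_add ((norm_add_le _ _).trans (add_le_add le_rfl ?_)) ?_)
    · rw [norm_smul, Real.norm_of_nonneg h1.le]
      gcongr; linarith
    · rw [norm_smul, Real.norm_of_nonneg h2.le]
      gcongr; linarith
  -- An exterior point in the open triangle would yield a vertex extreme towards the corner `s`; it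
  -- lies in the closed triangle off the third side, which `hv` forbids.
  set f : EuclideanSpace ℝ (Fin 2) →L[ℝ] ℝ :=
    (cross d₁ d₂)⁻¹ • (crossCLM d₂ - crossCLM d₁) with hf
  have hfv : ∀ v, f v = -(coordFst d₁ d₂ v + coordSnd d₁ d₂ v) := by
    intro v
    simp only [hf, smul_apply, sub_apply, crossCLM_apply, smul_eq_mul, coordFst, coordSnd]
    rw [cross_comm d₂ v]
    ring
  have hfz : ∀ z, f z = f s - (coordFst d₁ d₂ (z - s) + coordSnd d₁ d₂ (z - s)) := by
    intro z
    have := hfv (z - s)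
    rw [map_sub] at this
    linarith
  have hd₁ := coords_fst hc
  have hsub : K ⊆ P.region := by
    intro z₀ hz₀
    by_contra hz₀r
    obtain ⟨i, hi, -, hlt, -⟩ := hP.exists_reflexVertex hKo hKb f (crossCLM d₁) (m := f s - 1)
      (by
        intro v hv1 hv2
        have hd₁0 : d₁ ≠ 0 := by rintro rfl; simp at hc
        obtain ⟨κ, rfl⟩ := eq_smul_of_cross_eq_zero hd₁0 hv2
        rw [hfv, (hd₁ κ).1, (hd₁ κ).2] at hv1
        have : κ = 0 := by linarith
        rw [this, zero_smul])
      ⟨(-1 : ℝ) • d₁, by rw [hfv, (hd₁ _).1, (hd₁ _).2]; norm_num⟩ (by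
        intro z hzc hzK hzr
        obtain ⟨h1, h2, h3⟩ := hKcl hzc
        by_contra hlt
        rw [hfz z] at hlt
        apply hzr
        rcases h1.eq_or_lt with h1 | h1
        · apply h₂
          rw [segment_eq_image']
          refine ⟨coordSnd d₁ d₂ (z - s), ⟨h2, by linarith⟩, ?_⟩
          have := hexp z
          rw [← h1, zero_smul, add_zero] at this
          simp only [add_sub_cancel_left]
          exact this.symm
        · rcases h2.eq_or_lt with h2 | h2
          · apply h₁
            rw [segment_eq_image']
            refine ⟨coordFst d₁ d₂ (z - s), ⟨h1.le, by linarith⟩, ?_⟩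
            have := hexp z
            rw [← h2, zero_smul, add_zero] at this
            simp only [add_sub_cancel_left]
            exact this.symm
          · exact absurd ⟨h1, h2, by linarith⟩ hzK)
      hz₀ hz₀r (by rw [hfz z₀]; linarith [hz₀.2.2])
    obtain ⟨h1, h2, h3⟩ := hKcl hi
    rw [hfz (P i)] at hlt
    linarith [hv i h1 h2]
  refine interior_maximal hsub hKo ?_
  have : s + a • d₁ + b • d₂ - s = a • d₁ + b • d₂ := by abel
  rw [hK, Set.mem_ofPred_eq, this, coordFst_combo hc, coordSnd_combo hc]
  exact ⟨ha, hb, hab⟩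

/-- Near the intersection of the source with the line of the target, all positions on one side see
the same part of the target. -/
theorem IsSimple.exists_guard_near_line (hP : P.IsSimple) {o y u v : EuclideanSpace ℝ (Fin 2)}
    (hS : segment ℝ o y ⊆ P.region) (ho : cross (o - u) (v - u) = 0)
    (hc : cross (y - o) (v - u) ≠ 0) :
    ∃ δ : ℝ, 0 < δ ∧ δ ≤ 1 ∧ ∀ t ∈ segment ℝ u v, cross (y - o) (t - o) ≠ 0 →
      ∀ p, 0 < p → p ≤ δ → t ∈ P.visibilityPolygon (o + p • (y - o)) →
        t ∈ P.visibilityPolygon (o + δ • (y - o)) := by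
  set e := y - o with he
  set d := v - u with hd
  -- The coordinate measures the distance from the line of the target. As there are finitely many
  -- vertices, none has this coordinate in `(0, 2 * δ]` for small `δ`. The factor 2 leaves room
  -- beyond the guard at `δ`.
  obtain ⟨δ, hδ0, hδ1, hδv⟩ : ∃ δ : ℝ, 0 < δ ∧ 2 * δ ≤ 1 ∧
      ∀ i, 0 < coordFst e d (P i - o) → 2 * δ < coordFst e d (P i - o) := by
    have h1 : ∀ᶠ δ : ℝ in nhdsWithin 0 (Set.Ioi 0), ∀ i, 0 < coordFst e d (P i - o) →
        2 * δ < coordFst e d (P i - o) := by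
      rw [Filter.eventually_all]
      intro i
      by_cases hi : 0 < coordFst e d (P i - o)
      · have ht : Filter.Tendsto (fun δ : ℝ => 2 * δ) (nhds 0) (nhds 0) := by
          have : Continuous fun δ : ℝ => 2 * δ := by fun_prop
          simpa using this.tendsto 0
        filter_upwards [nhdsWithin_le_nhds (ht.eventually_lt_const hi)] with δ h _ using h
      · exact Filter.Eventually.of_forall fun δ h => absurd h hi
    have h2 : ∀ᶠ δ : ℝ in nhdsWithin 0 (Set.Ioi 0), 2 * δ < 1 := by
      have ht : Filter.Tendsto (fun δ : ℝ => 2 * δ) (nhds 0) (nhds 0) := by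
        have : Continuous fun δ : ℝ => 2 * δ := by fun_prop
        simpa using this.tendsto 0
      exact nhdsWithin_le_nhds (ht.eventually_lt_const one_pos)
    obtain ⟨δ, ⟨h3, h4⟩, h5⟩ := ((h1.and h2).and self_mem_nhdsWithin).exists
    exact ⟨δ, h5, h4.le, h3⟩
  refine ⟨δ, hδ0, by linarith, fun t ht hAt p hp0 hpδ hst => ?_⟩
  rcases hpδ.eq_or_lt with rfl | hpδ
  · exact hst
  refine ⟨hst.1, ?_⟩
  have hmem : ∀ r : ℝ, 0 ≤ r → r ≤ 1 → o + r • e ∈ segment ℝ o y := fun r h0 h1 => by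
    rw [segment_eq_image']; exact ⟨r, ⟨h0, h1⟩, rfl⟩
  set s := o + p • e with hs
  have hsS : s ∈ segment ℝ o y := hmem p hp0.le (by linarith)
  have hfst_e : ∀ r : ℝ, coordFst e d (r • e) = r := fun r => (coords_fst hc r).1
  have htd : cross (t - o) d = 0 := by
    rw [segment_eq_image'] at ht
    obtain ⟨q, _, rfl⟩ := ht
    have : u + q • (v - u) - o = -(o - u) + q • d := by rw [hd]; abel
    simp only [this, cross_add_left, cross_neg_left, ho, cross_smul_left, cross_self]
    ring
  have hlin := isLinearMap_coordFst e d
  have hfst_t : coordFst e d (t - o) = 0 := by rw [coordFst, htd, zero_div]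
  have hc' : cross ((2 * δ - p) • e) (t - s) ≠ 0 := by
    have : t - s = (t - o) - p • e := by rw [hs]; abel
    rw [cross_smul_left, this, cross_sub_right, cross_smul_right, cross_self, mul_zero, sub_zero]
    exact mul_ne_zero (by linarith) hAt
  rintro z ⟨a, b, ha, hb, hab, rfl⟩
  obtain rfl : b = 1 - a := by linarith
  have hpos : 0 < 2 * δ - p := by linarith
  -- The triangle has corners `s`, `o + (2 * δ) • e` and `t`. The open segment from the guard at `δ`
  -- to `t` runs inside it, because `p < δ < 2 * δ`.
  have hz : a • (o + δ • e) + (1 - a) • t =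
      s + (a * ((δ - p) / (2 * δ - p))) • ((2 * δ - p) • e) + (1 - a) • (t - s) := by
    rw [smul_smul, mul_assoc, div_mul_cancel₀ _ hpos.ne', hs]
    module
  rw [hz]
  have hfrac0 : 0 < (δ - p) / (2 * δ - p) := div_pos (by linarith) hpos
  have hfrac1 : (δ - p) / (2 * δ - p) < 1 := (div_lt_one hpos).2 (by linarith)
  refine hP.triangle_subset_interior hc' ?_ ?_ ?_ (by positivity) hb (by nlinarith)
  · have h2 : s + (2 * δ - p) • e = o + (2 * δ) • e := by rw [hs]; module
    rw [h2]
    exact ((convex_segment (𝕜 := ℝ) o y).segment_subset hsS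
      (hmem (2 * δ) (by linarith) hδ1)).trans hS
  · rw [add_sub_cancel]
    exact segment_subset_of_mem_visibilityPolygon (hS hsS) hst
  · intro i h1 h2
    by_contra! hlt
    set α := coordFst ((2 * δ - p) • e) (t - s) (P i - s)
    set β := coordSnd ((2 * δ - p) • e) (t - s) (P i - s)
    have hexp : P i - o = (p * (1 - α - β) + 2 * δ * α) • e + β • (t - o) := by
      have h3 : P i - o = (P i - s) + p • e := by rw [hs]; abel
      rw [h3, coord_expand hc' (P i - s), hs]
      module
    have hco : coordFst e d (P i - o) = p * (1 - α - β) + 2 * δ * α := by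
      rw [hexp, hlin.map_add, hlin.map_smul, hlin.map_smul β, hfst_t, smul_zero, add_zero]
      have := hfst_e 1
      rw [one_smul] at this
      rw [this, smul_eq_mul, mul_one]
    have hpos' : 0 < p * (1 - α - β) := mul_pos hp0 (by linarith)
    have hα : 0 ≤ 2 * δ * α := by positivity
    have := hδv i (by rw [hco]; linarith)
    rw [hco] at this
    nlinarith

end

/-! ### Cutting source and target, and counting the guards. -/

section

variable {n : ℕ} {P : Polygon (EuclideanSpace ℝ (Fin 2)) n}

lemma add_smul_mem_segment {x y : EuclideanSpace ℝ (Fin 2)} {p : ℝ} (h0 : 0 ≤ p) (h1 : p ≤ 1) :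
    x + p • (y - x) ∈ segment ℝ x y := by
  rw [segment_eq_image']; exact ⟨p, ⟨h0, h1⟩, rfl⟩

lemma exists_of_mem_segment {x y z : EuclideanSpace ℝ (Fin 2)} (h : z ∈ segment ℝ x y) :
    ∃ p : ℝ, 0 ≤ p ∧ p ≤ 1 ∧ z = x + p • (y - x) := by
  rw [segment_eq_image'] at h
  obtain ⟨p, ⟨h0, h1⟩, rfl⟩ := h
  exact ⟨p, h0, h1, rfl⟩

lemma segment_subset_segment {x y a b : EuclideanSpace ℝ (Fin 2)} (ha : a ∈ segment ℝ x y)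
    (hb : b ∈ segment ℝ x y) : segment ℝ a b ⊆ segment ℝ x y :=
  (convex_segment (𝕜 := ℝ) x y).segment_subset ha hb

/-- The part of the target off the line of the source that is seen from the source. -/
def seenOffLine (P : Polygon (EuclideanSpace ℝ (Fin 2)) n) (x y u v : EuclideanSpace ℝ (Fin 2)) :
    Set (EuclideanSpace ℝ (Fin 2)) :=
  {t | t ∈ segment ℝ u v ∧ cross (y - x) (t - x) ≠ 0 ∧
    ∃ s ∈ segment ℝ x y, t ∈ P.visibilityPolygon s}

/-- Rounding down `p * N` gives the cell, except that `p = 1` belongs to the last cell `N - 1`. -/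
lemma exists_cell {N : ℕ} (hN : 0 < N) {p : ℝ} (h0 : 0 ≤ p) (h1 : p ≤ 1) :
    ∃ k < N, (k : ℝ) / N ≤ p ∧ p ≤ ((k : ℝ) + 1) / N := by
  have hN' : (0 : ℝ) < N := by exact_mod_cast hN
  rcases h1.eq_or_lt with rfl | h1
  · refine ⟨N - 1, by omega, ?_, ?_⟩
    · rw [div_le_one hN']; exact_mod_cast Nat.sub_le _ _
    · rw [one_le_div hN', Nat.cast_sub hN]; simp
  · refine ⟨⌊p * N⌋₊, ?_, ?_, ?_⟩
    · rw [Nat.floor_lt (by positivity)]; nlinarith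
    · rw [div_le_iff₀ hN']; exact Nat.floor_le (by positivity)
    · rw [le_div_iff₀ hN']; exact (Nat.lt_floor_add_one _).le

/-- Subdivide the source into pieces not longer than the short width. -/
theorem IsSimple.guarded_of_pos (hP : P.IsSimple) {σ : ℝ} {x y u v : EuclideanSpace ℝ (Fin 2)}
    (hS : segment ℝ x y ⊆ P.region) (hT : segment ℝ u v ⊆ P.region)
    (hu : 0 ≤ σ * cross (y - x) (u - x)) (hv : 0 ≤ σ * cross (y - x) (v - x))
    (hx : 0 < σ * cross (x - u) (v - u)) (hy : 0 < σ * cross (y - u) (v - u))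
    {N : ℕ} (hN : 0 < N) (hw : ENNReal.ofReal (‖y - x‖ / N) ≤ P.shortWidth) :
    P.Guarded (segment ℝ x y) (6 * N) {t | t ∈ segment ℝ u v ∧ 0 < σ * cross (y - x) (t - x) ∧
      ∃ s ∈ segment ℝ x y, t ∈ P.visibilityPolygon s} := by
  have hN' : (0 : ℝ) < N := by exact_mod_cast hN
  set e := y - x with he
  set X : ℕ → EuclideanSpace ℝ (Fin 2) := fun k => x + ((k : ℝ) / N) • e with hX
  have hXS : ∀ k ≤ N, X k ∈ segment ℝ x y := fun k hk =>
    add_smul_mem_segment (by positivity) ((div_le_one hN').2 (by exact_mod_cast hk))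
  have hXe : ∀ k, X (k + 1) - X k = (1 / (N : ℝ)) • e := by
    intro k
    simp only [hX]
    push_cast
    rw [add_div]
    module
  have hA : ∀ k z, σ * cross (X (k + 1) - X k) (z - X k) = 1 / N * (σ * cross e (z - x)) := by
    intro k z
    have : z - X k = (z - x) - ((k : ℝ) / N) • e := by simp only [hX]; abel
    rw [hXe, cross_smul_left, this, cross_sub_right, cross_smul_right, cross_self]
    ring
  have hB : ∀ k ≤ N, 0 < σ * cross (X k - u) (v - u) := by
    intro k hk
    have h1 : (k : ℝ) / N ≤ 1 := (div_le_one hN').2 (by exact_mod_cast hk)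
    have h0 : 0 ≤ (k : ℝ) / N := by positivity
    have : X k - u = (1 - (k : ℝ) / N) • (x - u) + ((k : ℝ) / N) • (y - u) := by
      simp only [hX, he]; module
    rw [this, cross_add_left, cross_smul_left, cross_smul_left]
    rcases h0.eq_or_lt with h0 | h0
    · rw [← h0]; simpa using hx
    · have := mul_pos h0 hy
      nlinarith
  -- The pieces inherit all sign conditions, so each needs six guards.
  refine (Guarded.iUnion (k := 6) N fun k hk => ((hP.guarded_of_short
    ((segment_subset_segment (hXS k hk.le) (hXS (k + 1) hk)).trans hS) hT ?_ ?_ (hB k hk.le)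
    (hB (k + 1) hk) ?_).mono (segment_subset_segment (hXS k hk.le) (hXS (k + 1) hk)) le_rfl
      le_rfl)).mono le_rfl le_rfl ?_
  · rw [hA]; positivity
  · rw [hA]; positivity
  · rw [hXe, norm_smul, Real.norm_of_nonneg (by positivity), one_div_mul_eq_div]
    exact hw
  · rintro t ⟨htT, hAt, s, hs, hst⟩
    obtain ⟨p, hp0, hp1, rfl⟩ := exists_of_mem_segment hs
    obtain ⟨k, hk, hk1, hk2⟩ := exists_cell hN hp0 hp1
    refine ⟨k, hk, htT, ?_, _, ?_, hst⟩
    · rw [hA]; positivity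
    · have h1 : x + p • (y - x) = X k + (p * N - k) • (X (k + 1) - X k) := by
        rw [hXe, smul_smul, ← he]
        simp only [hX]
        rw [add_assoc, ← add_smul]
        congr 2
        field_simp
        ring
      rw [h1]
      rw [div_le_iff₀ hN'] at hk1
      rw [le_div_iff₀ hN'] at hk2
      exact add_smul_mem_segment (by linarith) (by linarith)

/-- The sign `σ` is dictated by the side of the source line on which the target lies. If the source
is then on the wrong side of the target line, exchanging `u` and `v` reverses that line. -/
theorem IsSimple.guarded_of_sides (hP : P.IsSimple) {x y u v : EuclideanSpace ℝ (Fin 2)}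
    (hS : segment ℝ x y ⊆ P.region) (hT : segment ℝ u v ⊆ P.region)
    (hA : (0 ≤ cross (y - x) (u - x) ∧ 0 ≤ cross (y - x) (v - x)) ∨
      (cross (y - x) (u - x) ≤ 0 ∧ cross (y - x) (v - x) ≤ 0))
    (hB : 0 < cross (x - u) (v - u) * cross (y - u) (v - u))
    {N : ℕ} (hN : 0 < N) (hw : ENNReal.ofReal (‖y - x‖ / N) ≤ P.shortWidth) :
    P.Guarded (segment ℝ x y) (6 * N) (P.seenOffLine x y u v) := by
  obtain ⟨σ, hσ, hu, hv, hlt⟩ : ∃ σ : ℝ, (σ = 1 ∨ σ = -1) ∧ 0 ≤ σ * cross (y - x) (u - x) ∧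
      0 ≤ σ * cross (y - x) (v - x) ∧
      ∀ t ∈ segment ℝ u v, cross (y - x) (t - x) ≠ 0 → 0 < σ * cross (y - x) (t - x) := by
    have hcomb : ∀ t ∈ segment ℝ u v, ∃ q : ℝ, 0 ≤ q ∧ q ≤ 1 ∧ cross (y - x) (t - x) =
        (1 - q) * cross (y - x) (u - x) + q * cross (y - x) (v - x) := by
      intro t ht
      obtain ⟨q, h0, h1, rfl⟩ := exists_of_mem_segment ht
      refine ⟨q, h0, h1, ?_⟩
      have : u + q • (v - u) - x = (1 - q) • (u - x) + q • (v - x) := by module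
      rw [this, cross_add_right, cross_smul_right, cross_smul_right]
    rcases hA with ⟨h1, h2⟩ | ⟨h1, h2⟩
    · refine ⟨1, Or.inl rfl, by linarith, by linarith, fun t ht h => ?_⟩
      obtain ⟨q, h3, h4, h5⟩ := hcomb t ht
      rw [one_mul]
      refine lt_of_le_of_ne ?_ h.symm
      rw [h5]
      exact add_nonneg (mul_nonneg (by linarith) h1) (mul_nonneg h3 h2)
    · refine ⟨-1, Or.inr rfl, by linarith, by linarith, fun t ht h => ?_⟩
      obtain ⟨q, h3, h4, h5⟩ := hcomb t ht
      have h6 : cross (y - x) (t - x) < 0 := by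
        refine lt_of_le_of_ne ?_ h
        rw [h5]
        exact add_nonpos (mul_nonpos_of_nonneg_of_nonpos (by linarith) h1)
          (mul_nonpos_of_nonneg_of_nonpos h3 h2)
      linarith
  have hsq : σ * σ = 1 := by rcases hσ with rfl | rfl <;> norm_num
  rcases lt_or_ge 0 (σ * cross (x - u) (v - u)) with hx | hx
  · have hy : 0 < σ * cross (y - u) (v - u) := by
      have : 0 < (σ * cross (x - u) (v - u)) * (σ * cross (y - u) (v - u)) := by
        have : (σ * cross (x - u) (v - u)) * (σ * cross (y - u) (v - u)) =
          σ * σ * (cross (x - u) (v - u) * cross (y - u) (v - u)) := by ring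
        rw [this, hsq, one_mul]; exact hB
      exact pos_of_mul_pos_right this hx.le
    exact (hP.guarded_of_pos hS hT hu hv hx hy hN hw).mono le_rfl le_rfl
      fun t ht => ⟨ht.1, hlt t ht.1 ht.2.1, ht.2.2⟩
  · have hswap : ∀ z, cross (z - v) (u - v) = -cross (z - u) (v - u) := by
      intro z
      have h1 : z - v = (z - u) - (v - u) := by abel
      have h2 : u - v = -(v - u) := by abel
      rw [h1, h2, cross_neg_right, cross_sub_left, cross_self, sub_zero]
    have hx' : 0 < σ * cross (x - v) (u - v) := by
      rw [hswap]
      have : σ * cross (x - u) (v - u) ≠ 0 := by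
        refine mul_ne_zero (by rcases hσ with rfl | rfl <;> norm_num) ?_
        intro h; rw [h, zero_mul] at hB; exact lt_irrefl _ hB
      have := lt_of_le_of_ne hx this
      linarith
    have hy' : 0 < σ * cross (y - v) (u - v) := by
      have : 0 < (σ * cross (x - v) (u - v)) * (σ * cross (y - v) (u - v)) := by
        have : (σ * cross (x - v) (u - v)) * (σ * cross (y - v) (u - v)) =
          σ * σ * (cross (x - u) (v - u) * cross (y - u) (v - u)) := by rw [hswap, hswap]; ring
        rw [this, hsq, one_mul]; exact hB
      exact pos_of_mul_pos_right this hx'.le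
    rw [segment_symm] at hT
    refine (hP.guarded_of_pos hS hT hv hu hx' hy' hN hw).mono le_rfl le_rfl
      fun t ht => ⟨?_, hlt t ht.1 ht.2.1, ht.2.2⟩
    rw [segment_symm]; exact ht.1

/-- The case where the line of the target misses the source: cut the target at the line of the
source. -/
theorem IsSimple.guarded_of_source_side (hP : P.IsSimple) {x y u v : EuclideanSpace ℝ (Fin 2)}
    (hS : segment ℝ x y ⊆ P.region) (hT : segment ℝ u v ⊆ P.region)
    (hB : 0 < cross (x - u) (v - u) * cross (y - u) (v - u))
    {N : ℕ} (hN : 0 < N) (hw : ENNReal.ofReal (‖y - x‖ / N) ≤ P.shortWidth) :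
    P.Guarded (segment ℝ x y) (12 * N) (P.seenOffLine x y u v) := by
  set a := cross (y - x) (u - x) with ha
  set b := cross (y - x) (v - x) with hb
  by_cases hA : (0 ≤ a ∧ 0 ≤ b) ∨ (a ≤ 0 ∧ b ≤ 0)
  · exact (hP.guarded_of_sides hS hT hA hB hN hw).mono le_rfl (by omega) le_rfl
  have hab : a - b ≠ 0 := by
    intro h
    apply hA
    rcases le_total 0 a with h' | h'
    · exact Or.inl ⟨h', by linarith⟩
    · exact Or.inr ⟨h', by linarith⟩
  -- The ends of the target lie strictly on different sides of the source line, and `q` is the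
  -- parameter of the crossing point. Each of the two parts needs `6 * N` guards.
  obtain ⟨q, hq0, hq1, hq⟩ : ∃ q : ℝ, 0 < q ∧ q < 1 ∧ (1 - q) * a + q * b = 0 := by
    refine ⟨a / (a - b), ?_, ?_, by field_simp; ring⟩
    · rcases lt_or_gt_of_ne hab with h | h
      · refine div_pos_of_neg_of_neg ?_ h
        by_contra! h'; exact hA (Or.inl ⟨h', by linarith⟩)
      · refine div_pos ?_ h
        by_contra! h'; exact hA (Or.inr ⟨h', by linarith⟩)
    · rcases lt_or_gt_of_ne hab with h | h
      · rw [div_lt_one_of_neg h]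
        by_contra! h'; exact hA (Or.inr ⟨by linarith, by linarith⟩)
      · rw [div_lt_one h]
        by_contra! h'; exact hA (Or.inl ⟨by linarith, by linarith⟩)
  set w := u + q • (v - u) with hwd
  have hwT : w ∈ segment ℝ u v := add_smul_mem_segment hq0.le hq1.le
  have hAw : cross (y - x) (w - x) = 0 := by
    have : w - x = (1 - q) • (u - x) + q • (v - x) := by rw [hwd]; module
    rw [this, cross_add_right, cross_smul_right, cross_smul_right]
    exact hq
  have h1 := hP.guarded_of_sides (u := u) (v := w) hS
    ((segment_subset_segment (left_mem_segment ℝ u v) hwT).trans hT)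
    (by
      rw [hAw]
      rcases le_total 0 a with h | h
      · exact Or.inl ⟨h, le_rfl⟩
      · exact Or.inr ⟨h, le_rfl⟩)
    (by
      have : w - u = q • (v - u) := by rw [hwd]; abel
      rw [this, cross_smul_right, cross_smul_right]
      have : q * cross (x - u) (v - u) * (q * cross (y - u) (v - u)) =
        (q * q) * (cross (x - u) (v - u) * cross (y - u) (v - u)) := by ring
      rw [this]
      exact mul_pos (mul_pos hq0 hq0) hB) hN hw
  have h2 := hP.guarded_of_sides (u := w) (v := v) hS
    ((segment_subset_segment hwT (right_mem_segment ℝ u v)).trans hT)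
    (by
      rw [hAw]
      rcases le_total 0 b with h | h
      · exact Or.inl ⟨le_rfl, h⟩
      · exact Or.inr ⟨le_rfl, h⟩)
    (by
      have e1 : v - w = (1 - q) • (v - u) := by rw [hwd]; module
      have e2 : ∀ z, cross (z - w) (v - w) = (1 - q) * cross (z - u) (v - u) := by
        intro z
        have : z - w = (z - u) - q • (v - u) := by rw [hwd]; abel
        rw [e1, this, cross_smul_right, cross_sub_left, cross_smul_left, cross_self, mul_zero,
          sub_zero]
      rw [e2, e2]
      have : (1 - q) * cross (x - u) (v - u) * ((1 - q) * cross (y - u) (v - u)) =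
        ((1 - q) * (1 - q)) * (cross (x - u) (v - u) * cross (y - u) (v - u)) := by ring
      rw [this]
      exact mul_pos (mul_pos (by linarith) (by linarith)) hB) hN hw
  refine (h1.union h2).mono le_rfl (by omega) ?_
  rintro t ⟨htT, hAt, hseen⟩
  obtain ⟨r, hr0, hr1, rfl⟩ := exists_of_mem_segment htT
  rcases le_total r q with h | h
  · left
    refine ⟨?_, hAt, hseen⟩
    have : u + r • (v - u) = u + (r / q) • (w - u) := by
      have : w - u = q • (v - u) := by rw [hwd]; abel
      rw [this, smul_smul, div_mul_cancel₀ _ hq0.ne']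
    rw [this]
    exact add_smul_mem_segment (by positivity) ((div_le_one hq0).2 h)
  · right
    refine ⟨?_, hAt, hseen⟩
    have hq1' : 0 < 1 - q := by linarith
    have : u + r • (v - u) = w + ((r - q) / (1 - q)) • (v - w) := by
      have : v - w = (1 - q) • (v - u) := by rw [hwd]; module
      rw [this, smul_smul, div_mul_cancel₀ _ hq1'.ne', hwd]
      module
    rw [this]
    exact add_smul_mem_segment (div_nonneg (by linarith) hq1'.le)
      ((div_le_one hq1').2 (by linarith))

/-- The half of the source on one side of the line of the target. -/
theorem IsSimple.guarded_of_half (hP : P.IsSimple) {o y u v : EuclideanSpace ℝ (Fin 2)}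
    (hS : segment ℝ o y ⊆ P.region) (hT : segment ℝ u v ⊆ P.region)
    (ho : cross (o - u) (v - u) = 0) (hc : cross (y - o) (v - u) ≠ 0)
    {N : ℕ} (hN : 0 < N) (hw : ENNReal.ofReal (‖y - o‖ / N) ≤ P.shortWidth) :
    P.Guarded (segment ℝ o y) (2 + 12 * N) (P.seenOffLine o y u v) := by
  obtain ⟨δ, hδ0, hδ1, hδ⟩ := hP.exists_guard_near_line hS ho hc
  set w := o + δ • (y - o) with hwd
  have hwS : w ∈ segment ℝ o y := add_smul_mem_segment hδ0.le hδ1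
  have hyw : y - w = (1 - δ) • (y - o) := by rw [hwd]; module
  have hsub := segment_subset_segment hwS (right_mem_segment ℝ o y)
  -- One guard at the crossing `o`, one at `w` for all positions between `o` and `w`, and the
  -- previous case for the rest, which is off the line of the target.
  have h1 : P.Guarded (segment ℝ o y) 1 {t | t ∈ P.visibilityPolygon o} :=
    Guarded.of_forall (left_mem_segment ..) fun t ht => ht
  have h2 : P.Guarded (segment ℝ o y) 1 {t | t ∈ P.visibilityPolygon w} :=
    Guarded.of_forall hwS fun t ht => ht
  have h3 : P.Guarded (segment ℝ w y) (12 * N) (P.seenOffLine w y u v) := by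
    refine hP.guarded_of_source_side (hsub.trans hS) hT ?_ hN ?_
    · have e1 : w - u = (o - u) + δ • (y - o) := by rw [hwd]; abel
      have e2 : y - u = (o - u) + (y - o) := by abel
      rw [e1, e2, cross_add_left, cross_add_left, ho, cross_smul_left, zero_add, zero_add, mul_assoc]
      exact mul_pos hδ0 (mul_self_pos.2 hc)
    · refine le_trans (ENNReal.ofReal_le_ofReal ?_) hw
      gcongr
      rw [hyw, norm_smul, Real.norm_of_nonneg (by linarith)]
      exact mul_le_of_le_one_left (norm_nonneg _) (by linarith)
  refine ((h1.union h2).union (h3.mono hsub le_rfl le_rfl)).mono le_rfl (by omega) ?_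
  rintro t ⟨htT, hAt, s, hs, hst⟩
  obtain ⟨p, hp0, hp1, rfl⟩ := exists_of_mem_segment hs
  rcases hp0.eq_or_lt with rfl | hp0
  · rw [zero_smul, add_zero] at hst
    exact Or.inl (Or.inl hst)
  rcases le_total p δ with h | h
  · exact Or.inl (Or.inr (hδ t htT hAt p hp0 h hst))
  · rcases hδ1.eq_or_lt with hδ1 | hδ1
    · obtain rfl : p = δ := le_antisymm (by linarith) h
      exact Or.inl (Or.inr hst)
    right
    have hδ' : 0 < 1 - δ := by linarith
    refine ⟨htT, ?_, _, ?_, hst⟩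
    · have : t - w = (t - o) - δ • (y - o) := by rw [hwd]; abel
      rw [hyw, this, cross_smul_left, cross_sub_right, cross_smul_right, cross_self, mul_zero,
        sub_zero]
      exact mul_ne_zero hδ'.ne' hAt
    · have : o + p • (y - o) = w + ((p - δ) / (1 - δ)) • (y - w) := by
        rw [hyw, smul_smul, div_mul_cancel₀ _ hδ'.ne', hwd]
        module
      rw [this]
      exact add_smul_mem_segment (div_nonneg (by linarith) hδ'.le)
        ((div_le_one hδ').2 (by linarith))

lemma collinear_of_cross {x y u v : EuclideanSpace ℝ (Fin 2)} (hxy : x ≠ y)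
    (hu : cross (y - x) (u - x) = 0) (hv : cross (y - x) (v - x) = 0) :
    Collinear ℝ {x, y, u, v} := by
  have he : y - x ≠ 0 := sub_ne_zero.2 hxy.symm
  rw [collinear_iff_of_mem (p₀ := x) (by simp)]
  refine ⟨y - x, ?_⟩
  obtain ⟨a, ha⟩ := eq_smul_of_cross_eq_zero he hu
  obtain ⟨b, hb⟩ := eq_smul_of_cross_eq_zero he hv
  rintro p (rfl | rfl | rfl | rfl)
  · exact ⟨0, by simp⟩
  · exact ⟨1, by simp⟩
  · exact ⟨a, by rw [← ha]; simp⟩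
  · exact ⟨b, by rw [← hb]; simp⟩

/-- Source and target on different lines. -/
theorem IsSimple.guarded_of_not_collinear (hP : P.IsSimple) {x y u v : EuclideanSpace ℝ (Fin 2)}
    (hS : segment ℝ x y ⊆ P.region) (hT : segment ℝ u v ⊆ P.region) (hxy : x ≠ y) (huv : u ≠ v)
    (hcol : ¬ Collinear ℝ {x, y, u, v})
    (hvis : ∀ t ∈ segment ℝ u v, ∃ s ∈ segment ℝ x y, t ∈ P.visibilityPolygon s)
    {N : ℕ} (hN : 0 < N) (hw : ENNReal.ofReal (‖y - x‖ / N) ≤ P.shortWidth) :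
    P.Guarded (segment ℝ x y) (5 + 24 * N) (segment ℝ u v) := by
  -- Two target points on the source line would make the segments collinear, so at most one point is
  -- lost here.
  have hline : P.Guarded (segment ℝ x y) 1
      {t | t ∈ segment ℝ u v ∧ cross (y - x) (t - x) = 0} := by
    refine Guarded.of_subsingleton ?_ fun t ht => hvis t ht.1
    rintro t ⟨ht, hct⟩ t' ⟨ht', hct'⟩
    by_contra hne
    obtain ⟨q, -, -, rfl⟩ := exists_of_mem_segment ht
    obtain ⟨q', -, -, rfl⟩ := exists_of_mem_segment ht'
    have hqq : q - q' ≠ 0 := fun h => hne (by rw [sub_eq_zero.1 h])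
    have hexp : ∀ r : ℝ, cross (y - x) (u + r • (v - u) - x) =
        cross (y - x) (u - x) + r * cross (y - x) (v - u) := by
      intro r
      have : u + r • (v - u) - x = (u - x) + r • (v - u) := by abel
      rw [this, cross_add_right, cross_smul_right]
    rw [hexp] at hct hct'
    have hd : cross (y - x) (v - u) = 0 := by
      have : (q - q') * cross (y - x) (v - u) = 0 := by linarith
      exact (mul_eq_zero.1 this).resolve_left hqq
    have hu : cross (y - x) (u - x) = 0 := by rw [hd] at hct; linarith
    refine hcol (collinear_of_cross hxy hu ?_)
    have := hexp 1
    rw [hd, hu, one_smul, add_sub_cancel] at this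
    linarith
  have hoff : P.Guarded (segment ℝ x y) (4 + 24 * N) (P.seenOffLine x y u v) := by
    have hexp : ∀ r : ℝ, cross (x + r • (y - x) - u) (v - u) =
        cross (x - u) (v - u) + r * cross (y - x) (v - u) := by
      intro r
      have : x + r • (y - x) - u = (x - u) + r • (y - x) := by abel
      rw [this, cross_add_left, cross_smul_left]
    have hy1 : cross (y - u) (v - u) = cross (x - u) (v - u) + cross (y - x) (v - u) := by
      have := hexp 1
      rwa [one_smul, add_sub_cancel, one_mul] at this
    by_cases hB : 0 < cross (x - u) (v - u) * cross (y - u) (v - u)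
    · exact (hP.guarded_of_source_side hS hT hB hN hw).mono le_rfl (by omega) le_rfl
    rw [not_lt] at hB
    have hc : cross (y - x) (v - u) ≠ 0 := by
      intro hc
      rw [hy1, hc, add_zero] at hB
      have h0 : cross (x - u) (v - u) = 0 := by
        by_contra h
        exact absurd hB (not_le.2 (mul_self_pos.2 h))
      have hx' : cross (v - u) (x - u) = 0 := by rw [cross_comm, h0, neg_zero]
      have hy' : cross (v - u) (y - u) = 0 := by rw [cross_comm, hy1, hc, h0, add_zero, neg_zero]
      refine hcol ((collinear_of_cross huv hx' hy').subset ?_)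
      rintro p (rfl | rfl | rfl | rfl) <;> simp
    -- The source crosses the line of the target at parameter `r`, where the affine function below
    -- vanishes.
    obtain ⟨r, hr0, hr1, hr⟩ : ∃ r : ℝ, 0 ≤ r ∧ r ≤ 1 ∧
        cross (x - u) (v - u) + r * cross (y - x) (v - u) = 0 := by
      refine ⟨-cross (x - u) (v - u) / cross (y - x) (v - u), ?_, ?_, by field_simp; ring⟩
      · rw [hy1] at hB
        rcases lt_or_gt_of_ne hc with h | h
        · refine div_nonneg_of_nonpos ?_ h.le
          nlinarith
        · refine div_nonneg ?_ h.le
          nlinarith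
      · rw [hy1] at hB
        rcases lt_or_gt_of_ne hc with h | h
        · rw [div_le_one_of_neg h]
          nlinarith
        · rw [div_le_one h]
          nlinarith
    set o := x + r • (y - x) with hod
    have hoS : o ∈ segment ℝ x y := add_smul_mem_segment hr0 hr1
    have ho : cross (o - u) (v - u) = 0 := by rw [hexp]; exact hr
    -- one half of the source, from `o` to the end `z`
    have hhalf : ∀ (z : EuclideanSpace ℝ (Fin 2)) (c : ℝ), z ∈ segment ℝ x y → |c| ≤ 1 →
        z - o = c • (y - x) → P.Guarded (segment ℝ x y) (2 + 12 * N)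
          {t | t ∈ segment ℝ u v ∧ cross (y - x) (t - x) ≠ 0 ∧
            ∃ s ∈ segment ℝ o z, t ∈ P.visibilityPolygon s} := by
      intro z c hz hc1 hzo
      have hsub := segment_subset_segment hoS hz
      rcases eq_or_ne c 0 with rfl | hc0
      · rw [zero_smul, sub_eq_zero] at hzo
        refine (Guarded.of_forall hoS (Z := {t | t ∈ P.visibilityPolygon o})
          fun t ht => ht).mono le_rfl (by omega) ?_
        rintro t ⟨-, -, s, hs, hst⟩
        rw [hzo, segment_same, Set.mem_singleton_iff] at hs
        rwa [hs] at hst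
      · refine (hP.guarded_of_half (hsub.trans hS) hT ho ?_ hN ?_).mono hsub le_rfl ?_
        · rw [hzo, cross_smul_left]
          exact mul_ne_zero hc0 hc
        · refine le_trans (ENNReal.ofReal_le_ofReal ?_) hw
          gcongr
          rw [hzo, norm_smul, Real.norm_eq_abs]
          exact mul_le_of_le_one_left (norm_nonneg _) hc1
        · rintro t ⟨htT, hAt, hseen⟩
          refine ⟨htT, ?_, hseen⟩
          have : t - o = (t - x) - r • (y - x) := by rw [hod]; abel
          rw [hzo, this, cross_smul_left, cross_sub_right, cross_smul_right, cross_self, mul_zero,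
            sub_zero]
          exact mul_ne_zero hc0 hAt
    have h1 := hhalf y (1 - r) (right_mem_segment ..) (abs_le.2 ⟨by linarith, by linarith⟩)
      (by rw [hod]; module)
    have h2 := hhalf x (-r) (left_mem_segment ..) (abs_le.2 ⟨by linarith, by linarith⟩)
      (by rw [hod]; module)
    refine (h1.union h2).mono le_rfl (by omega) ?_
    rintro t ⟨htT, hAt, s, hs, hst⟩
    obtain ⟨p, hp0, hp1, rfl⟩ := exists_of_mem_segment hs
    rcases le_total r p with h | h
    · left
      refine ⟨htT, hAt, _, ?_, hst⟩
      rcases hr1.eq_or_lt with hr1 | hr1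
      · obtain rfl : p = r := le_antisymm (by linarith) h
        exact left_mem_segment ..
      have hr' : 0 < 1 - r := by linarith
      have : x + p • (y - x) = o + ((p - r) / (1 - r)) • (y - o) := by
        have e1 : y - o = (1 - r) • (y - x) := by rw [hod]; module
        rw [e1, smul_smul, div_mul_cancel₀ _ hr'.ne', hod]
        module
      rw [this]
      exact add_smul_mem_segment (div_nonneg (by linarith) hr'.le)
        ((div_le_one hr').2 (by linarith))
    · right
      refine ⟨htT, hAt, _, ?_, hst⟩
      rcases hr0.eq_or_lt with hr0 | hr0
      · obtain rfl : p = r := le_antisymm h (by linarith)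
        exact left_mem_segment ..
      have : x + p • (y - x) = o + ((r - p) / r) • (x - o) := by
        have e1 : x - o = (-r) • (y - x) := by rw [hod]; module
        rw [e1, smul_smul, mul_neg, div_mul_cancel₀ _ hr0.ne', hod]
        module
      rw [this]
      exact add_smul_mem_segment (div_nonneg (by linarith) hr0.le)
        ((div_le_one hr0).2 (by linarith))
  refine (hline.union hoff).mono le_rfl (by omega) fun t ht => ?_
  by_cases h : cross (y - x) (t - x) = 0
  · exact Or.inl ⟨ht, h⟩
  · exact Or.inr ⟨ht, h, hvis t ht⟩

/-- On the line of the source, beyond its end `y`, everything that is visible is visible from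
`y`. -/
lemma visible_from_end {x y : EuclideanSpace ℝ (Fin 2)} {p τ : ℝ} (hp1 : p ≤ 1)
    (hτ : 1 < τ) (h : x + τ • (y - x) ∈ P.visibilityPolygon (x + p • (y - x))) :
    x + τ • (y - x) ∈ P.visibilityPolygon y := by
  refine ⟨h.1, ?_⟩
  rintro z ⟨a, b, ha, hb, hab, rfl⟩
  apply h.2
  rw [openSegment_eq_image']
  have hpos : 0 < τ - p := by linarith
  refine ⟨(a * (1 - p) + b * (τ - p)) / (τ - p), ⟨?_, ?_⟩, ?_⟩
  · have : 0 ≤ a * (1 - p) := mul_nonneg ha.le (by linarith)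
    have : 0 < b * (τ - p) := by positivity
    exact div_pos (by linarith) hpos
  · rw [div_lt_one hpos]
    nlinarith
  · obtain rfl : b = 1 - a := by linarith
    have : x + τ • (y - x) - (x + p • (y - x)) = (τ - p) • (y - x) := by module
    simp only [this, smul_smul, div_mul_cancel₀ _ hpos.ne']
    module

/-- Disjoint source and target on a line. -/
theorem guarded_of_collinear {x y u v : EuclideanSpace ℝ (Fin 2)} (hxy : x ≠ y)
    (hcol : Collinear ℝ {x, y, u, v}) (hdisj : Disjoint (segment ℝ x y) (segment ℝ u v))
    (hvis : ∀ t ∈ segment ℝ u v, ∃ s ∈ segment ℝ x y, t ∈ P.visibilityPolygon s) :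
    P.Guarded (segment ℝ x y) 1 (segment ℝ u v) := by
  have hline : ∀ p ∈ ({x, y, u, v} : Set (EuclideanSpace ℝ (Fin 2))), ∃ a : ℝ,
      p = x + a • (y - x) := by
    obtain ⟨w, hw⟩ := (collinear_iff_of_mem (p₀ := x) (by simp)).1 hcol
    obtain ⟨c, hc⟩ := hw y (by simp)
    have hyx : y - x = c • w := by rw [hc]; simp
    have hc0 : c ≠ 0 := by
      rintro rfl
      rw [zero_smul, sub_eq_zero] at hyx
      exact hxy hyx.symm
    intro p hp
    obtain ⟨a, ha⟩ := hw p hp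
    refine ⟨a / c, ?_⟩
    rw [hyx, smul_smul, div_mul_cancel₀ _ hc0, ha, vadd_eq_add, add_comm]
  obtain ⟨a, ha⟩ := hline u (by simp)
  obtain ⟨b, hb⟩ := hline v (by simp)
  have hT : ∀ q : ℝ, u + q • (v - u) = x + ((1 - q) * a + q * b) • (y - x) := by
    intro q
    rw [ha, hb]
    module
  have hout : ∀ q : ℝ, 0 ≤ q → q ≤ 1 →
      ¬ (0 ≤ (1 - q) * a + q * b ∧ (1 - q) * a + q * b ≤ 1) := by
    rintro q h0 h1 ⟨h2, h3⟩
    refine Set.disjoint_left.1 hdisj (add_smul_mem_segment h2 h3) ?_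
    rw [← hT]
    exact add_smul_mem_segment h0 h1
  have ha' := hout 0 le_rfl zero_le_one
  have hb' := hout 1 zero_le_one le_rfl
  simp only [sub_zero, one_mul, zero_mul, add_zero, sub_self, zero_add, not_and_or, not_le] at ha' hb'
  -- If the end parameters `a` and `b` were not of the same strict sign, the target would contain
  -- `x`. So both are negative or both exceed 1, and the target lies beyond one end of the source.
  have hcross : ¬ a * b ≤ 0 := by
    intro hab
    have hne : a - b ≠ 0 := by
      intro h
      have : a = b := by linarith
      subst this
      rcases ha' with h | h <;> nlinarith
    have hq : (1 - a / (a - b)) * a + a / (a - b) * b = 0 := by field_simp; ring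
    refine hout (a / (a - b)) ?_ ?_ ⟨hq.ge, hq.le.trans zero_le_one⟩
    · rcases lt_or_gt_of_ne hne with h | h
      · exact div_nonneg_of_nonpos (by nlinarith) h.le
      · exact div_nonneg (by nlinarith) h.le
    · rcases lt_or_gt_of_ne hne with h | h
      · rw [div_le_one_of_neg h]; nlinarith
      · rw [div_le_one h]; nlinarith
  rcases ha' with ha' | ha' <;> rcases hb' with hb' | hb'
  · refine Guarded.of_forall (left_mem_segment ..) fun t ht => ?_
    obtain ⟨s, hs, hst⟩ := hvis t ht
    obtain ⟨q, hq0, hq1, rfl⟩ := exists_of_mem_segment ht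
    obtain ⟨p, hp0, hp1, rfl⟩ := exists_of_mem_segment hs
    rw [hT] at hst ⊢
    set τ := (1 - q) * a + q * b
    have hτ : τ < 0 := by
      rcases hq0.eq_or_lt with h | h
      · simp only [τ, ← h]; linarith
      · have := mul_neg_of_pos_of_neg h hb'
        have : (1 - q) * a ≤ 0 := mul_nonpos_of_nonneg_of_nonpos (by linarith) ha'.le
        linarith
    -- Reversing the parametrisation turns the part before `x` into the part beyond the second end.
    have hrev : ∀ r : ℝ, x + r • (y - x) = y + (1 - r) • (x - y) := fun r => by module
    rw [hrev τ, hrev p] at hst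
    rw [hrev τ]
    exact visible_from_end (by linarith) (by linarith) hst
  · exact absurd (by nlinarith) hcross
  · exact absurd (by nlinarith) hcross
  · refine Guarded.of_forall (right_mem_segment ..) fun t ht => ?_
    obtain ⟨s, hs, hst⟩ := hvis t ht
    obtain ⟨q, hq0, hq1, rfl⟩ := exists_of_mem_segment ht
    obtain ⟨p, hp0, hp1, rfl⟩ := exists_of_mem_segment hs
    rw [hT] at hst ⊢
    refine visible_from_end hp1 ?_ hst
    rcases hq0.eq_or_lt with h | h
    · rw [← h]; linarith
    · nlinarith

/-- A segment of the region is cut into `O(1 + AR)` pieces not longer than the short width. -/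
theorem IsSimple.exists_cells (hP : P.IsSimple) (hAR : P.lineAspectRatio ≠ ⊤)
    {x y : EuclideanSpace ℝ (Fin 2)} (hx : x ∈ P.region) (hy : y ∈ P.region) (hxy : x ≠ y) :
    ∃ N : ℕ, 0 < N ∧ ENNReal.ofReal (‖y - x‖ / N) ≤ P.shortWidth ∧
      (N : ℝ≥0∞) ≤ 2 * max 1 P.lineAspectRatio := by
  have hL := hP.le_longWidth hx hy
  have hn : 0 < ‖y - x‖ := norm_pos_iff.2 (sub_ne_zero.2 hxy.symm)
  have hone : (1 : ℝ≥0∞) ≤ 2 * max 1 P.lineAspectRatio :=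
    calc (1 : ℝ≥0∞) ≤ 2 * 1 := by norm_num
      _ ≤ _ := by gcongr; exact le_max_left _ _
  by_cases hW : P.shortWidth = ⊤
  · exact ⟨1, one_pos, by simp [hW], by simpa using hone⟩
  set w := P.shortWidth.toReal with hw
  have hWw : P.shortWidth = ENNReal.ofReal w := (ENNReal.ofReal_toReal hW).symm
  -- A zero short width would make the ratio infinite, as the long width is positive.
  have hw0 : 0 < w := by
    refine ENNReal.toReal_nonneg.lt_of_ne' fun h0 => hAR ?_
    rw [lineAspectRatio, hWw, hw, h0, ENNReal.ofReal_zero, ENNReal.div_zero]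
    exact ((ENNReal.ofReal_pos.2 hn).trans_le hL).ne'
  have hratio : ENNReal.ofReal (‖y - x‖ / w) ≤ P.lineAspectRatio := by
    rw [ENNReal.ofReal_div_of_pos hw0, lineAspectRatio, hWw]
    gcongr
  have hq : 0 < ‖y - x‖ / w := by positivity
  have hceil : 0 < ⌈‖y - x‖ / w⌉₊ := Nat.ceil_pos.2 hq
  -- Rounding up costs at most 1, whence the factor 2.
  refine ⟨⌈‖y - x‖ / w⌉₊, hceil, ?_, ?_⟩
  · rw [hWw]
    refine ENNReal.ofReal_le_ofReal ?_
    rw [div_le_iff₀ (by exact_mod_cast hceil), ← div_le_iff₀' hw0]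
    exact Nat.le_ceil _
  · calc ((⌈‖y - x‖ / w⌉₊ : ℕ) : ℝ≥0∞) = ENNReal.ofReal (⌈‖y - x‖ / w⌉₊ : ℝ) :=
          (ENNReal.ofReal_natCast _).symm
      _ ≤ ENNReal.ofReal (‖y - x‖ / w + 1) :=
          ENNReal.ofReal_le_ofReal (Nat.ceil_lt_add_one hq.le).le
      _ = ENNReal.ofReal (‖y - x‖ / w) + 1 := by
          rw [ENNReal.ofReal_add hq.le zero_le_one, ENNReal.ofReal_one]
      _ ≤ max 1 P.lineAspectRatio + max 1 P.lineAspectRatio :=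
          add_le_add (hratio.trans (le_max_right _ _)) (le_max_left _ _)
      _ = 2 * max 1 P.lineAspectRatio := (two_mul _).symm

end

end Polygon

end

theorem theorem1 :
    ∃ C : ℝ≥0, ∀ (n : ℕ) (P : Polygon (EuclideanSpace ℝ (Fin 2)) n),
      P.IsSimple → P.lineAspectRatio ≠ ⊤ →
      ∀ x y u v : EuclideanSpace ℝ (Fin 2),
        segment ℝ x y ⊆ P.region → segment ℝ u v ⊆ P.region →
        (Collinear ℝ {x, y, u, v} → Disjoint (segment ℝ x y) (segment ℝ u v)) →
        (∀ t ∈ segment ℝ u v, ∃ s ∈ segment ℝ x y, t ∈ P.visibilityPolygon s) →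
        ∃ S : Finset (EuclideanSpace ℝ (Fin 2)),
          (S : Set (EuclideanSpace ℝ (Fin 2))) ⊆ segment ℝ x y ∧
          (S.card : ℝ≥0∞) ≤ C * max 1 P.lineAspectRatio ∧
          segment ℝ u v ⊆ ⋃ s ∈ S, P.visibilityPolygon s := by
  -- There are `5 + 24 * N ≤ 29 * N` guards, and `N` is at most twice the maximum of 1 and the
  -- ratio: 58 = 29 · 2. Degenerate and collinear segments need one guard.
  refine ⟨58, fun n P hP hAR x y u v hS hT hcol hvis => ?_⟩
  suffices h : ∃ k : ℕ, P.Guarded (segment ℝ x y) k (segment ℝ u v) ∧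
      (k : ℝ≥0∞) ≤ 58 * max 1 P.lineAspectRatio by
    obtain ⟨k, ⟨G, h1, h2, h3⟩, hk⟩ := h
    refine ⟨G, h1, (Nat.cast_le.2 h2).trans hk, fun t ht => ?_⟩
    obtain ⟨g, hg, hgt⟩ := h3 t ht
    exact Set.mem_biUnion hg hgt
  have hone : ((1 : ℕ) : ℝ≥0∞) ≤ 58 * max 1 P.lineAspectRatio :=
    calc ((1 : ℕ) : ℝ≥0∞) ≤ 58 * 1 := by norm_num
      _ ≤ _ := by gcongr; exact le_max_left _ _
  rcases eq_or_ne x y with rfl | hxy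
  · refine ⟨1, Polygon.Guarded.of_forall (left_mem_segment ..) fun t ht => ?_, hone⟩
    obtain ⟨s, hs, hst⟩ := hvis t ht
    rw [segment_same, Set.mem_singleton_iff] at hs
    rwa [hs] at hst
  rcases eq_or_ne u v with rfl | huv
  · exact ⟨1, Polygon.Guarded.of_subsingleton (by rw [segment_same]; exact Set.subsingleton_singleton)
      hvis, hone⟩
  by_cases hc : Collinear ℝ {x, y, u, v}
  · exact ⟨1, Polygon.guarded_of_collinear hxy hc (hcol hc) hvis, hone⟩
  obtain ⟨N, hN, hw, hNle⟩ := hP.exists_cells hAR (hS (left_mem_segment ..))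
    (hS (right_mem_segment ..)) hxy
  refine ⟨5 + 24 * N, hP.guarded_of_not_collinear hS hT hxy huv hc hvis hN hw, ?_⟩
  calc ((5 + 24 * N : ℕ) : ℝ≥0∞) ≤ ((29 * N : ℕ) : ℝ≥0∞) := Nat.cast_le.2 (by omega)
    _ = 29 * (N : ℝ≥0∞) := by push_cast; rfl
    _ ≤ 29 * (2 * max 1 P.lineAspectRatio) := by gcongr
    _ = 58 * max 1 P.lineAspectRatio := by rw [← mul_assoc]; norm_num
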